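/- \textbf{Theorem (Privacy Against a Malicious Server).} Throughout, $\lambda$ is the security parameter, and a function $f(\lambda)$ is negligible if $f=o(1/\lambda^c)$ for every $c\in\mathbb N$. A PPT algorithm runs in probabilistic polynomial time in $\lambda$ and the length of its input; as an interactive machine it does so whatever messages it receives. \emph{Primitives.} PIR and 1-out-of-$n$ OT are two-party protocols in which a receiver with an index $i\in\{0,\dots,n-1\}$ retrieves the $i$-th record of a sender's database, with an efficient receiver and polynomially many rounds. Such a protocol is \emph{private against a malicious server} if for every non-uniform PPT server $\mathcal B$ (which may deviate from the protocol), all polynomially bounded numbers $n$ and lengths $m$ of the records, all databases $\mathcal D$ of polynomial length and all indices $i,i'<n$ (all depending on $\lambda$), the views of $\mathcal B$ in its executions with the honest receiver on $i$ and on $i'$ are computationally indistinguishable. \emph{Public parameters} (of polynomial size in $\lambda$): a directed graph $\mathcal G$ with vertex set $V$, $|V|=n\ge 1$, in which each vertex has at most one neighbor in each of the directions $\textsc n,\textsc e,\textsc s,\textsc w$; the number of columns $d$; a bit-length bound $\tau$; a statistical security parameter $\mu$; a prime $p>2^{\tau+\mu+1}$; the number of rounds $R$; the lengths of keys, ciphertexts,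 wire encodings and records, and the numbers of rounds of the subprotocols. The client's input is $(s,t)\in V^2$; the server's input consists of matrices $A^{\textsc{ne}},B^{\textsc{ne}},A^{\textsc{nw}},B^{\textsc{nw}}\in\mathbb Z^{n\times d}$ such that the entries of $A^{\textsc{ne}}(B^{\textsc{ne}})^T$ and $A^{\textsc{nw}}(B^{\textsc{nw}})^T$ have bit-length at most $\tau$. \emph{The protocol $\pi$} (honest client). Setup: the client retrieves by two OTs the record $s$ from a database of source keys and the record $t$ from a database of destination keys. Then, in each of $R$ rounds, where $s$ is the current vertex: (1) it retrieves by PIR record $s$ of a source database and record $t$ of a destination database, decrypts them with the current source key and with the destination key, and parses them into affine encodings $(x_j)$, $(y_j)$ of two pairs of vectors over $\mathbb F_p$, wire encodings of $s$ and $t$, and four encrypted keys $\kappa_{\textsc n},\kappa_{\textsc e},\kappa_{\textsc s},\kappa_{\textsc w}$; (2) it computes $z=\sum_j (x_{j,1}y_{j,1}+x_{j,2}+y_{j,2})$ for each of the two pairs, or picks $z_{\textsc{ne}},z_{\textsc{nw}}\in\mathbb F_p$ uniformly at random if a record is malformed; (3) it retrieves wire encodings for the bits of $z_{\textsc{ne}},z_{\textsc{nw}}$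 by a series of 1-out-of-2 OTs; (4) it receives a garbled circuit and the encodings of the server's inputs to it, and evaluates it. If this yields bits $b_{\textsc{ne}},b_{\textsc{nw}}$ and PRF keys $k_{\textsc{ne}},k_{\textsc{nw}}$, let $\mathsf{dir}$ be the direction with index $(b_{\textsc{ne}},b_{\textsc{nw}})$, where $(0,0),(0,1),(1,0),(1,1)$ stand for $\textsc n,\textsc e,\textsc w,\textsc s$. The client outputs the neighbor of $s$ in direction $\mathsf{dir}$ and moves there (or outputs $\perp$ and stays at $s$ if there is none), and takes the decryption of $\kappa_{\mathsf{dir}}$ under $F(k_{\textsc{ne}},\mathsf{dir})\oplus F(k_{\textsc{nw}},\mathsf{dir})$ as its next source key. If an OT of step (3), the parsing or the evaluation fails, or the output of the circuit is $\perp$, it outputs $\perp$, stays at $s$, continues, and picks the next source key uniformly at random. No security of the encryption scheme, of the PRF $F$ or of the garbling scheme is assumed. \emph{Privacy game.} An environment $\mathcal E=\{\mathcal E_\lambda\}$, a family of polynomial-size Boolean circuits, chooses the inputs of both parties. In the real world, $\mathcal A$ plays the server against the honest client of $\pi$, knows $1^\lambda$, the public parameters and the server's input, and finally gives an output computed from its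 view to $\mathcal E$. In the ideal world, the client and a simulator $\mathcal S$, which has the same inputs as $\mathcal A$, submit inputs to a trusted party for the shortest-paths functionality $f$: from the matrices it computes the path of the first $R$ hops from $s$ to $t$, gives it to the client, and gives nothing to $\mathcal S$; then $\mathcal S$ gives an output to $\mathcal E$. In both worlds $\mathcal E$ sees only this output, and not the client's, and outputs a bit, denoted $\mathsf{REAL}'_{\pi,\mathcal A,\mathcal E}(\lambda)$ and $\mathsf{IDEAL}'_{f,\mathcal S,\mathcal E}(\lambda)$. Put \[ \mathsf{Adv}^{\mathrm{priv}}_{\pi,f,\mathcal A,\mathcal S,\mathcal E}(\lambda)=\bigl|\Pr[\mathsf{REAL}'_{\pi,\mathcal A,\mathcal E}(\lambda)=0]-\Pr[\mathsf{IDEAL}'_{f,\mathcal S,\mathcal E}(\lambda)=0]\bigr|. \] \emph{Claim.} Let $\pi$ be instantiated with a PIR and an OT protocol that are private against a malicious server. Then for every PPT adversary $\mathcal A$ corrupting the server there is a PPT simulator $\mathcal S$ such that for every polynomial-size circuit family $\mathcal E$ the advantage $\mathsf{Adv}^{\mathrm{priv}}_{\pi,f,\mathcal A,\mathcal S,\mathcal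 E}(\lambda)$ is negligible in $\lambda$. -/

import Mathlib

/-! ## Negligible and polynomially bounded functions -/

namespace PrivateRouting

/-- `f` is negligible: `f = o(1 / k ^ c)` for every natural number `c`. -/
def Negligible (f : ℕ → ℝ) : Prop :=
  ∀ c : ℕ, f =o[Filter.atTop] fun k : ℕ => 1 / (k : ℝ) ^ c

def PolyBounded (f : ℕ → ℕ) : Prop :=
  ∃ q : Polynomial ℕ, ∀ k, f k ≤ q.eval k

/-! ## Probabilistic machines with a step count

A machine has registers `0, 1, 2, …`, each holding a stack of bits, and a finite structured program.
Every elementary step touches the top of one stack or the control, so it costs what a step of a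
multitape Turing machine costs. -/

abbrev Str := List Bool

abbrev Store := ℕ → Str

inductive Cmd : Type
  | skip : Cmd
  | push (b : Bool) (r : ℕ) : Cmd
  | pop (r : ℕ) : Cmd
  /-- push a fresh uniformly random bit -/
  | toss (r : ℕ) : Cmd
  | seq (c d : Cmd) : Cmd
  /-- three-way branch: register empty, top bit `false`, top bit `true` -/
  | branch (r : ℕ) (cEmpty cFalse cTrue : Cmd) : Cmd
  /-- repeat the body as long as the register is nonempty -/
  | loop (r : ℕ) (c : Cmd) : Cmd

/-- The commands still to be executed, and the current store. -/
abbrev Config := List Cmd × Store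

/-- One step of the machine. A configuration with nothing left to do has halted. -/
noncomputable def step : Config → PMF Config
  | ([], σ) => PMF.pure ([], σ)
  | (Cmd.skip :: K, σ) => PMF.pure (K, σ)
  | (Cmd.push b r :: K, σ) => PMF.pure (K, Function.update σ r (b :: σ r))
  | (Cmd.pop r :: K, σ) => PMF.pure (K, Function.update σ r (σ r).tail)
  | (Cmd.toss r :: K, σ) =>
      (PMF.uniformOfFintype Bool).map fun b => (K, Function.update σ r (b :: σ r))
  | (Cmd.seq c d :: K, σ) => PMF.pure (c :: d :: K, σ)
  | (Cmd.branch r cEmpty cFalse cTrue :: K, σ) =>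
      match σ r with
      | [] => PMF.pure (cEmpty :: K, σ)
      | false :: _ => PMF.pure (cFalse :: K, σ)
      | true :: _ => PMF.pure (cTrue :: K, σ)
  | (Cmd.loop r c :: K, σ) =>
      match σ r with
      | [] => PMF.pure (K, σ)
      | _ :: _ => PMF.pure (c :: Cmd.loop r c :: K, σ)

/-- The configuration after `T` steps. -/
noncomputable def steps : ℕ → Config → PMF Config
  | 0, x => PMF.pure x
  | T + 1, x => (step x).bind (steps T)

/-- Started on `σ`, the program halts within `T` steps, whatever its coins are. -/
def HaltsIn (c : Cmd) (σ : Store) (T : ℕ) : Prop :=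
  ∀ x ∈ (steps T ([c], σ)).support, x.1 = []

open Classical in
/-- The distribution of the final store of a program (for a program which, from `σ`, has
no bound on its running time, the value is immaterial and set to `σ`). -/
noncomputable def exec (c : Cmd) (σ : Store) : PMF Store :=
  if h : ∃ T, HaltsIn c σ T then (steps (Nat.find h) ([c], σ)).map Prod.snd else PMF.pure σ

/-! ### Interactive machines

An interactive machine is a program that is run again at each activation on the store which it
left behind. Register `0` holds the incoming message, register `1` receives the outgoing one. -/

/-- Deliver a message: it is put in register `0`, and register `1` is emptied. -/
def deliver (σ : Store) (msg : Str) : Store :=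
  Function.update (Function.update σ 0 msg) 1 []

/-- `Reach c σ₀ L σ`: for some incoming messages and some coins, the machine `c` with initial store
`σ₀` starts an activation on the store `σ`; `L` is the number of messages received so far plus
their total length. -/
inductive Reach (c : Cmd) (σ₀ : Store) : ℕ → Store → Prop
  | first (msg : Str) : Reach c σ₀ (msg.length + 1) (deliver σ₀ msg)
  | next {L : ℕ} {σ σ' : Store} (h : Reach c σ₀ L σ) (h' : σ' ∈ (exec c σ).support) (msg : Str) :
      Reach c σ₀ (L + (msg.length + 1)) (deliver σ' msg)

def ones (k : ℕ) : Str := List.replicate k true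

/-- `k` rounds of interaction of a server with a receiver. In each round the server is activated
with the receiver's last message, and then the receiver with the server's answer. Returns both
stores and the receiver's last message. -/
noncomputable def interact (server receiver : Cmd) :
    ℕ → Store → Store → Str → PMF (Store × Store × Str)
  | 0, σ, ρ, msg => PMF.pure (σ, ρ, msg)
  | k + 1, σ, ρ, msg => do
      let σ' ← exec server (deliver σ msg)
      let ρ' ← exec receiver (deliver ρ (σ' 1))
      interact server receiver k σ' ρ' (ρ' 1)

/-! ## Computational indistinguishability -/

/-- Input of a distinguisher: the sample in register `0` and `1 ^ k` in register `2`. -/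
def distStore (k : ℕ) (w : Str) : Store
  | 0 => w
  | 2 => ones k
  | _ => []

/-- A probabilistic polynomial-time distinguisher. -/
def IsPPTDistinguisher (c : Cmd) : Prop :=
  ∃ q : Polynomial ℕ, ∀ (k : ℕ) (w : Str), HaltsIn c (distStore k w) (q.eval (k + w.length))

/-- The probability that the distinguisher writes `1` on a sample of `X`. -/
noncomputable def acceptProb (c : Cmd) (k : ℕ) (X : PMF Str) : ℝ :=
  ((X.bind fun w => (exec c (distStore k w)).map fun σ => σ 1) [true]).toReal

def CompIndist (X Y : ℕ → PMF Str) : Prop :=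
  ∀ c : Cmd, IsPPTDistinguisher c →
    Negligible fun k => |acceptProb c k (X k) - acceptProb c k (Y k)|

/-! ## Retrieval protocols: PIR and 1-out-of-`n` OT -/

/-- A two-party protocol in which a receiver with an index `i < n` retrieves the `i`-th of
the `n` records, each of `m` bits, which a sender holds. `rounds k n m` is its number
of rounds for the security parameter `k`. -/
structure RetrievalProtocol where
  sender : Cmd
  receiver : Cmd
  rounds : ℕ → ℕ → ℕ → ℕ

namespace RetrievalProtocol

/-- Initial store of the receiver. -/
def receiverStore (k n m i : ℕ) : Store
  | 2 => ones k
  | 3 => ones n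
  | 4 => ones m
  | 5 => Nat.bits i
  | _ => []

/-- An execution of the receiver on index `i` with an arbitrary server, whose current store is `σ`.
When the last round is over, the server is activated once more, on the receiver's last message.
Returns the server's store and the receiver's output, which is found in register `6`. -/
noncomputable def run (P : RetrievalProtocol) (server : Cmd) (k n m i : ℕ) (σ : Store) :
    PMF (Store × Str) := do
  let (σ₁, ρ, msg) ← interact server P.receiver (P.rounds k n m) σ (receiverStore k n m i) []
  let σ₂ ← exec server (deliver σ₁ msg)
  return (σ₂, ρ 6)

/-- The number of rounds is polynomial, and the receiver runs in probabilistic polynomial time in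
the length of its input and of the messages that it receives. -/
def IsEfficient (P : RetrievalProtocol) : Prop :=
  ∃ q : Polynomial ℕ, ∀ k n m : ℕ, P.rounds k n m ≤ q.eval (k + n + m) ∧
    ∀ i < n, ∀ (L : ℕ) (ρ : Store), Reach P.receiver (receiverStore k n m i) L ρ →
      HaltsIn P.receiver ρ (q.eval (k + n + m + L))

/-- Initial store of a server in the privacy game: security parameter, number and length of the
records, database, and, in all the remaining registers, the advice of a non-uniform server. -/
def serverStore (k n m : ℕ) (D : Str) (advice : Store) : Store
  | 0 => []
  | 1 => []
  | 2 => ones k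
  | 3 => ones n
  | 4 => ones m
  | 5 => D
  | r => advice r

/-- What the server outputs after an execution with the receiver on index `i`: a function, computed
by the server itself, of its view (input, coins, and messages received). -/
noncomputable def view (P : RetrievalProtocol) (server : Cmd) (k n m : ℕ) (D : Str)
    (advice : Store) (i : ℕ) : PMF Str :=
  (P.run server k n m i (serverStore k n m D advice)).map fun x => x.1 1

/-- Privacy against a malicious server: no non-uniform PPT server, which may deviate from
the protocol, has computationally distinguishable views for two indices. As all servers are
considered, among them the ones that output everything they have seen, this is
indistinguishability of the whole view. -/
def IsPrivate (P : RetrievalProtocol) : Prop :=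
  ∀ (server : Cmd) (n m : ℕ → ℕ) (D : ℕ → Str) (advice : ℕ → Store) (i i' : ℕ → ℕ),
    PolyBounded n → PolyBounded m → PolyBounded (fun k => (D k).length) →
    (∃ q : Polynomial ℕ, ∀ k r, (advice k r).length ≤ q.eval k) →
    (∃ q : Polynomial ℕ, ∀ (k L : ℕ) (σ : Store),
      Reach server (serverStore k (n k) (m k) (D k) (advice k)) L σ →
        HaltsIn server σ (q.eval k)) →
    (∀ k, i k < n k) → (∀ k, i' k < n k) →
    CompIndist (fun k => P.view server k (n k) (m k) (D k) (advice k) (i k))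
      (fun k => P.view server k (n k) (m k) (D k) (advice k) (i' k))

end RetrievalProtocol

/-! ## Public parameters and inputs of the routing protocol -/

inductive Dir : Type
  | north | east | south | west

def indexToDirection : Bool → Bool → Dir
  | false, false => Dir.north
  | true, false => Dir.west
  | false, true => Dir.east
  | true, true => Dir.south

/-- Everything that both parties know. -/
structure PublicParams where
  /-- number of vertices; the vertex set is `Fin n` -/
  n : ℕ
  n_pos : 0 < n
  /-- structure of the graph: the neighbor (if any) of a vertex in each direction -/
  nbr : Fin n → Dir → Option (Fin n)
  /-- number of columns of the compressed routing matrices -/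
  d : ℕ
  /-- bound on the bit-length of the entries of the matrix products -/
  τ : ℕ
  /-- statistical security parameter -/
  μ : ℕ
  /-- number of rounds -/
  R : ℕ
  /-- length of the encryption keys -/
  keyLen : ℕ
  /-- length of the PRF keys -/
  prfKeyLen : ℕ
  /-- order of the finite field -/
  p : ℕ
  p_prime : p.Prime
  p_large : 2 ^ (τ + μ + 1) < p
  /-- length of one garbled-circuit wire encoding -/
  labelLen : ℕ
  /-- length of an encryption of a source key -/
  ctLen : ℕ
  /-- length of the (encrypted) records of the source database -/
  srcLen : ℕ
  /-- length of the (encrypted) records of the destination database -/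
  dstLen : ℕ

namespace PublicParams

instance (pp : PublicParams) : NeZero pp.p := ⟨pp.p_prime.ne_zero⟩

/-- number of bits of an element of the field -/
def fieldBits (pp : PublicParams) : ℕ := Nat.clog 2 pp.p

/-- number of bits of a vertex -/
def nodeBits (pp : PublicParams) : ℕ := Nat.clog 2 pp.n

/-- The quantity that has to be polynomial in the security parameter (`τ` and `μ` are
smaller than the bit-length of `p`). -/
def size (pp : PublicParams) : ℕ :=
  pp.n + pp.d + pp.R + pp.keyLen + pp.prfKeyLen + Nat.size pp.p + pp.labelLen + pp.ctLen +
    pp.srcLen + pp.dstLen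

end PublicParams

/-- The server's input: the compressed next-hop routing matrices. -/
structure ServerInput (pp : PublicParams) where
  A_ne : Matrix (Fin pp.n) (Fin pp.d) ℤ
  B_ne : Matrix (Fin pp.n) (Fin pp.d) ℤ
  A_nw : Matrix (Fin pp.n) (Fin pp.d) ℤ
  B_nw : Matrix (Fin pp.n) (Fin pp.d) ℤ

instance (pp : PublicParams) : Nonempty (ServerInput pp) := ⟨⟨0, 0, 0, 0⟩⟩

/-- All entries of the two matrix products have bit-length at most `τ`. -/
def ServerInput.Valid {pp : PublicParams} (x : ServerInput pp) : Prop :=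
  ∀ u v, Nat.size ((x.A_ne * x.B_ne.transpose) u v).natAbs ≤ pp.τ ∧
    Nat.size ((x.A_nw * x.B_nw.transpose) u v).natAbs ≤ pp.τ

/-- Self-delimiting code of an integer: sign, then every bit of the absolute value preceded by
`true`, then `false`. -/
def encodeInt (z : ℤ) : Str :=
  decide (z < 0) :: ((Nat.bits z.natAbs).flatMap fun b => [true, b]) ++ [false]

def encodeMatrix {n d : ℕ} (M : Matrix (Fin n) (Fin d) ℤ) : Str :=
  (List.finRange n).flatMap fun u => (List.finRange d).flatMap fun j => encodeInt (M u j)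

def ServerInput.encode {pp : PublicParams} (x : ServerInput pp) : Str :=
  encodeMatrix x.A_ne ++ encodeMatrix x.B_ne ++ encodeMatrix x.A_nw ++ encodeMatrix x.B_nw

/-- The list of the neighbors of all vertices in all directions; `none` is coded by `0`, and the
vertex `v` by `1 ^ (v + 1) 0`. -/
def encodeGraph (pp : PublicParams) : Str :=
  (List.finRange pp.n).flatMap fun u =>
    [Dir.north, Dir.east, Dir.south, Dir.west].flatMap fun dir =>
      match pp.nbr u dir with
      | none => [false]
      | some v => ones (v + 1) ++ [false]

/-- Initial store of the corrupted server, and likewise of a simulator: the security parameter, the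
public parameters (with the public numbers of rounds of the subprotocols), and the server's
input. -/
def corruptStore (pir ot : RetrievalProtocol) (k : ℕ) (pp : PublicParams) (x : ServerInput pp) :
    Store
  | 2 => ones k
  | 3 => ones pp.n
  | 4 => encodeGraph pp
  | 5 => ones pp.d
  | 6 => ones pp.τ
  | 7 => ones pp.μ
  | 8 => ones pp.R
  | 9 => ones pp.keyLen
  | 10 => ones pp.prfKeyLen
  | 11 => Nat.bits pp.p
  | 12 => ones pp.labelLen
  | 13 => ones pp.ctLen
  | 14 => ones pp.srcLen
  | 15 => ones pp.dstLen
  | 16 => ones pp.fieldBits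
  | 17 => ones (ot.rounds k pp.n pp.keyLen)
  | 18 => ones (pir.rounds k pp.n pp.srcLen)
  | 19 => ones (pir.rounds k pp.n pp.dstLen)
  | 20 => ones (ot.rounds k 2 pp.labelLen)
  | 21 => x.encode
  | _ => []

/-- A PPT server in the routing protocol: whatever messages it receives, each activation takes time
polynomial in the security parameter and the length of its input. -/
def IsPPTServer (pir ot : RetrievalProtocol) (pp : ℕ → PublicParams) (c : Cmd) : Prop :=
  ∃ q : Polynomial ℕ, ∀ (k : ℕ) (x : ServerInput (pp k)) (L : ℕ) (σ : Store),
    Reach c (corruptStore pir ot k (pp k) x) L σ → HaltsIn c σ (q.eval (k + x.encode.length))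

/-- A PPT simulator in the ideal world. -/
def IsPPTSimulator (pir ot : RetrievalProtocol) (pp : ℕ → PublicParams) (c : Cmd) : Prop :=
  ∃ q : Polynomial ℕ, ∀ (k : ℕ) (x : ServerInput (pp k)),
    HaltsIn c (corruptStore pir ot k (pp k) x) (q.eval (k + x.encode.length))

/-! ## The honest client -/

/-- The algorithms that the client applies locally: decryption, the PRF, and evaluation of a garbled
circuit on a list of wire encodings (`none` if the evaluation fails). -/
structure LocalAlgorithms where
  dec : Str → Str → Str
  prf : Str → Dir → Str
  evalGarbled : Str → List Str → Option Str

/-- The first `k` consecutive blocks of `w` bits. -/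
def blocks (k w : ℕ) (l : Str) : List Str :=
  (List.range k).map fun j => (l.drop (j * w)).take w

/-- The number with the given binary digits, least significant first. -/
def ofBits (l : Str) : ℕ := l.foldr Nat.bit 0

/-- The `w` low bits of a number, least significant first. -/
def toBits (w a : ℕ) : Str := (List.range w).map a.testBit

/-- Affine encodings of a vector: one pair of field elements for each coordinate. -/
abbrev AffineEncoding (pp : PublicParams) := Fin pp.d → ZMod pp.p × ZMod pp.p

/-- Evaluation of the arithmetic circuit from the encodings of both vectors. -/
def evalAffine {pp : PublicParams} (x y : AffineEncoding pp) : ZMod pp.p :=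
  ∑ i, ((x i).1 * (y i).1 + (x i).2 + (y i).2)

/-- The plain contents of a record: two affine encodings, the wire encodings of the vertex,
and what follows (in the source database the encrypted keys of the neighbors). -/
structure RecordContents (pp : PublicParams) where
  aff_ne : AffineEncoding pp
  aff_nw : AffineEncoding pp
  nodeLabels : List Str
  rest : Str

/-- Parsing of a decrypted record in which `restLen` bits follow the wire encodings. It fails when the
length is wrong or one of the field elements is not reduced modulo `p`. -/
def parseRecord (pp : PublicParams) (restLen : ℕ) (r : Str) : Option (RecordContents pp) :=
  let w := pp.fieldBits
  let affLen := 4 * pp.d * w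
  let elt : ℕ → ℕ := fun j => ofBits ((r.drop (j * w)).take w)
  if r.length = affLen + pp.nodeBits * pp.labelLen + restLen ∧ ∀ j < 4 * pp.d, elt j < pp.p then
    some
      { aff_ne := fun i => ((elt (2 * i) : ZMod pp.p), (elt (2 * i + 1) : ZMod pp.p))
        aff_nw := fun i =>
          ((elt (2 * pp.d + 2 * i) : ZMod pp.p), (elt (2 * pp.d + 2 * i + 1) : ZMod pp.p))
        nodeLabels := blocks pp.nodeBits pp.labelLen (r.drop affLen)
        rest := r.drop (affLen + pp.nodeBits * pp.labelLen) }
  else none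

/-- The encrypted key for a direction in the last part of a source record. -/
def keyCiphertext (pp : PublicParams) (rest : Str) (dir : Dir) : Str :=
  let j := match dir with
    | Dir.north => 0
    | Dir.east => 1
    | Dir.south => 2
    | Dir.west => 3
  (rest.drop (j * pp.ctLen)).take pp.ctLen

/-- What the client obtains from the garbled circuit. The server's message consists of the wire
encodings of the four unblinding coefficients and of the four PRF keys, and of the garbled circuit.
The result is `none` if one of the parts is missing or malformed, the evaluation fails, or the
output of the circuit is `⊥` (first bit `0`). -/
def evalUnblind (pp : PublicParams) (alg : LocalAlgorithms) (zLabels : List Str)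
    (src dst : RecordContents pp) (msg : Str) : Option (Bool × Bool × Str × Str) :=
  let count := 4 * pp.fieldBits + 4 * pp.prfKeyLen
  if (∀ l ∈ zLabels, l.length = pp.labelLen) ∧ count * pp.labelLen ≤ msg.length then
    match alg.evalGarbled (msg.drop (count * pp.labelLen))
        (zLabels ++ blocks count pp.labelLen msg ++ src.nodeLabels ++ dst.nodeLabels) with
    | some (true :: b_ne :: b_nw :: keys) =>
        if keys.length = 2 * pp.prfKeyLen then
          some (b_ne, b_nw, keys.take pp.prfKeyLen, keys.drop pp.prfKeyLen)
        else none
    | _ => none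
  else none

noncomputable def uniformStr (l : ℕ) : PMF Str :=
  (PMF.uniformOfFintype (Fin l → Bool)).map List.ofFn

/-- The client's 1-out-of-2 OTs, one for each of the given choice bits. -/
noncomputable def runOTs (ot : RetrievalProtocol) (server : Cmd) (k m : ℕ) :
    List Bool → Store → PMF (Store × List Str)
  | [], σ => PMF.pure (σ, [])
  | b :: bs, σ => do
      let (σ₁, l) ← ot.run server k 2 m b.toNat σ
      let (σ₂, ls) ← runOTs ot server k m bs σ₁
      return (σ₂, l :: ls)

/-- One round of the protocol, for an honest client at the vertex `s` with source key `kSrc`, against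
a server with current store `σ`. Returns the server's store, the client's next vertex and
next source key, and the client's output in this round. -/
noncomputable def clientRound (pir ot : RetrievalProtocol) (alg : LocalAlgorithms) (server : Cmd)
    (k : ℕ) (pp : PublicParams) (t : Fin pp.n) (kDst : Str) (s : Fin pp.n) (kSrc : Str)
    (σ : Store) : PMF (Store × Fin pp.n × Str × Option (Fin pp.n)) := do
  let (σ₁, cSrc) ← pir.run server k pp.n pp.srcLen s σ
  let (σ₂, cDst) ← pir.run server k pp.n pp.dstLen t σ₁
  let src := parseRecord pp (4 * pp.ctLen) (alg.dec kSrc cSrc)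
  let dst := parseRecord pp 0 (alg.dec kDst cDst)
  let (z_ne, z_nw) ←
    match src, dst with
    | some x, some y => PMF.pure (evalAffine x.aff_ne y.aff_ne, evalAffine x.aff_nw y.aff_nw)
    | _, _ => PMF.uniformOfFintype (ZMod pp.p × ZMod pp.p)
  let (σ₃, zLabels) ← runOTs ot server k pp.labelLen
    (toBits pp.fieldBits z_ne.val ++ toBits pp.fieldBits z_nw.val) σ₂
  let σ₄ ← exec server (deliver σ₃ [])
  let result := do
    let x ← src
    let y ← dst
    let (b_ne, b_nw, k_ne, k_nw) ← evalUnblind pp alg zLabels x y (σ₄ 1)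
    return (x, indexToDirection b_ne b_nw, k_ne, k_nw)
  match result with
  | some (x, dir, k_ne, k_nw) =>
      let kDir := List.zipWith xor (alg.prf k_ne dir) (alg.prf k_nw dir)
      return (σ₄, (pp.nbr s dir).getD s, alg.dec kDir (keyCiphertext pp x.rest dir), pp.nbr s dir)
  | none => do
      let kNew ← uniformStr pp.keyLen
      return (σ₄, s, kNew, none)

/-- The given number of rounds. Returns the server's store and the client's outputs. -/
noncomputable def clientRounds (pir ot : RetrievalProtocol) (alg : LocalAlgorithms) (server : Cmd)
    (k : ℕ) (pp : PublicParams) (t : Fin pp.n) (kDst : Str) :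
    ℕ → Fin pp.n → Str → Store → PMF (Store × List (Option (Fin pp.n)))
  | 0, _, _, σ => PMF.pure (σ, [])
  | r + 1, s, kSrc, σ => do
      let (σ₁, s₁, kSrc₁, o) ← clientRound pir ot alg server k pp t kDst s kSrc σ
      let (σ₂, os) ← clientRounds pir ot alg server k pp t kDst r s₁ kSrc₁ σ₁
      return (σ₂, o :: os)

/-- The whole protocol, executed by an honest client with input `(s, t)` and a corrupted server with
input `x`. Returns the client's output and the server's output. -/
noncomputable def realExecution (pir ot : RetrievalProtocol) (alg : LocalAlgorithms) (server : Cmd)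
    (k : ℕ) (pp : PublicParams) (s t : Fin pp.n) (x : ServerInput pp) :
    PMF (List (Option (Fin pp.n)) × Str) := do
  let (σ₁, kSrc) ← ot.run server k pp.n pp.keyLen s (corruptStore pir ot k pp x)
  let (σ₂, kDst) ← ot.run server k pp.n pp.keyLen t σ₁
  let (σ₃, path) ← clientRounds pir ot alg server k pp t kDst pp.R s kSrc σ₂
  let σ₄ ← exec server (deliver σ₃ [])
  return (path, σ₄ 1)

/-! ## The ideal world -/

/-- The direction of the first edge from `v` to `t` according to the routing matrices. -/
def nextDirection {pp : PublicParams} (x : ServerInput pp) (v t : Fin pp.n) : Dir :=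
  indexToDirection (decide (0 < (x.A_ne * x.B_ne.transpose) v t))
    (decide (0 < (x.A_nw * x.B_nw.transpose) v t))

/-- The vertices of the path from `s` to `t`; `none` after `t`, and once a hop leads nowhere. -/
def hop {pp : PublicParams} (x : ServerInput pp) (s t : Fin pp.n) : ℕ → Option (Fin pp.n)
  | 0 => some s
  | i + 1 =>
      match hop x s t i with
      | none => none
      | some v => if v = t then none else pp.nbr v (nextDirection x v t)

/-- The ideal shortest-paths functionality: the client receives `v₀, …, v_R`. -/
def shortestPaths {pp : PublicParams} (x : ServerInput pp) (s t : Fin pp.n) :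
    List (Option (Fin pp.n)) :=
  (List.range (pp.R + 1)).map (hop x s t)

/-- The ideal execution with a simulator in the place of the corrupted server: in register `22` it
leaves the (encoded) matrices that it submits to the trusted party, from which it gets no answer,
and in register `1` its output. Returns the honest client's output and the simulator's output. -/
noncomputable def idealExecution (pir ot : RetrievalProtocol) (sim : Cmd)
    (k : ℕ) (pp : PublicParams) (s t : Fin pp.n) (x : ServerInput pp) :
    PMF (List (Option (Fin pp.n)) × Str) := do
  let σ ← exec sim (corruptStore pir ot k pp x)
  let submitted := Function.invFun ServerInput.encode (σ 22)
  return (shortestPaths submitted s t, σ 1)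

/-! ## Environments and the privacy game -/

/-- A Boolean circuit: a list of NAND gates. A gate `(a, b)` reads the `a`-th and the `b`-th most
recently computed wire; absent wires carry `false`. The output is the last wire. -/
abbrev Circuit := List (ℕ × ℕ)

def Circuit.eval (C : Circuit) (input : List Bool) : Bool :=
  (C.foldl (fun ws g => (!(ws.getD g.1 false && ws.getD g.2 false)) :: ws) input).headD false

/-- The first `N` symbols of a string as `2 * N` bits: for each position, whether there is a symbol,
and which one. -/
def window (N : ℕ) (w : Str) : List Bool :=
  (List.range N).flatMap fun j => [(w[j]?).isSome, (w[j]?).getD false]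

/-- One circuit of an environment: it puts out the inputs of the parties (having no input
itself, it can only put out constants) and finally maps the adversary's output to a bit. -/
structure Environment (pp : PublicParams) where
  s : Fin pp.n
  t : Fin pp.n
  x : ServerInput pp
  x_valid : x.Valid
  /-- number of symbols of the adversary's output that are read -/
  readLen : ℕ
  circuit : Circuit

def Environment.size {pp : PublicParams} (E : Environment pp) : ℕ :=
  E.x.encode.length + E.readLen + E.circuit.length

def Environment.decide {pp : PublicParams} (E : Environment pp) (w : Str) : Bool :=
  E.circuit.eval (window E.readLen w)

/-- `REAL'`: the bit of the environment, which sees the adversary's output only. -/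
noncomputable def realBit (pir ot : RetrievalProtocol) (alg : LocalAlgorithms) (server : Cmd)
    (k : ℕ) (pp : PublicParams) (E : Environment pp) : PMF Bool :=
  (realExecution pir ot alg server k pp E.s E.t E.x).map fun o => E.decide o.2

/-- `IDEAL'`: the bit of the environment, which sees the simulator's output only. -/
noncomputable def idealBit (pir ot : RetrievalProtocol) (sim : Cmd)
    (k : ℕ) (pp : PublicParams) (E : Environment pp) : PMF Bool :=
  (idealExecution pir ot sim k pp E.s E.t E.x).map fun o => E.decide o.2

/-- The distinguishing advantage of the environment in the privacy game. -/
noncomputable def privacyAdvantage (pir ot : RetrievalProtocol) (alg : LocalAlgorithms)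
    (server sim : Cmd) (k : ℕ) (pp : PublicParams) (E : Environment pp) : ℝ :=
  |(realBit pir ot alg server k pp E false).toReal - (idealBit pir ot sim k pp E false).toReal|

end PrivateRouting

/-! ### Semantics of programs: couplings, composition, time bounds, renaming of registers. -/

namespace PrivateRouting

/-! ## Probability mass functions: couplings -/

/-! The environment sees only the server's output, so only what the server sees of the client
matters. The honest client speaks to the server exclusively through PIR and OT sessions and through
activations with an empty message. The order, number and kinds of these are fixed by the public
parameters: a failed parsing or evaluation changes the client's private state but not the schedule
`allItems`. The client's secrets enter only through the indices of the sessions. The simulator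
`simulatorCmd` therefore runs the adversary against honest receivers that all have index 0.

The real and the simulated execution are compared by replacing indices by 0 one session at a time,
from the last to the first (`close_session`). The direction matters: an index may depend on what
earlier sessions returned, but once all later indices are 0, the continuation depends only on the
adversary's store and not on the receiver's output. One replacement, `Swappable`, then follows from
the privacy of a single session. The malicious server `attackCmd` gets as advice the adversary's
store at the start of the session, the remaining schedule and the environment's circuit; it plays
the session as the adversary, runs the remaining schedule by itself, evaluates the circuit and
outputs the bit. Its acceptance probabilities are exactly those of the two hybrids
(`map_run_attackCmd`).

Privacy is a statement about each single sequence of stores, schedules and indices, whereas the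
hybrids need one bound for all of them at each security parameter. `exists_negligible_bound`
supplies it by choosing a nearly worst case for each parameter, which non-uniform advice permits.
The number of sessions is polynomial, so the sum of the replacement costs is negligible.

The rest is a proof that the two machines exist and are efficient. `Impl` and `Det` form a program
logic with time bounds, in which the concrete memory is coupled with an abstract execution. The time
analysis is not circular: the adversary's time per activation does not depend on the messages it
receives, so its messages are short, so the receivers, polynomial in what they receive, are fast as
well (`exists_bounds`). -/

theorem pmf_bind_congr {α β : Type} {p : PMF α} {f g : α → PMF β}
    (h : ∀ a ∈ p.support, f a = g a) : p.bind f = p.bind g := by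
  ext b
  rw [PMF.bind_apply, PMF.bind_apply]
  refine tsum_congr fun a => ?_
  by_cases ha : p a = 0
  · simp [ha]
  · rw [h a ((PMF.mem_support_iff _ _).2 ha)]

/-- `μ` and `ν` have a coupling supported in the relation `Rel`. -/
def Coupled {α β : Type} (μ : PMF α) (ν : PMF β) (Rel : α → β → Prop) : Prop :=
  ∃ κ : PMF (α × β), κ.map Prod.fst = μ ∧ κ.map Prod.snd = ν ∧ ∀ z ∈ κ.support, Rel z.1 z.2

namespace Coupled

variable {α β γ δ : Type}

theorem pure {a : α} {b : β} {Rel : α → β → Prop} (h : Rel a b) :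
    Coupled (PMF.pure a) (PMF.pure b) Rel := by
  refine ⟨PMF.pure (a, b), PMF.pure_map _ _, PMF.pure_map _ _, ?_⟩
  intro z hz
  rw [PMF.mem_support_pure_iff] at hz
  subst hz
  exact h

theorem refl (μ : PMF α) : Coupled μ μ fun a b => a ∈ μ.support ∧ a = b := by
  refine ⟨μ.map fun a => (a, a), ?_, ?_, ?_⟩
  · rw [PMF.map_comp]; exact PMF.map_id _
  · rw [PMF.map_comp]; exact PMF.map_id _
  · intro z hz
    obtain ⟨a, ha, rfl⟩ := (PMF.mem_support_map_iff _ _ _).1 hz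
    exact ⟨ha, rfl⟩

theorem mono {μ : PMF α} {ν : PMF β} {Rel Rel' : α → β → Prop} (h : Coupled μ ν Rel)
    (hR : ∀ a ∈ μ.support, ∀ b ∈ ν.support, Rel a b → Rel' a b) : Coupled μ ν Rel' := by
  obtain ⟨κ, rfl, rfl, h⟩ := h
  refine ⟨κ, rfl, rfl, fun z hz => hR _ ?_ _ ?_ (h z hz)⟩
  · exact (PMF.mem_support_map_iff _ _ _).2 ⟨z, hz, rfl⟩
  · exact (PMF.mem_support_map_iff _ _ _).2 ⟨z, hz, rfl⟩

/-- The continuations are glued onto each pair of the first coupling. Couplings of them exist only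
over its support, so the kernel takes an arbitrary value elsewhere; `hne` provides it. -/
theorem bind {μ : PMF α} {ν : PMF β} {Rel : α → β → Prop} {f : α → PMF γ} {g : β → PMF δ}
    {Rel' : γ → δ → Prop} (h : Coupled μ ν Rel)
    (hfg : ∀ a ∈ μ.support, ∀ b ∈ ν.support, Rel a b → Coupled (f a) (g b) Rel') :
    Coupled (μ.bind f) (ν.bind g) Rel' := by
  classical
  obtain ⟨κ, rfl, rfl, h⟩ := h
  have key : ∀ z ∈ κ.support, Coupled (f z.1) (g z.2) Rel' := fun z hz =>
    hfg _ ((PMF.mem_support_map_iff _ _ _).2 ⟨z, hz, rfl⟩) _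
      ((PMF.mem_support_map_iff _ _ _).2 ⟨z, hz, rfl⟩) (h z hz)
  have hne : Nonempty (PMF (γ × δ)) := by
    obtain ⟨z, hz⟩ := κ.support_nonempty
    exact ⟨(key z hz).choose⟩
  choose! η h₁ h₂ h₃ using key
  refine ⟨κ.bind η, ?_, ?_, ?_⟩
  · rw [PMF.map_bind, PMF.bind_map]
    exact pmf_bind_congr h₁
  · rw [PMF.map_bind, PMF.bind_map]
    exact pmf_bind_congr h₂
  · intro z hz
    obtain ⟨a, ha, hz⟩ := (PMF.mem_support_bind_iff _ _ _).1 hz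
    exact h₃ a ha z hz

theorem map_left {μ : PMF α} {ν : PMF β} {Rel : α → β → Prop} {Rel' : γ → β → Prop}
    (h : Coupled μ ν Rel) (f : α → γ) (hR : ∀ a b, Rel a b → Rel' (f a) b) :
    Coupled (μ.map f) ν Rel' := by
  have := h.bind (f := fun a => PMF.pure (f a)) (g := PMF.pure) (Rel' := Rel')
    (fun a _ b _ hab => Coupled.pure (hR a b hab))
  rwa [PMF.bind_pure] at this

theorem map_eq {μ : PMF α} {ν : PMF β} {Rel : α → β → Prop} (h : Coupled μ ν Rel)
    {f : α → γ} {g : β → γ} (hR : ∀ a b, Rel a b → f a = g b) : μ.map f = ν.map g := by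
  obtain ⟨κ, rfl, rfl, h⟩ := h
  rw [PMF.map_comp, PMF.map_comp]
  exact pmf_bind_congr fun z hz => by simp [hR _ _ (h z hz)]

/-- Every concrete outcome comes from an ideal one. In the program logic this turns facts about the
ideal sample into halting of the second half of a program. -/
theorem of_support {μ : PMF α} {ν : PMF β} {Rel : α → β → Prop} (h : Coupled μ ν Rel) {b : β}
    (hb : b ∈ ν.support) : ∃ a ∈ μ.support, Rel a b := by
  obtain ⟨κ, rfl, rfl, h⟩ := h
  obtain ⟨z, hz, rfl⟩ := (PMF.mem_support_map_iff _ _ _).1 hb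
  exact ⟨z.1, (PMF.mem_support_map_iff _ _ _).2 ⟨z, hz, rfl⟩, h z hz⟩

end Coupled

/-! ## Semantics of programs -/

theorem steps_nil (T : ℕ) (σ : Store) : steps T ([], σ) = PMF.pure ([], σ) := by
  induction T with
  | zero => rfl
  | succ T ih => simp [steps, step, ih]

theorem steps_add (a b : ℕ) (x : Config) : steps (a + b) x = (steps a x).bind (steps b) := by
  induction a generalizing x with
  | zero => simp [steps]
  | succ a ih =>
    rw [Nat.add_right_comm]
    simp only [steps, PMF.bind_bind]
    exact pmf_bind_congr fun y _ => ih y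

/-- The configuration halts within `T` steps. -/
def HaltsBy (x : Config) (T : ℕ) : Prop := ∀ y ∈ (steps T x).support, y.1 = []

/-- The store after `T` steps. -/
noncomputable def finalStore (T : ℕ) (x : Config) : PMF Store := (steps T x).map Prod.snd

theorem HaltsBy.steps_eq {x : Config} {T : ℕ} (h : HaltsBy x T) {T' : ℕ} (hT : T ≤ T') :
    steps T' x = steps T x := by
  obtain ⟨d, rfl⟩ := Nat.exists_eq_add_of_le hT
  rw [steps_add]
  conv_rhs => rw [← PMF.bind_pure (steps T x)]
  refine pmf_bind_congr fun y hy => ?_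
  obtain ⟨K, σ⟩ := y
  obtain rfl : K = [] := h _ hy
  exact steps_nil d σ

theorem HaltsBy.mono {x : Config} {T : ℕ} (h : HaltsBy x T) {T' : ℕ} (hT : T ≤ T') :
    HaltsBy x T' := by
  intro y hy
  rw [h.steps_eq hT] at hy
  exact h y hy

theorem haltsBy_nil (σ : Store) (T : ℕ) : HaltsBy ([], σ) T := by
  intro y hy
  rw [steps_nil, PMF.mem_support_pure_iff] at hy
  rw [hy]

theorem haltsBy_succ {x : Config} {T : ℕ} :
    HaltsBy x (T + 1) ↔ ∀ y ∈ (step x).support, HaltsBy y T := by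
  constructor
  · intro h y hy z hz
    exact h z ((PMF.mem_support_bind_iff _ _ _).2 ⟨y, hy, hz⟩)
  · intro h z hz
    obtain ⟨y, hy, hz⟩ := (PMF.mem_support_bind_iff _ _ _).1 hz
    exact h y hy z hz

theorem finalStore_succ (T : ℕ) (x : Config) :
    finalStore (T + 1) x = (step x).bind (finalStore T) := by
  rw [finalStore, steps, PMF.map_bind]
  rfl

theorem HaltsBy.finalStore_eq {x : Config} {T : ℕ} (h : HaltsBy x T) {T' : ℕ} (hT : T ≤ T') :
    finalStore T' x = finalStore T x := by
  rw [finalStore, h.steps_eq hT, finalStore]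

theorem finalStore_nil (T : ℕ) (σ : Store) : finalStore T ([], σ) = PMF.pure σ := by
  rw [finalStore, steps_nil, PMF.pure_map]

theorem step_append (c : Cmd) (K K' : List Cmd) (σ : Store) :
    step (c :: K ++ K', σ) = (step (c :: K, σ)).map fun y => (y.1 ++ K', y.2) := by
  cases c with
  | branch r a b d =>
    simp only [List.cons_append, step]
    rcases σ r with _ | ⟨_ | _, _⟩ <;> simp [PMF.pure_map]
  | loop r a =>
    simp only [List.cons_append, step]
    rcases σ r with _ | ⟨_, _⟩ <;> simp [PMF.pure_map]
  | toss r => simp [step, PMF.map_comp, Function.comp_def]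
  | _ => simp [step, PMF.pure_map]

/-- While commands of `K` remain, `K'` is inert. A run of `K` that ends early starts `K'` early and
idles at the end, so the distribution after the full `T + T'` steps is the same. -/
theorem haltsBy_append {K K' : List Cmd} {σ : Store} {T T' : ℕ} (h : HaltsBy (K, σ) T)
    (h' : ∀ σ' ∈ (finalStore T (K, σ)).support, HaltsBy (K', σ') T') :
    HaltsBy (K ++ K', σ) (T + T') ∧
      finalStore (T + T') (K ++ K', σ) =
        (finalStore T (K, σ)).bind fun σ' => finalStore T' (K', σ') := by
  induction T generalizing K σ with
  | zero =>
    obtain rfl : K = [] := h (K, σ) (by simp [steps])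
    simp only [finalStore_nil, PMF.mem_support_pure_iff, forall_eq] at h'
    simpa [finalStore_nil] using h'
  | succ T ih =>
    cases K with
    | nil =>
      simp only [finalStore_nil, PMF.mem_support_pure_iff, forall_eq] at h'
      simp only [List.nil_append, finalStore_nil, PMF.pure_bind]
      exact ⟨h'.mono (by omega), h'.finalStore_eq (by omega)⟩
    | cons c K =>
      rw [haltsBy_succ] at h
      have key : ∀ y ∈ (step (c :: K, σ)).support, _ := fun y hy =>
        ih (h y hy) fun σ' hσ' => h' σ' (by
          rw [finalStore_succ]
          exact (PMF.mem_support_bind_iff _ _ _).2 ⟨y, hy, hσ'⟩)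
      rw [Nat.add_right_comm, haltsBy_succ, finalStore_succ, finalStore_succ, step_append,
        PMF.bind_map, PMF.bind_bind]
      refine ⟨fun y hy => ?_, pmf_bind_congr fun y hy => (key y hy).2⟩
      obtain ⟨z, hz, rfl⟩ := (PMF.mem_support_map_iff _ _ _).1 hy
      exact (key z hz).1

/-- `exec` refers to the least halting time, but a halted configuration no longer changes, so any
valid bound computes the same distribution. -/
theorem exec_eq {c : Cmd} {σ : Store} {T : ℕ} (h : HaltsIn c σ T) :
    exec c σ = finalStore T ([c], σ) := by
  classical
  have hex : ∃ T, HaltsIn c σ T := ⟨T, h⟩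
  rw [exec, dif_pos hex]
  exact (HaltsBy.finalStore_eq (Nat.find_spec hex) (Nat.find_min' hex h)).symm

theorem HaltsIn.mono {c : Cmd} {σ : Store} {T T' : ℕ} (h : HaltsIn c σ T) (hT : T ≤ T') :
    HaltsIn c σ T' :=
  HaltsBy.mono h hT

theorem haltsIn_cons {c : Cmd} {K : List Cmd} {σ : Store} {T T' : ℕ} (h : HaltsIn c σ T)
    (h' : ∀ σ' ∈ (exec c σ).support, HaltsBy (K, σ') T') :
    HaltsBy (c :: K, σ) (T + T') ∧
      finalStore (T + T') (c :: K, σ) =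
        (exec c σ).bind fun σ' => finalStore T' (K, σ') := by
  rw [exec_eq h] at h' ⊢
  exact haltsBy_append (K := [c]) h h'

theorem haltsIn_seq {c d : Cmd} {σ : Store} {T T' : ℕ} (h : HaltsIn c σ T)
    (h' : ∀ σ' ∈ (exec c σ).support, HaltsIn d σ' T') :
    HaltsIn (Cmd.seq c d) σ (T + T' + 1) ∧ exec (Cmd.seq c d) σ = (exec c σ).bind (exec d) := by
  obtain ⟨h₁, h₂⟩ := haltsIn_cons (K := [d]) h h'
  have hs : HaltsIn (Cmd.seq c d) σ (T + T' + 1) := haltsBy_succ.2 (by simpa [step] using h₁)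
  refine ⟨hs, ?_⟩
  rw [exec_eq hs, finalStore_succ]
  simp only [step, PMF.pure_bind, h₂]
  exact pmf_bind_congr fun σ' hσ' => (exec_eq (h' σ' hσ')).symm

theorem haltsIn_loop_cons {c : Cmd} {r : ℕ} {σ : Store} {T T' : ℕ} (hr : σ r ≠ [])
    (h : HaltsIn c σ T) (h' : ∀ σ' ∈ (exec c σ).support, HaltsIn (Cmd.loop r c) σ' T') :
    HaltsIn (Cmd.loop r c) σ (T + T' + 1) ∧
      exec (Cmd.loop r c) σ = (exec c σ).bind (exec (Cmd.loop r c)) := by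
  obtain ⟨h₁, h₂⟩ := haltsIn_cons (K := [Cmd.loop r c]) h h'
  have hstep : step ([Cmd.loop r c], σ) = PMF.pure ([c, Cmd.loop r c], σ) := by
    obtain ⟨b, l, hb⟩ := List.exists_cons_of_ne_nil hr
    simp [step, hb]
  have hs : HaltsIn (Cmd.loop r c) σ (T + T' + 1) := haltsBy_succ.2 (by simpa [hstep] using h₁)
  refine ⟨hs, ?_⟩
  rw [exec_eq hs, finalStore_succ]
  simp only [hstep, PMF.pure_bind, h₂]
  exact pmf_bind_congr fun σ' hσ' => (exec_eq (h' σ' hσ')).symm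

theorem haltsIn_of_step {c : Cmd} {σ σ' : Store} (hstep : step ([c], σ) = PMF.pure ([], σ')) :
    HaltsIn c σ 1 ∧ exec c σ = PMF.pure σ' := by
  have hs : HaltsIn c σ 1 := haltsBy_succ.2 (by
    rw [hstep]; intro y hy; rw [PMF.mem_support_pure_iff] at hy; rw [hy]; exact haltsBy_nil _ _)
  refine ⟨hs, ?_⟩
  rw [exec_eq hs, finalStore_succ, hstep, PMF.pure_bind, finalStore_nil]

theorem haltsIn_of_step_cons {c d : Cmd} {σ : Store} {T : ℕ}
    (hstep : step ([c], σ) = PMF.pure ([d], σ)) (h : HaltsIn d σ T) :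
    HaltsIn c σ (T + 1) ∧ exec c σ = exec d σ := by
  have hs : HaltsIn c σ (T + 1) := haltsBy_succ.2 (by
    rw [hstep]; intro y hy; rw [PMF.mem_support_pure_iff] at hy; rw [hy]; exact h)
  refine ⟨hs, ?_⟩
  rw [exec_eq hs, finalStore_succ, hstep, PMF.pure_bind, exec_eq h]

/-! ## A logic for programs with a running time -/

/-- From `σ`, the program `c` halts within `T` steps, and its final store is coupled with a sample
of `ν` by `Rel`. -/
def Impl {α : Type} (c : Cmd) (σ : Store) (T : ℕ) (ν : PMF α) (Rel : α → Store → Prop) : Prop :=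
  HaltsIn c σ T ∧ Coupled ν (exec c σ) Rel

/-- From `σ`, the program `c` halts within `T` steps in the store `σ'`. -/
def Det (c : Cmd) (σ : Store) (T : ℕ) (σ' : Store) : Prop :=
  HaltsIn c σ T ∧ exec c σ = PMF.pure σ'

namespace Impl

variable {α β : Type} {c d : Cmd} {σ : Store} {T T' U : ℕ} {ν : PMF α} {Rel : α → Store → Prop}
  {Rel' : β → Store → Prop}

theorem mono (h : Impl c σ T ν Rel) (hT : T ≤ T') {Rel₂ : α → Store → Prop}
    (hR : ∀ a ∈ ν.support, ∀ σ', Rel a σ' → Rel₂ a σ') : Impl c σ T' ν Rel₂ :=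
  ⟨h.1.mono hT, h.2.mono fun a ha b _ => hR a ha b⟩

theorem seq {ν' : α → PMF β} (h : Impl c σ T ν Rel)
    (h' : ∀ a ∈ ν.support, ∀ σ', Rel a σ' → Impl d σ' T' (ν' a) Rel') (hU : T + T' + 1 ≤ U) :
    Impl (Cmd.seq c d) σ U (ν.bind ν') Rel' := by
  have hd : ∀ σ' ∈ (exec c σ).support, HaltsIn d σ' T' := fun σ' hσ' => by
    obtain ⟨a, ha, haσ⟩ := h.2.of_support hσ'
    exact (h' a ha σ' haσ).1
  obtain ⟨h₁, h₂⟩ := haltsIn_seq h.1 hd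
  refine ⟨h₁.mono hU, ?_⟩
  rw [h₂]
  exact h.2.bind fun a ha σ' _ haσ => (h' a ha σ' haσ).2

theorem loop_cons {r : ℕ} {ν' : α → PMF β} (hr : σ r ≠ []) (h : Impl c σ T ν Rel)
    (h' : ∀ a ∈ ν.support, ∀ σ', Rel a σ' → Impl (Cmd.loop r c) σ' T' (ν' a) Rel')
    (hU : T + T' + 1 ≤ U) : Impl (Cmd.loop r c) σ U (ν.bind ν') Rel' := by
  have hd : ∀ σ' ∈ (exec c σ).support, HaltsIn (Cmd.loop r c) σ' T' := fun σ' hσ' => by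
    obtain ⟨a, ha, haσ⟩ := h.2.of_support hσ'
    exact (h' a ha σ' haσ).1
  obtain ⟨h₁, h₂⟩ := haltsIn_loop_cons hr h.1 hd
  refine ⟨h₁.mono hU, ?_⟩
  rw [h₂]
  exact h.2.bind fun a ha σ' _ haσ => (h' a ha σ' haσ).2

theorem of_step_cons (hstep : step ([c], σ) = PMF.pure ([d], σ)) (h : Impl d σ T ν Rel)
    (hU : T + 1 ≤ U) : Impl c σ U ν Rel := by
  obtain ⟨h₁, h₂⟩ := haltsIn_of_step_cons hstep h.1
  exact ⟨h₁.mono hU, h₂ ▸ h.2⟩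

theorem branch_nil {r : ℕ} {c₀ c₁ c₂ : Cmd} (hr : σ r = []) (h : Impl c₀ σ T ν Rel)
    (hU : T + 1 ≤ U) : Impl (Cmd.branch r c₀ c₁ c₂) σ U ν Rel :=
  of_step_cons (by simp [step, hr]) h hU

theorem branch_false {r : ℕ} {c₀ c₁ c₂ : Cmd} {l : Str} (hr : σ r = false :: l)
    (h : Impl c₁ σ T ν Rel) (hU : T + 1 ≤ U) : Impl (Cmd.branch r c₀ c₁ c₂) σ U ν Rel :=
  of_step_cons (by simp [step, hr]) h hU

theorem branch_true {r : ℕ} {c₀ c₁ c₂ : Cmd} {l : Str} (hr : σ r = true :: l)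
    (h : Impl c₂ σ T ν Rel) (hU : T + 1 ≤ U) : Impl (Cmd.branch r c₀ c₁ c₂) σ U ν Rel :=
  of_step_cons (by simp [step, hr]) h hU

theorem det_seq {τ : Store} (h : Det c σ T τ) (h' : Impl d τ T' ν Rel) (hU : T + T' + 1 ≤ U) :
    Impl (Cmd.seq c d) σ U ν Rel := by
  have hd : ∀ σ' ∈ (exec c σ).support, HaltsIn d σ' T' := fun σ' hσ' => by
    rw [h.2, PMF.mem_support_pure_iff] at hσ'
    exact hσ' ▸ h'.1
  obtain ⟨h₁, h₂⟩ := haltsIn_seq h.1 hd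
  refine ⟨h₁.mono hU, ?_⟩
  rw [h₂, h.2, PMF.pure_bind]
  exact h'.2

theorem seq_det {Rel₂ : α → Store → Prop} (h : Impl c σ T ν Rel)
    (h' : ∀ a ∈ ν.support, ∀ σ', Rel a σ' → ∃ τ, Det d σ' T' τ ∧ Rel₂ a τ)
    (hU : T + T' + 1 ≤ U) : Impl (Cmd.seq c d) σ U ν Rel₂ := by
  have := seq (ν' := PMF.pure) (Rel' := Rel₂) h (fun a ha σ' hσ' => by
    obtain ⟨τ, hd, hτ⟩ := h' a ha σ' hσ'
    exact ⟨hd.1, by rw [hd.2]; exact Coupled.pure hτ⟩) hU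
  rwa [PMF.bind_pure] at this

theorem loop_nil {r : ℕ} {a : α} (hr : σ r = []) (h : Rel a σ) (hU : 1 ≤ U) :
    Impl (Cmd.loop r c) σ U (PMF.pure a) Rel := by
  obtain ⟨h₁, h₂⟩ := haltsIn_of_step (c := Cmd.loop r c) (σ := σ) (σ' := σ) (by simp [step, hr])
  exact ⟨h₁.mono hU, h₂ ▸ Coupled.pure h⟩

end Impl

namespace Det

variable {c d : Cmd} {σ τ υ : Store} {T T' U : ℕ}

theorem mono (h : Det c σ T τ) (hT : T ≤ U) : Det c σ U τ := ⟨h.1.mono hT, h.2⟩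

theorem congr {τ' : Store} (h : Det c σ T τ) (hτ : τ = τ') : Det c σ T τ' := hτ ▸ h

theorem impl {α : Type} {a : α} {Rel : α → Store → Prop} (h : Det c σ T τ) (hR : Rel a τ) :
    Impl c σ T (PMF.pure a) Rel :=
  ⟨h.1, by rw [h.2]; exact Coupled.pure hR⟩

theorem skip : Det Cmd.skip σ 1 σ := haltsIn_of_step (by simp [step])

theorem push {b : Bool} {r : ℕ} : Det (Cmd.push b r) σ 1 (Function.update σ r (b :: σ r)) :=
  haltsIn_of_step (by simp [step])

theorem pop {r : ℕ} : Det (Cmd.pop r) σ 1 (Function.update σ r (σ r).tail) :=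
  haltsIn_of_step (by simp [step])

theorem seq (h : Det c σ T τ) (h' : Det d τ T' υ) (hU : T + T' + 1 ≤ U) :
    Det (Cmd.seq c d) σ U υ := by
  obtain ⟨h₁, h₂⟩ := haltsIn_seq (d := d) (T' := T') h.1 (fun σ' hσ' => by
    rw [h.2, PMF.mem_support_pure_iff] at hσ'
    exact hσ' ▸ h'.1)
  exact ⟨h₁.mono hU, by rw [h₂, h.2, PMF.pure_bind, h'.2]⟩

theorem of_step_cons (hstep : step ([c], σ) = PMF.pure ([d], σ)) (h : Det d σ T τ)
    (hU : T + 1 ≤ U) : Det c σ U τ := by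
  obtain ⟨h₁, h₂⟩ := haltsIn_of_step_cons hstep h.1
  exact ⟨h₁.mono hU, h₂ ▸ h.2⟩

theorem branch_nil {r : ℕ} {c₀ c₁ c₂ : Cmd} (hr : σ r = []) (h : Det c₀ σ T τ)
    (hU : T + 1 ≤ U) : Det (Cmd.branch r c₀ c₁ c₂) σ U τ :=
  of_step_cons (by simp [step, hr]) h hU

theorem branch_false {r : ℕ} {c₀ c₁ c₂ : Cmd} {l : Str} (hr : σ r = false :: l)
    (h : Det c₁ σ T τ) (hU : T + 1 ≤ U) : Det (Cmd.branch r c₀ c₁ c₂) σ U τ :=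
  of_step_cons (by simp [step, hr]) h hU

theorem branch_true {r : ℕ} {c₀ c₁ c₂ : Cmd} {l : Str} (hr : σ r = true :: l)
    (h : Det c₂ σ T τ) (hU : T + 1 ≤ U) : Det (Cmd.branch r c₀ c₁ c₂) σ U τ :=
  of_step_cons (by simp [step, hr]) h hU

theorem loop_nil {r : ℕ} (hr : σ r = []) (hU : 1 ≤ U) : Det (Cmd.loop r c) σ U σ :=
  mono (haltsIn_of_step (by simp [step, hr])) hU

theorem loop_cons {r : ℕ} (hr : σ r ≠ []) (h : Det c σ T τ) (h' : Det (Cmd.loop r c) τ T' υ)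
    (hU : T + T' + 1 ≤ U) : Det (Cmd.loop r c) σ U υ := by
  obtain ⟨h₁, h₂⟩ := haltsIn_loop_cons (T' := T') hr h.1 (fun σ' hσ' => by
    rw [h.2, PMF.mem_support_pure_iff] at hσ'
    exact hσ' ▸ h'.1)
  exact ⟨h₁.mono hU, by rw [h₂, h.2, PMF.pure_bind, h'.2]⟩

end Det

/-! ## Growth of the registers -/

theorem length_le_of_step {x y : Config} (h : y ∈ (step x).support) (r : ℕ) :
    (y.2 r).length ≤ (x.2 r).length + 1 := by
  obtain ⟨K, σ⟩ := x
  cases K with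
  | nil => simp only [step, PMF.mem_support_pure_iff] at h; subst h; simp
  | cons c K =>
    cases c with
    | branch s a b d =>
      simp only [step] at h
      rcases hs : σ s with _ | ⟨_ | _, _⟩ <;> rw [hs] at h <;>
        simp only [PMF.mem_support_pure_iff] at h <;> subst h <;> simp
    | loop s a =>
      simp only [step] at h
      rcases hs : σ s with _ | ⟨_, _⟩ <;> rw [hs] at h <;>
        simp only [PMF.mem_support_pure_iff] at h <;> subst h <;> simp
    | toss s =>
      simp only [step, PMF.mem_support_map_iff] at h
      obtain ⟨b, -, rfl⟩ := h
      by_cases hr : r = s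
      · subst hr; simp
      · simp [Function.update_of_ne hr]
    | push b s =>
      simp only [step, PMF.mem_support_pure_iff] at h
      subst h
      by_cases hr : r = s
      · subst hr; simp
      · simp [Function.update_of_ne hr]
    | pop s =>
      simp only [step, PMF.mem_support_pure_iff] at h
      subst h
      by_cases hr : r = s
      · subst hr; simp; omega
      · simp [Function.update_of_ne hr]
    | _ => simp only [step, PMF.mem_support_pure_iff] at h; subst h; simp

theorem length_le_of_steps {T : ℕ} {x y : Config} (h : y ∈ (steps T x).support) (r : ℕ) :
    (y.2 r).length ≤ (x.2 r).length + T := by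
  induction T generalizing x with
  | zero => simp only [steps, PMF.mem_support_pure_iff] at h; subst h; simp
  | succ T ih =>
    obtain ⟨z, hz, h⟩ := (PMF.mem_support_bind_iff _ _ _).1 h
    have := ih h
    have := length_le_of_step hz r
    omega

/-- A step writes at most one symbol. Applied to register 1, which is empty at each activation, this
bounds the length of messages by the running time. -/
theorem length_le_of_exec {c : Cmd} {σ σ' : Store} {T : ℕ} (hc : HaltsIn c σ T)
    (h : σ' ∈ (exec c σ).support) (r : ℕ) : (σ' r).length ≤ (σ r).length + T := by
  rw [exec_eq hc] at h
  obtain ⟨y, hy, rfl⟩ := (PMF.mem_support_map_iff _ _ _).1 h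
  exact length_le_of_steps hy r

/-! ## The registers of a program -/

/-- A bound on the registers that a program mentions. -/
def Cmd.regBound : Cmd → ℕ
  | skip => 0
  | push _ r => r + 1
  | pop r => r + 1
  | toss r => r + 1
  | seq c d => max c.regBound d.regBound
  | branch r a b c => max (r + 1) (max a.regBound (max b.regBound c.regBound))
  | loop r c => max (r + 1) c.regBound

theorem step_of_regBound {M : ℕ} {x y : Config} (h : y ∈ (step x).support)
    (hx : ∀ c ∈ x.1, c.regBound ≤ M) :
    (∀ c ∈ y.1, c.regBound ≤ M) ∧ ∀ r, M ≤ r → y.2 r = x.2 r := by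
  obtain ⟨K, σ⟩ := x
  cases K with
  | nil => simp only [step, PMF.mem_support_pure_iff] at h; subst h; simp
  | cons c K =>
    simp only [List.mem_cons, forall_eq_or_imp] at hx
    obtain ⟨hc, hK⟩ := hx
    cases c with
    | branch s a b d =>
      simp only [Cmd.regBound, max_le_iff] at hc
      simp only [step] at h
      rcases hs : σ s with _ | ⟨_ | _, _⟩ <;> rw [hs] at h <;>
        simp only [PMF.mem_support_pure_iff] at h <;> subst h <;> simp_all
    | loop s a =>
      simp only [Cmd.regBound, max_le_iff] at hc
      simp only [step] at h
      rcases hs : σ s with _ | ⟨_, _⟩ <;> rw [hs] at h <;>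
        simp only [PMF.mem_support_pure_iff] at h <;> subst h <;> simp_all [Cmd.regBound]
    | toss s =>
      simp only [step, PMF.mem_support_map_iff] at h
      obtain ⟨b, -, rfl⟩ := h
      refine ⟨hK, fun r hr => Function.update_of_ne ?_ _ _⟩
      simp only [Cmd.regBound] at hc
      omega
    | push b s =>
      simp only [step, PMF.mem_support_pure_iff] at h
      subst h
      refine ⟨hK, fun r hr => Function.update_of_ne ?_ _ _⟩
      simp only [Cmd.regBound] at hc
      omega
    | pop s =>
      simp only [step, PMF.mem_support_pure_iff] at h
      subst h
      refine ⟨hK, fun r hr => Function.update_of_ne ?_ _ _⟩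
      simp only [Cmd.regBound] at hc
      omega
    | skip => simp only [step, PMF.mem_support_pure_iff] at h; subst h; simpa using hK
    | seq a b =>
      simp only [Cmd.regBound, max_le_iff] at hc
      simp only [step, PMF.mem_support_pure_iff] at h; subst h; simp_all

/-- For erasing a receiver after its session: only finitely many registers can have been touched. -/
theorem exec_of_regBound {c : Cmd} {σ σ' : Store} {T : ℕ} (hc : HaltsIn c σ T)
    (h : σ' ∈ (exec c σ).support) {r : ℕ} (hr : c.regBound ≤ r) : σ' r = σ r := by
  rw [exec_eq hc] at h
  obtain ⟨y, hy, rfl⟩ := (PMF.mem_support_map_iff _ _ _).1 h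
  have key : ∀ (T : ℕ) (x : Config), (∀ c ∈ x.1, c.regBound ≤ r) → y ∈ (steps T x).support →
      y.2 r = x.2 r := by
    intro T
    induction T with
    | zero => intro x _ hy; simp only [steps, PMF.mem_support_pure_iff] at hy; rw [hy]
    | succ T ih =>
      intro x hx hy
      obtain ⟨z, hz, hy⟩ := (PMF.mem_support_bind_iff _ _ _).1 hy
      obtain ⟨h₁, h₂⟩ := step_of_regBound hz hx
      rw [ih z h₁ hy, h₂ r le_rfl]
  exact key T ([c], σ) (by simpa using hr) hy

/-! ## Renaming registers -/

/-- The same program on other registers. -/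
def Cmd.rename (f : ℕ → ℕ) : Cmd → Cmd
  | skip => skip
  | push b r => push b (f r)
  | pop r => pop (f r)
  | toss r => toss (f r)
  | seq c d => seq (c.rename f) (d.rename f)
  | branch r a b c => branch (f r) (a.rename f) (b.rename f) (c.rename f)
  | loop r c => loop (f r) (c.rename f)

theorem extend_update {f : ℕ → ℕ} (hf : f.Injective) (σ : Store) (r : ℕ) (w : Str) :
    Function.extend f (Function.update (σ ∘ f) r w) σ = Function.update σ (f r) w := by
  funext s
  by_cases hs : ∃ a, f a = s
  · obtain ⟨a, rfl⟩ := hs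
    rw [hf.extend_apply]
    by_cases ha : a = r
    · subst ha; simp
    · rw [Function.update_of_ne ha, Function.update_of_ne (hf.ne ha)]; rfl
  · rw [Function.extend_apply' _ _ _ hs, Function.update_of_ne]
    rintro rfl
    exact hs ⟨r, rfl⟩

theorem extend_self {f : ℕ → ℕ} (hf : f.Injective) (σ : Store) :
    Function.extend f (σ ∘ f) σ = σ := by
  funext s
  by_cases hs : ∃ a, f a = s
  · obtain ⟨a, rfl⟩ := hs
    rw [hf.extend_apply]; rfl
  · rw [Function.extend_apply' _ _ _ hs]

/-- The original program sees `σ ∘ f`; `Function.extend f _ σ` writes its result back and keeps the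
registers outside the range of `f`. Injectivity of `f` excludes collisions. -/
theorem step_rename {f : ℕ → ℕ} (hf : f.Injective) (K : List Cmd) (σ : Store) :
    step (K.map (Cmd.rename f), σ) =
      (step (K, σ ∘ f)).map fun y => (y.1.map (Cmd.rename f), Function.extend f y.2 σ) := by
  cases K with
  | nil => simp [step, PMF.pure_map, extend_self hf]
  | cons c K =>
    cases c with
    | branch r a b d =>
      simp only [List.map_cons, Cmd.rename, step, Function.comp_apply]
      rcases σ (f r) with _ | ⟨_ | _, _⟩ <;> simp [PMF.pure_map, extend_self hf]
    | loop r a =>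
      simp only [List.map_cons, Cmd.rename, step, Function.comp_apply]
      rcases σ (f r) with _ | ⟨_, _⟩ <;> simp [PMF.pure_map, extend_self hf, Cmd.rename]
    | toss r =>
      simp [step, Cmd.rename, PMF.map_comp, Function.comp_def, ← extend_update hf]
    | _ => simp [step, Cmd.rename, PMF.pure_map, extend_self hf, extend_update hf]

theorem steps_rename {f : ℕ → ℕ} (hf : f.Injective) (T : ℕ) (K : List Cmd) (σ : Store) :
    steps T (K.map (Cmd.rename f), σ) =
      (steps T (K, σ ∘ f)).map fun y => (y.1.map (Cmd.rename f), Function.extend f y.2 σ) := by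
  induction T generalizing K σ with
  | zero => simp [steps, PMF.pure_map, extend_self hf]
  | succ T ih =>
    rw [steps, step_rename hf, PMF.bind_map, steps, PMF.map_bind]
    refine pmf_bind_congr fun y _ => ?_
    have h₁ : Function.extend f y.2 σ ∘ f = y.2 := Function.extend_comp hf _ _
    rw [Function.comp_apply, ih, h₁]
    congr 1
    funext z
    congr 1
    funext s
    by_cases hs : ∃ a, f a = s
    · obtain ⟨a, rfl⟩ := hs
      rw [hf.extend_apply, hf.extend_apply]
    · rw [Function.extend_apply' _ _ _ hs, Function.extend_apply' _ _ _ hs,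
        Function.extend_apply' _ _ _ hs]

theorem Impl.rename {c : Cmd} {f : ℕ → ℕ} (hf : f.Injective) {σ : Store} {T : ℕ}
    (h : HaltsIn c (σ ∘ f) T) :
    Impl (c.rename f) σ T (exec c (σ ∘ f)) fun τ σ' =>
      σ' ∘ f = τ ∧ ∀ r, r ∉ Set.range f → σ' r = σ r := by
  have key := steps_rename hf T [c] σ
  have hh : HaltsIn (c.rename f) σ T := by
    intro y hy
    rw [List.map_cons, List.map_nil] at key
    rw [key] at hy
    obtain ⟨z, hz, rfl⟩ := (PMF.mem_support_map_iff _ _ _).1 hy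
    simp [h z hz]
  refine ⟨hh, ?_⟩
  have he : exec (c.rename f) σ = (exec c (σ ∘ f)).map fun τ => Function.extend f τ σ := by
    rw [exec_eq hh, exec_eq h, finalStore, finalStore]
    rw [List.map_cons, List.map_nil] at key
    rw [key, PMF.map_comp, PMF.map_comp]
    rfl
  rw [he]
  have := (Coupled.refl (exec c (σ ∘ f))).bind (f := PMF.pure)
    (g := fun τ => PMF.pure (Function.extend f τ σ))
    (Rel' := fun τ σ' => σ' ∘ f = τ ∧ ∀ r, r ∉ Set.range f → σ' r = σ r) (by
      rintro a ha b hb ⟨-, rfl⟩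
      refine Coupled.pure ⟨Function.extend_comp hf _ _, fun r hr => ?_⟩
      exact Function.extend_apply' _ _ _ (by simpa using hr))
  rwa [PMF.bind_pure] at this

end PrivateRouting

/-! ### Elementary register programs, and the memory layout common to the simulator and the
malicious server. -/

namespace PrivateRouting

/-! ## Moving the contents of registers -/

def pushAll (b : Bool) : List ℕ → Cmd
  | [] => Cmd.skip
  | d :: ds => Cmd.seq (Cmd.push b d) (pushAll b ds)

theorem det_pushAll (b : Bool) {ds : List ℕ} (hds : ds.Nodup) (σ : Store) :
    Det (pushAll b ds) σ (2 * ds.length + 1) fun r => if r ∈ ds then b :: σ r else σ r := by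
  induction ds generalizing σ with
  | nil => exact Det.skip.congr (by simp)
  | cons d ds ih =>
    rw [List.nodup_cons] at hds
    refine Det.seq Det.push ?_ (T := 1) (T' := 2 * ds.length + 1) (by simp; omega)
    refine (ih hds.2 (Function.update σ d (b :: σ d))).congr ?_
    funext r
    by_cases hr : r = d
    · subst hr; simp [hds.1]
    · simp [hr]

/-- Pop everything from `s` and push it on all the registers in `ds`. -/
def pour (s : ℕ) (ds : List ℕ) : Cmd :=
  Cmd.loop s (Cmd.branch s Cmd.skip
    (Cmd.seq (Cmd.pop s) (pushAll false ds)) (Cmd.seq (Cmd.pop s) (pushAll true ds)))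

/-- Popping and pushing reverses a word, so the programs below that preserve the order pour twice.
-/
theorem det_pour {s : ℕ} {ds : List ℕ} (hs : s ∉ ds) (hds : ds.Nodup) (σ : Store) :
    Det (pour s ds) σ ((σ s).length * (2 * ds.length + 6) + 1) fun r =>
      if r = s then [] else if r ∈ ds then (σ s).reverse ++ σ r else σ r := by
  generalize hl : σ s = l
  induction l generalizing σ with
  | nil =>
    refine (Det.loop_nil hl (by simp)).congr ?_
    funext r
    by_cases hr : r = s
    · subst hr; simp [hl]
    · simp [hr]
  | cons b l ih =>
    have hb : Det (Cmd.seq (Cmd.pop s) (pushAll b ds)) σ (2 * ds.length + 3)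
        (fun r => if r = s then l else if r ∈ ds then b :: σ r else σ r) := by
      refine Det.seq Det.pop ?_ (T := 1) (T' := 2 * ds.length + 1) (by omega)
      refine (det_pushAll b hds _).congr ?_
      funext r
      by_cases hr : r = s
      · subst hr; simp [hs, hl]
      · simp [hr]
    refine Det.loop_cons (T := 2 * ds.length + 4) (T' := l.length * (2 * ds.length + 6) + 1)
      (by simp [hl]) ?_ ?_ ?_ (τ := fun r => if r = s then l else if r ∈ ds then b :: σ r else σ r)
    · cases b
      · exact Det.branch_false hl hb le_rfl
      · exact Det.branch_true hl hb le_rfl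
    · refine (ih (fun r => if r = s then l else if r ∈ ds then b :: σ r else σ r) (by simp)).congr ?_
      funext r
      by_cases hr : r = s
      · subst hr; simp
      · by_cases hr' : r ∈ ds <;> simp [hr, hr']
    · simp only [List.length_cons]; nlinarith

def clear (r : ℕ) : Cmd := pour r []

theorem det_clear (r : ℕ) (σ : Store) {T : ℕ} (hT : (σ r).length * 6 + 1 ≤ T) :
    Det (clear r) σ T (Function.update σ r []) := by
  have := (det_pour (s := r) (ds := []) (by simp) (by simp) σ).mono
    (show _ ≤ T by simpa using hT)
  refine this.congr ?_
  funext s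
  by_cases hs : s = r
  · subst hs; simp
  · simp [hs]

/-- Move the contents of `s` to `d`, by way of the empty register `t`. -/
def transfer (s t d : ℕ) : Cmd :=
  Cmd.seq (clear d) (Cmd.seq (pour s [t]) (pour t [d]))

theorem det_transfer {s t d : ℕ} (hst : s ≠ t) (hsd : s ≠ d) (htd : t ≠ d) {σ : Store}
    (ht : σ t = []) {T : ℕ} (hT : 16 * (σ s).length + 6 * (σ d).length + 5 ≤ T) :
    Det (transfer s t d) σ T (Function.update (Function.update σ s []) d (σ s)) := by
  have h₁ := det_clear d σ le_rfl
  have h₂ := det_pour (s := s) (ds := [t]) (by simpa using hst) (by simp) (Function.update σ d [])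
  have h₃ := det_pour (s := t) (ds := [d]) (by simpa using htd) (by simp)
  refine ((h₁.seq (h₂.seq (h₃ _) le_rfl) le_rfl).mono ?_).congr ?_
  · simp [hsd, htd, ht, hst.symm]
    omega
  · funext r
    by_cases hr : r = d
    · subst hr; simp [hsd, ht, htd, htd.symm, hsd.symm, hst.symm]
    · by_cases hr' : r = s
      · subst hr'; simp [hsd, hst]
      · by_cases hr'' : r = t
        · subst hr''; simp [hr, hr', ht]
        · simp [hr, hr', hr'']

/-- Copy the contents of `s` to the empty register `d`, by way of the empty register `t`. -/
def copy (s t d : ℕ) : Cmd := Cmd.seq (pour s [t]) (pour t [s, d])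

theorem det_copy {s t d : ℕ} (hst : s ≠ t) (hsd : s ≠ d) (htd : t ≠ d) {σ : Store}
    (ht : σ t = []) (hd : σ d = []) {T : ℕ} (hT : 18 * (σ s).length + 3 ≤ T) :
    Det (copy s t d) σ T (Function.update σ d (σ s)) := by
  have h₁ := det_pour (s := s) (ds := [t]) (by simpa using hst) (by simp) σ
  have h₂ := det_pour (s := t) (ds := [s, d]) (by simp [htd, hst.symm]) (by simpa using hsd)
  refine ((h₁.seq (h₂ _) le_rfl).mono ?_).congr ?_
  · simp [hst.symm, ht]
    omega
  · funext r
    by_cases hr : r = d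
    · subst hr; simp [ht, htd.symm, hsd.symm, hst.symm, hd]
    · by_cases hr' : r = s
      · subst hr'; simp [hst, hsd, ht, hst.symm]
      · by_cases hr'' : r = t
        · subst hr''; simp [hr, ht]
        · simp [hr, hr', hr'']

def clearAll (g : ℕ → ℕ) : ℕ → Cmd
  | 0 => Cmd.skip
  | M + 1 => Cmd.seq (clear (g M)) (clearAll g M)

theorem det_clearAll {g : ℕ → ℕ} (hg : g.Injective) (M : ℕ) {σ : Store} {S : ℕ}
    (hS : ∀ r, (σ (g r)).length ≤ S) :
    ∃ τ, Det (clearAll g M) σ (M * (6 * S + 2) + 1) τ ∧ (∀ r < M, τ (g r) = []) ∧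
      (∀ r, M ≤ r → τ (g r) = σ (g r)) ∧ ∀ r, r ∉ Set.range g → τ r = σ r := by
  induction M generalizing σ with
  | zero => exact ⟨σ, by simpa [clearAll] using Det.skip, by simp, by simp, by simp⟩
  | succ M ih =>
    have hS' : ∀ r, (Function.update σ (g M) [] (g r)).length ≤ S := fun r => by
      by_cases hr : r = M
      · subst hr; simp
      · rw [Function.update_of_ne (hg.ne hr)]; exact hS r
    obtain ⟨τ, h₁, h₂, h₃, h₄⟩ := ih hS'
    refine ⟨τ, Det.seq (det_clear (g M) σ (T := 6 * S + 1) ?_) h₁ ?_, ?_, ?_, ?_⟩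
    · have := hS M; omega
    · nlinarith
    · intro r hr
      rcases Nat.lt_succ_iff_lt_or_eq.1 hr with hr | rfl
      · exact h₂ r hr
      · rw [h₃ r le_rfl]; simp
    · intro r hr
      rw [h₃ r (by omega), Function.update_of_ne (hg.ne (by omega))]
    · intro r hr
      rw [h₄ r hr, Function.update_of_ne]
      rintro rfl
      exact hr ⟨M, rfl⟩

/-! ## Layout of the registers of the simulator -/

/-- The registers in which the adversary is run. -/
def advReg (r : ℕ) : ℕ := if r = 1 then 1 else 3 * r + 24

/-- The registers in which an honest receiver is run. -/
def recvReg (r : ℕ) : ℕ := 3 * r + 25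

/-- The registers for parameters and control. -/
def workReg (r : ℕ) : ℕ := 3 * r + 26

/-- The three families use the residues 0, 1, 2 modulo 3 from register 24 on, above the input
registers. The one exception is `advReg 1 = 1`: the adversary's last output is then already where a
machine's output is looked for. -/
theorem advReg_injective : advReg.Injective := by
  intro a b h
  simp only [advReg] at h
  split_ifs at h <;> omega

theorem recvReg_injective : recvReg.Injective := by
  intro a b h
  simp only [recvReg] at h
  omega

theorem workReg_injective : workReg.Injective := by
  intro a b h
  simp only [workReg] at h
  omega

theorem advReg_ne_recvReg (a b : ℕ) : advReg a ≠ recvReg b := by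
  simp only [advReg, recvReg]
  split_ifs <;> omega

theorem advReg_ne_workReg (a b : ℕ) : advReg a ≠ workReg b := by
  simp only [advReg, workReg]
  split_ifs <;> omega

theorem recvReg_ne_workReg (a b : ℕ) : recvReg a ≠ workReg b := by
  simp only [recvReg, workReg]
  omega

section Views

variable (σ : Store) (r : ℕ) (v : Str)

theorem update_adv_adv : Function.update σ (advReg r) v ∘ advReg = Function.update (σ ∘ advReg) r v :=
  Function.update_comp_eq_of_injective _ advReg_injective _ _

theorem update_recv_recv :
    Function.update σ (recvReg r) v ∘ recvReg = Function.update (σ ∘ recvReg) r v :=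
  Function.update_comp_eq_of_injective _ recvReg_injective _ _

theorem update_work_work :
    Function.update σ (workReg r) v ∘ workReg = Function.update (σ ∘ workReg) r v :=
  Function.update_comp_eq_of_injective _ workReg_injective _ _

theorem update_adv_recv : Function.update σ (advReg r) v ∘ recvReg = σ ∘ recvReg :=
  Function.update_comp_eq_of_notMem_range _ _ fun ⟨_, h⟩ => advReg_ne_recvReg _ _ h.symm

theorem update_adv_work : Function.update σ (advReg r) v ∘ workReg = σ ∘ workReg :=
  Function.update_comp_eq_of_notMem_range _ _ fun ⟨_, h⟩ => advReg_ne_workReg _ _ h.symm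

theorem update_recv_adv : Function.update σ (recvReg r) v ∘ advReg = σ ∘ advReg :=
  Function.update_comp_eq_of_notMem_range _ _ fun ⟨_, h⟩ => advReg_ne_recvReg _ _ h

theorem update_recv_work : Function.update σ (recvReg r) v ∘ workReg = σ ∘ workReg :=
  Function.update_comp_eq_of_notMem_range _ _ fun ⟨_, h⟩ => recvReg_ne_workReg _ _ h.symm

theorem update_work_adv : Function.update σ (workReg r) v ∘ advReg = σ ∘ advReg :=
  Function.update_comp_eq_of_notMem_range _ _ fun ⟨_, h⟩ => advReg_ne_workReg _ _ h

theorem update_work_recv : Function.update σ (workReg r) v ∘ recvReg = σ ∘ recvReg :=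
  Function.update_comp_eq_of_notMem_range _ _ fun ⟨_, h⟩ => recvReg_ne_workReg _ _ h

end Views

/-- The store consists of the three given parts (up to registers that are not used). -/
def Parts (a ρ W : Store) (σ : Store) : Prop :=
  σ ∘ advReg = a ∧ σ ∘ recvReg = ρ ∧ σ ∘ workReg = W

namespace Parts

variable {a ρ W σ : Store}

theorem adv (h : Parts a ρ W σ) (r : ℕ) : σ (advReg r) = a r := congrFun h.1 r

theorem recv (h : Parts a ρ W σ) (r : ℕ) : σ (recvReg r) = ρ r := congrFun h.2.1 r

theorem work (h : Parts a ρ W σ) (r : ℕ) : σ (workReg r) = W r := congrFun h.2.2 r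

theorem update_adv (h : Parts a ρ W σ) (r : ℕ) (v : Str) :
    Parts (Function.update a r v) ρ W (Function.update σ (advReg r) v) := by
  obtain ⟨rfl, rfl, rfl⟩ := h
  exact ⟨update_adv_adv _ _ _, update_adv_recv _ _ _, update_adv_work _ _ _⟩

theorem update_recv (h : Parts a ρ W σ) (r : ℕ) (v : Str) :
    Parts a (Function.update ρ r v) W (Function.update σ (recvReg r) v) := by
  obtain ⟨rfl, rfl, rfl⟩ := h
  exact ⟨update_recv_adv _ _ _, update_recv_recv _ _ _, update_recv_work _ _ _⟩

theorem update_work (h : Parts a ρ W σ) (r : ℕ) (v : Str) :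
    Parts a ρ (Function.update W r v) (Function.update σ (workReg r) v) := by
  obtain ⟨rfl, rfl, rfl⟩ := h
  exact ⟨update_work_adv _ _ _, update_work_recv _ _ _, update_work_work _ _ _⟩

theorem impl_adv {c : Cmd} {T : ℕ} (h : Parts a ρ W σ) (hc : HaltsIn c a T) :
    Impl (c.rename advReg) σ T (exec c a) fun a' σ' => Parts a' ρ W σ' := by
  obtain ⟨rfl, rfl, rfl⟩ := h
  refine (Impl.rename advReg_injective hc).mono le_rfl ?_
  rintro a' - σ' ⟨h₁, h₂⟩
  refine ⟨h₁, funext fun r => h₂ _ ?_, funext fun r => h₂ _ ?_⟩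
  · rintro ⟨s, hs⟩; exact advReg_ne_recvReg _ _ hs
  · rintro ⟨s, hs⟩; exact advReg_ne_workReg _ _ hs

theorem impl_recv {c : Cmd} {T : ℕ} (h : Parts a ρ W σ) (hc : HaltsIn c ρ T) :
    Impl (c.rename recvReg) σ T (exec c ρ) fun ρ' σ' => Parts a ρ' W σ' := by
  obtain ⟨rfl, rfl, rfl⟩ := h
  refine (Impl.rename recvReg_injective hc).mono le_rfl ?_
  rintro a' - σ' ⟨h₁, h₂⟩
  refine ⟨funext fun r => h₂ _ ?_, h₁, funext fun r => h₂ _ ?_⟩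
  · rintro ⟨s, hs⟩; exact advReg_ne_recvReg _ _ hs.symm
  · rintro ⟨s, hs⟩; exact recvReg_ne_workReg _ _ hs

end Parts

end PrivateRouting

/-! ### The simulator: sessions with index 0 and their schedule inside one machine. -/

namespace PrivateRouting

/-! ## Running a retrieval session inside a machine -/

/-- `σ` is a store that the machine may have between two activations, after having received messages
of total size `L`. -/
def Idle (c : Cmd) (σ₀ : Store) (L : ℕ) (σ : Store) : Prop :=
  ∀ msg : Str, Reach c σ₀ (L + (msg.length + 1)) (deliver σ msg)

theorem Idle.init (c : Cmd) (σ₀ : Store) : Idle c σ₀ 0 σ₀ := fun msg => by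
  rw [zero_add]; exact Reach.first msg

theorem Idle.exec {c : Cmd} {σ₀ σ σ' : Store} {L : ℕ} {msg : Str} (h : Idle c σ₀ L σ)
    (hσ' : σ' ∈ (exec c (deliver σ msg)).support) : Idle c σ₀ (L + (msg.length + 1)) σ' :=
  fun msg' => Reach.next (h msg) hσ' msg'

theorem deliver_zero (σ : Store) (msg : Str) : deliver σ msg 0 = msg := by simp [deliver]

theorem deliver_one (σ : Store) (msg : Str) : deliver σ msg 1 = [] := by simp [deliver]

theorem deliver_of_ne {σ : Store} {msg : Str} {r : ℕ} (h0 : r ≠ 0) (h1 : r ≠ 1) :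
    deliver σ msg r = σ r := by simp [deliver, h0, h1]

theorem RetrievalProtocol.run_eq (P : RetrievalProtocol) (server : Cmd) (k n m i : ℕ) (σ : Store) :
    P.run server k n m i σ =
      (interact server P.receiver (P.rounds k n m) σ
        (RetrievalProtocol.receiverStore k n m i) []).bind
        fun x => (exec server (deliver x.1 x.2.2)).map fun σ' => (σ', x.2.1 6) := rfl

/-- One round: the adversary is activated, and then the receiver with the adversary's answer. -/
def roundCmd (A R : Cmd) : Cmd :=
  Cmd.seq (Cmd.pop (workReg 1)) <| Cmd.seq (A.rename advReg) <|
    Cmd.seq (transfer (advReg 1) (workReg 0) (recvReg 0)) <| Cmd.seq (R.rename recvReg) <|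
      transfer (recvReg 1) (workReg 0) (advReg 0)

/-- A session of the adversary with the receiver on index `0`. The security parameter, the number
and the length of the records, and the number of rounds are found in the work registers `2`,
`n`, `m`, `r`. -/
def sessionCmd (A R : Cmd) (n m r : ℕ) : Cmd :=
  Cmd.seq (copy (workReg 2) (workReg 0) (recvReg 2)) <|
  Cmd.seq (copy (workReg n) (workReg 0) (recvReg 3)) <|
  Cmd.seq (copy (workReg m) (workReg 0) (recvReg 4)) <|
  Cmd.seq (copy (workReg r) (workReg 0) (workReg 1)) <|
  Cmd.seq (clear (advReg 0)) <| Cmd.seq (clear (advReg 1)) <|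
  Cmd.seq (Cmd.loop (workReg 1) (roundCmd A R)) <| Cmd.seq (A.rename advReg) <|
    clearAll recvReg (max 5 R.regBound)

variable {A R : Cmd} {σ₀ ρ₀ : Store} {B₀ B Lmax : ℕ}

/-- `ρ` is the receiver's abstract store and `ρm` its copy in memory; they may differ in registers 0
and 1, which the next delivery overwrites. A message of the adversary has length at most `B₀`, so a
round adds at most `B₀ + 1` to the quantity `L` on which the receiver's running time depends. -/
theorem impl_roundCmd (hA : ∀ L σ, Reach A σ₀ L σ → HaltsIn A σ B₀) (hB₀ : B₀ ≤ B)
    (hR : ∀ L ρ, L ≤ Lmax → Reach R ρ₀ L ρ → HaltsIn R ρ B)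
    {L L' S : ℕ} {σ ρ ρm W mem : Store} {msg : Str}
    (hσ : Idle A σ₀ L' σ) (hρ : Idle R ρ₀ L ρ) (hL : L + (B₀ + 1) ≤ Lmax)
    (hmem : Parts (deliver σ msg) ρm W mem) (hmsg : msg.length ≤ B) (hW : W 0 = [])
    (hρm : ∀ r, r ≠ 0 → r ≠ 1 → ρm r = ρ r) (hρm1 : ρm 1 = [])
    (hρm0 : (ρm 0).length ≤ 2 * B) (hS : ∀ r, (ρm r).length ≤ S) :
    Impl (roundCmd A R) mem (60 * B + 25)
      ((exec A (deliver σ msg)).bind fun σ' => (exec R (deliver ρ (σ' 1))).map fun ρ' => (σ', ρ'))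
      fun x mem' => (∃ L', Idle A σ₀ L' x.1) ∧ (∃ L' ≤ L + (B₀ + 1), Idle R ρ₀ L' x.2) ∧
        Parts (deliver x.1 (x.2 1)) (Function.update x.2 1 []) (Function.update W 1 (W 1).tail)
          mem' ∧ (x.2 1).length ≤ B ∧ (x.2 0).length ≤ 2 * B ∧
        (∀ r, (x.2 r).length ≤ S + 2 * B) ∧
        ∀ r, R.regBound ≤ r → r ≠ 0 → r ≠ 1 → x.2 r = ρm r := by
  refine Impl.det_seq (T' := 60 * B + 23) Det.pop ?_ (by omega)
  have h₁ := hmem.update_work 1 (mem (workReg 1)).tail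
  rw [show Function.update W 1 (mem (workReg 1)).tail = Function.update W 1 (W 1).tail by
    rw [hmem.work]] at h₁
  have hAσ₀ := hA _ _ (hσ msg)
  have hAσ : HaltsIn A (deliver σ msg) B := hAσ₀.mono hB₀
  refine Impl.seq (T' := 59 * B + 22) (h₁.impl_adv hAσ) ?_ (by omega)
  intro σ' hσ' mem₁ h₁
  have hlen₀ : (σ' 1).length ≤ B₀ := by
    have := length_le_of_exec hAσ₀ hσ' 1
    rwa [deliver_one, List.length_nil, zero_add] at this
  have hlen := hlen₀.trans hB₀
  have hlen0 : (σ' 0).length ≤ 2 * B := by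
    have := length_le_of_exec hAσ hσ' 0
    rw [deliver_zero] at this
    omega
  -- The word moved has length at most `B` and the word it replaces at most `2 * B`, so the cost is
  -- `16 * B + 6 * (2 * B) + 5`.
  refine Impl.det_seq (T := 28 * B + 5) (T' := 31 * B + 16)
    (det_transfer (advReg_ne_workReg _ _) (advReg_ne_recvReg _ _)
      (recvReg_ne_workReg _ _).symm ?_ ?_) ?_ (by omega)
  · rw [h₁.work]; simpa using hW
  · rw [h₁.adv, h₁.recv]; omega
  -- The transfer amounts to a delivery, because register 1 of the receiver is already empty.
  have hρeq : Function.update ρm 0 (σ' 1) = deliver ρ (σ' 1) := by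
    funext r
    by_cases h0 : r = 0
    · subst h0; simp [deliver_zero]
    by_cases h1 : r = 1
    · subst h1; simp [deliver_one, hρm1]
    rw [deliver_of_ne h0 h1, Function.update_of_ne h0, hρm r h0 h1]
  have h₂ := (h₁.update_adv 1 []).update_recv 0 (mem₁ (advReg 1))
  rw [show Function.update ρm 0 (mem₁ (advReg 1)) = deliver ρ (σ' 1) by rw [h₁.adv, hρeq]] at h₂
  have hRρ : HaltsIn R (deliver ρ (σ' 1)) B := hR _ _ (by omega) (hρ (σ' 1))
  refine Impl.seq_det (T := B) (T' := 28 * B + 5) (ν := (exec R (deliver ρ (σ' 1))).map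
    fun ρ' => (σ', ρ')) (Rel := fun x mem' => x.1 = σ' ∧ x.2 ∈ (exec R (deliver ρ (σ' 1))).support ∧
      Parts (Function.update σ' 1 []) x.2 (Function.update W 1 (W 1).tail) mem') ?_ ?_ (by omega)
  · have h₃ := h₂.impl_recv hRρ
    refine ⟨h₃.1, Coupled.map_left (h₃.2.mono (Rel' := fun ρ' mem' =>
      ρ' ∈ (exec R (deliver ρ (σ' 1))).support ∧ Parts _ ρ' _ mem')
      fun a ha b _ hab => ⟨ha, hab⟩) _ ?_⟩
    rintro ρ' mem' ⟨h, h'⟩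
    exact ⟨rfl, h, h'⟩
  · rintro ⟨σ'', ρ'⟩ - mem₃ ⟨h, hρ', h₃⟩
    change σ'' = σ' at h
    subst h
    dsimp only at hρ' h₃ ⊢
    have hlen' : ∀ r, (ρ' r).length ≤ (deliver ρ (σ'' 1) r).length + B :=
      fun r => length_le_of_exec hRρ hρ' r
    have hlen1 : (ρ' 1).length ≤ B := by
      have := hlen' 1
      rwa [deliver_one, List.length_nil, zero_add] at this
    refine ⟨_, det_transfer (recvReg_ne_workReg _ _) (advReg_ne_recvReg _ _).symm
      (advReg_ne_workReg _ _).symm ?_ ?_, ⟨_, hσ.exec hσ'⟩, ⟨_, ?_, hρ.exec hρ'⟩, ?_, hlen1,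
      ?_, ?_, ?_⟩
    · rw [h₃.work]; simpa using hW
    · rw [h₃.adv, h₃.recv]
      simp only [ne_eq, zero_ne_one, not_false_eq_true, Function.update_of_ne]
      omega
    · omega
    · have h₄ := (h₃.update_recv 1 []).update_adv 0 (mem₃ (recvReg 1))
      rw [← h₃.recv 1]
      convert h₄ using 1
      exact Function.update_comm (by norm_num) _ _ _
    · have := hlen' 0
      rw [deliver_zero] at this
      omega
    · intro r
      have := hlen' r
      rw [← hρeq] at this
      by_cases h0 : r = 0
      · subst h0; simp only [Function.update_self] at this; omega
      · rw [Function.update_of_ne h0] at this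
        have := hS r
        omega
    · intro r hr h0 h1
      rw [exec_of_regBound hRρ hρ' hr, ← hρeq, Function.update_of_ne h0]

/-- The growth of the receiver's registers by `2 * B` per round, and the emptiness of those beyond
`R.regBound`, are carried along so that the receiver can be erased in bounded time. -/
theorem impl_rounds (hA : ∀ L σ, Reach A σ₀ L σ → HaltsIn A σ B₀) (hB₀ : B₀ ≤ B)
    (hR : ∀ L ρ, L ≤ Lmax → Reach R ρ₀ L ρ → HaltsIn R ρ B) (j : ℕ)
    {L L' S : ℕ} {σ ρ ρm W mem : Store} {msg : Str}
    (hσ : Idle A σ₀ L' σ) (hρ : Idle R ρ₀ L ρ) (hL : L + j * (B₀ + 1) ≤ Lmax)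
    (hmem : Parts (deliver σ msg) ρm W mem) (hmsg : msg.length ≤ B) (hW : W 0 = [])
    (hW1 : W 1 = ones j) (hρm : ∀ r, r ≠ 0 → r ≠ 1 → ρm r = ρ r) (hρm1 : ρm 1 = [])
    (hρm0 : (ρm 0).length ≤ 2 * B) (hS : ∀ r, (ρm r).length ≤ S)
    (hfar : ∀ r, max 5 R.regBound ≤ r → ρm r = []) :
    Impl (Cmd.loop (workReg 1) (roundCmd A R)) mem (j * (60 * B + 26) + 1)
      (interact A R j σ ρ msg)
      fun x mem' => (∃ L', Idle A σ₀ L' x.1) ∧ x.2.2.length ≤ B ∧ ∃ ρm',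
        Parts (deliver x.1 x.2.2) ρm' (Function.update W 1 []) mem' ∧
        (∀ r, (ρm' r).length ≤ S + 2 * B * j) ∧ ∀ r, max 5 R.regBound ≤ r → ρm' r = [] := by
  induction j generalizing L L' S σ ρ ρm W mem msg with
  | zero =>
    refine Impl.loop_nil (by rw [hmem.work, hW1]; rfl) ?_ (by omega)
    refine ⟨⟨_, hσ⟩, hmsg, ρm, ?_, by simpa using hS, hfar⟩
    rwa [← show W 1 = [] from hW1, Function.update_eq_self]
  | succ j ih =>
    have h := impl_roundCmd hA hB₀ hR hσ hρ (by nlinarith) hmem hmsg hW hρm hρm1 hρm0 hS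
    have hν : interact A R (j + 1) σ ρ msg = ((exec A (deliver σ msg)).bind fun σ' =>
        (exec R (deliver ρ (σ' 1))).map fun ρ' => (σ', ρ')).bind
        fun x => interact A R j x.1 x.2 (x.2 1) := by
      rw [PMF.bind_bind]
      simp only [PMF.bind_map]
      rfl
    rw [hν]
    refine Impl.loop_cons (T' := j * (60 * B + 26) + 1) (by rw [hmem.work, hW1]; simp [ones]) h ?_
      (by nlinarith)
    rintro ⟨σ', ρ'⟩ - mem' ⟨⟨L₁, h₁⟩, ⟨L₂, hL₂, h₂⟩, h₃, h₄, h₅, h₆, h₇⟩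
    dsimp only at h₁ h₂ h₃ h₄ h₅ h₆ h₇ ⊢
    have h := ih (S := S + 2 * B) h₁ h₂ (by nlinarith) h₃ h₄ (by simpa using hW)
      (by simp [hW1, ones, List.replicate_succ])
      (fun r _ h1 => by rw [Function.update_of_ne h1]) (by simp)
      (by simpa using h₅) (fun r => by
        by_cases h1 : r = 1
        · subst h1; simp
        · rw [Function.update_of_ne h1]; exact h₆ r)
      (fun r hr => by
        have hr' := max_le_iff.1 hr
        rw [Function.update_of_ne (by omega), h₇ r hr'.2 (by omega) (by omega), hfar r hr])
    refine h.mono le_rfl ?_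
    rintro x - mem₂ ⟨g₁, g₂, ρm', g₃, g₄, g₅⟩
    refine ⟨g₁, g₂, ρm', by simpa using g₃, fun r => (g₄ r).trans (by nlinarith), g₅⟩

/-- The store holds the adversary's store `σ` (up to register `0`, which the next message
overwrites), no receiver, and the work registers `W`. -/
def Resting (B : ℕ) (σ W mem : Store) : Prop :=
  ∃ a, Parts a (fun _ => []) W mem ∧ (∀ r, r ≠ 0 → a r = σ r) ∧ (a 0).length ≤ 2 * B ∧
    (a 1).length ≤ 2 * B

/-- A bound on the running time of a session. -/
def sessionTime (R : Cmd) (B : ℕ) : ℕ :=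
  B * (60 * B + 26) + 97 * B + max 5 R.regBound * (6 * (B + 2 * B * B) + 2) + 30

/-- Index 0 has the empty binary code, so the receiver's initial store is made of public parameters
only. At most `B₀` rounds with contributions of at most `B₀ + 1` explain the bound `B₀ * (B₀ + 1)`
on what the receiver reads. -/
theorem impl_sessionCmd {P : RetrievalProtocol} {k n m : ℕ}
    (hA : ∀ L σ, Reach A σ₀ L σ → HaltsIn A σ B₀) (hB₀ : B₀ ≤ B)
    (hR : ∀ L ρ, L ≤ B₀ * (B₀ + 1) → Reach P.receiver (RetrievalProtocol.receiverStore k n m 0) L ρ →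
      HaltsIn P.receiver ρ B)
    {nr mr rr : ℕ} {L' : ℕ} {σ W mem : Store} (hσ : Idle A σ₀ L' σ) (hmem : Resting B σ W mem)
    (h0 : W 0 = []) (h1 : W 1 = []) (hk : W 2 = ones k) (hn : W nr = ones n) (hm : W mr = ones m)
    (hr : W rr = ones (P.rounds k n m)) (hkB : k ≤ B) (hnB : n ≤ B) (hmB : m ≤ B)
    (hrB₀ : P.rounds k n m ≤ B₀) (hnr : 2 ≤ nr) (hmr : 2 ≤ mr) (hrr : 2 ≤ rr) :
    Impl (sessionCmd A P.receiver nr mr rr) mem (sessionTime P.receiver B)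
      ((P.run A k n m 0 σ).map Prod.fst)
      fun σ' mem' => (∃ L', Idle A σ₀ L' σ') ∧ Resting B σ' W mem' := by
  have hrB := hrB₀.trans hB₀
  obtain ⟨a, ha, haσ, ha0, ha1⟩ := hmem
  have copyWork : ∀ {ρ W mem : Store} (s d : ℕ), Parts a ρ W mem → W 0 = [] → s ≠ 0 →
      ρ d = [] → (W s).length ≤ B →
      Det (copy (workReg s) (workReg 0) (recvReg d)) mem (18 * B + 3)
          (Function.update mem (recvReg d) (mem (workReg s))) ∧
        Parts a (Function.update ρ d (W s)) W
          (Function.update mem (recvReg d) (mem (workReg s))) := by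
    intro ρ W mem s d h h0 hs hd hsB
    refine ⟨det_copy (workReg_injective.ne hs) (recvReg_ne_workReg _ _).symm
      (recvReg_ne_workReg _ _).symm (by rw [h.work, h0]) (by rw [h.recv, hd]) ?_, ?_⟩
    · rw [h.work]; omega
    · rw [← h.work s]; exact h.update_recv _ _
  obtain ⟨c₁, h₁⟩ := copyWork 2 2 ha h0 (by norm_num) rfl (by simpa [hk, ones] using hkB)
  obtain ⟨c₂, h₂⟩ := copyWork nr 3 h₁ h0 (by omega) (by simp) (by simpa [hn, ones] using hnB)
  obtain ⟨c₃, h₃⟩ := copyWork mr 4 h₂ h0 (by omega) (by simp) (by simpa [hm, ones] using hmB)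
  rw [hk, hn, hm] at h₃
  generalize Function.update (Function.update (Function.update mem (recvReg 2) (mem (workReg 2)))
    (recvReg 3) _) (recvReg 4) _ = mem₃ at c₃ h₃
  have h₄ := h₃.update_work 1 (mem₃ (workReg rr))
  have h₅ := (h₄.update_adv 0 []).update_adv 1 []
  have ea : Function.update (Function.update a 0 []) 1 [] = deliver σ [] := by
    funext r
    by_cases r0 : r = 0
    · subst r0; simp [deliver_zero]
    by_cases r1 : r = 1
    · subst r1; simp [deliver_one]
    rw [deliver_of_ne r0 r1, Function.update_of_ne r1, Function.update_of_ne r0, haσ r r0]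
  have eρ : Function.update (Function.update (Function.update (fun _ => []) 2 (ones k)) 3 (ones n))
      4 (ones m) = RetrievalProtocol.receiverStore k n m 0 := by
    funext r
    match r with
    | 0 | 1 | 2 | 3 | 4 | 5 => simp [RetrievalProtocol.receiverStore]
    | r + 6 => simp [RetrievalProtocol.receiverStore]
  have eW : Function.update W 1 (mem₃ (workReg rr)) =
      Function.update W 1 (ones (P.rounds k n m)) := by rw [h₃.work, hr]
  rw [ea, eρ, eW] at h₅
  have hν : (P.run A k n m 0 σ).map Prod.fst =
      (interact A P.receiver (P.rounds k n m) σ (RetrievalProtocol.receiverStore k n m 0) []).bind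
        fun x => exec A (deliver x.1 x.2.2) := by
    rw [RetrievalProtocol.run_eq, PMF.map_bind]
    refine pmf_bind_congr fun x _ => ?_
    rw [PMF.map_comp]
    exact PMF.map_id _
  rw [hν]
  have hrecv : ∀ r, (RetrievalProtocol.receiverStore k n m 0 r).length ≤ B := fun r => by
    match r with
    | 0 | 1 | 2 | 3 | 4 | 5 => simp [RetrievalProtocol.receiverStore, ones, hkB, hnB, hmB]
    | r + 6 => simp [RetrievalProtocol.receiverStore]
  -- For index 0 register 5 is empty, so the nonempty input registers end at 4, and clearing `max 5
  -- P.receiver.regBound` registers removes every trace of the receiver.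
  have hfar : ∀ r, max 5 P.receiver.regBound ≤ r →
      RetrievalProtocol.receiverStore k n m 0 r = [] := fun r hr => by
    have := (max_le_iff.1 hr).1
    match r with
    | 5 => simp [RetrievalProtocol.receiverStore]
    | r + 6 => simp [RetrievalProtocol.receiverStore]
  have hloop := impl_rounds hA hB₀ hR (P.rounds k n m) hσ (Idle.init _ _)
    (by rw [zero_add]; exact Nat.mul_le_mul_right _ hrB₀) h₅ (by simp) (by simpa using h0)
    (by simp) (fun _ _ _ => rfl) rfl (by simp [RetrievalProtocol.receiverStore]) hrecv hfar
  have hend := Impl.seq (d := Cmd.seq (A.rename advReg)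
      (clearAll recvReg (max 5 P.receiver.regBound)))
    (ν' := fun x => exec A (deliver x.1 x.2.2))
    (Rel' := fun σ' mem' => (∃ L', Idle A σ₀ L' σ') ∧ Resting B σ' W mem')
    (T' := B + (max 5 P.receiver.regBound * (6 * (B + 2 * B * B) + 2) + 1) + 1) hloop (by
      rintro ⟨σ₁, ρ₁, msg₁⟩ - mem₁ ⟨⟨L₁, g₁⟩, g₂, ρm, g₃, g₄, g₅⟩
      dsimp only at g₁ g₂ g₃ ⊢
      rw [Function.update_idem, ← h1, Function.update_eq_self] at g₃
      have hσ₁ := (hA _ _ (g₁ msg₁)).mono hB₀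
      refine Impl.seq_det (g₃.impl_adv hσ₁) ?_ le_rfl
      intro σ' hσ' mem₂ h
      obtain ⟨τ, t₁, t₂, t₃, t₄⟩ := det_clearAll recvReg_injective (max 5 P.receiver.regBound)
        (σ := mem₂) (S := B + 2 * B * B) fun r => by
          rw [h.recv]
          refine (g₄ r).trans (Nat.add_le_add_left (Nat.mul_le_mul_left _ hrB) _)
      refine ⟨τ, t₁, ⟨_, g₁.exec hσ'⟩, σ', ⟨?_, ?_, ?_⟩, fun _ _ => rfl, ?_, ?_⟩
      · funext r
        rw [Function.comp_apply, t₄ _ (fun ⟨s, hs⟩ => advReg_ne_recvReg _ _ hs.symm), h.adv]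
      · funext r
        rw [Function.comp_apply]
        by_cases hr : r < max 5 P.receiver.regBound
        · exact t₂ r hr
        · rw [t₃ r (not_lt.1 hr), h.recv, g₅ r (not_lt.1 hr)]
      · funext r
        rw [Function.comp_apply, t₄ _ (fun ⟨s, hs⟩ => recvReg_ne_workReg _ _ hs), h.work]
      · have := length_le_of_exec hσ₁ hσ' 0
        rw [deliver_zero] at this
        omega
      · have := length_le_of_exec hσ₁ hσ' 1
        rw [deliver_one, List.length_nil] at this
        omega) le_rfl
  have hlt := Nat.mul_le_mul_right (60 * B + 26) hrB
  refine Impl.det_seq c₁ (Impl.det_seq c₂ (Impl.det_seq c₃ (Impl.det_seq (T := 18 * B + 3)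
    (det_copy (workReg_injective.ne (by omega)) (workReg_injective.ne (by omega))
      (workReg_injective.ne (by omega)) (by rw [h₃.work, h0]) (by rw [h₃.work, h1])
      (by rw [h₃.work, hr]; simpa [ones] using hrB))
    (Impl.det_seq (T := 12 * B + 1) (det_clear _ _ ?_)
      (Impl.det_seq (T := 12 * B + 1) (det_clear _ _ ?_) hend le_rfl) le_rfl) le_rfl) le_rfl)
    le_rfl) ?_
  · rw [h₄.adv]; omega
  · rw [(h₄.update_adv 0 []).adv, Function.update_of_ne (by norm_num)]; omega
  · rw [sessionTime]; omega

end PrivateRouting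

namespace PrivateRouting

/-! ## Schedules -/

/-- The kinds of retrieval sessions in the routing protocol. -/
inductive Session : Type
  | otKey | otLabel | pirSrc | pirDst

namespace Session

def protocol (pir ot : RetrievalProtocol) : Session → RetrievalProtocol
  | otKey => ot
  | otLabel => ot
  | pirSrc => pir
  | pirDst => pir

/-- number of records -/
def count (pp : PublicParams) : Session → ℕ
  | otLabel => 2
  | _ => pp.n

/-- length of the records -/
def len (pp : PublicParams) : Session → ℕ
  | otKey => pp.keyLen
  | otLabel => pp.labelLen
  | pirSrc => pp.srcLen
  | pirDst => pp.dstLen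

def rounds (pir ot : RetrievalProtocol) (k : ℕ) (pp : PublicParams) (s : Session) : ℕ :=
  (s.protocol pir ot).rounds k (s.count pp) (s.len pp)

/-- The work register with the number of records. -/
def countReg : Session → ℕ
  | otLabel => 22
  | _ => 3

/-- The work register with the length of the records. -/
def lenReg : Session → ℕ
  | otKey => 9
  | otLabel => 12
  | pirSrc => 14
  | pirDst => 15

/-- The work register with the number of rounds. -/
def roundsReg : Session → ℕ
  | otKey => 17
  | otLabel => 20
  | pirSrc => 18
  | pirDst => 19

noncomputable def run (pir ot : RetrievalProtocol) (A : Cmd) (k : ℕ) (pp : PublicParams)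
    (s : Session) (i : ℕ) (σ : Store) : PMF (Store × Str) :=
  (s.protocol pir ot).run A k (s.count pp) (s.len pp) i σ

def cmd (pir ot : RetrievalProtocol) (A : Cmd) (s : Session) : Cmd :=
  sessionCmd A (s.protocol pir ot).receiver s.countReg s.lenReg s.roundsReg

end Session

/-- A session, or an activation of the adversary on the empty message. -/
abbrev Item := Option Session

/-- A prefix code, which the nested `dispatch` of `restCmd` decodes bit by bit. -/
def Item.code : Item → Str
  | none => [false]
  | some Session.otLabel => [true, false]
  | some Session.otKey => [true, true, false]
  | some Session.pirSrc => [true, true, true, false]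
  | some Session.pirDst => [true, true, true, true]

def itemsCode (items : List Item) : Str := items.flatMap Item.code

/-- The effect of an item on the adversary's store, when receivers have index `0`. -/
noncomputable def Item.sem (pir ot : RetrievalProtocol) (A : Cmd) (k : ℕ) (pp : PublicParams) :
    Item → Store → PMF Store
  | none, σ => exec A (deliver σ [])
  | some s, σ => (s.run pir ot A k pp 0 σ).map Prod.fst

/-- What remains of an execution of the adversary against receivers with index `0`. -/
noncomputable def restSem (pir ot : RetrievalProtocol) (A : Cmd) (k : ℕ) (pp : PublicParams) :
    List Item → Store → PMF Store
  | [], σ => PMF.pure σ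
  | item :: items, σ => (item.sem pir ot A k pp σ).bind (restSem pir ot A k pp items)

def activateCmd (A : Cmd) : Cmd :=
  Cmd.seq (clear (advReg 0)) (Cmd.seq (clear (advReg 1)) (A.rename advReg))

/-- Pop a bit from the register `r` and branch on it. -/
def dispatch (r : ℕ) (c₀ c₁ : Cmd) : Cmd :=
  Cmd.branch r Cmd.skip (Cmd.seq (Cmd.pop r) c₀) (Cmd.seq (Cmd.pop r) c₁)

/-- Run all the items on the schedule. -/
def restCmd (pir ot : RetrievalProtocol) (A : Cmd) : Cmd :=
  Cmd.loop (workReg 23) <| dispatch (workReg 23) (activateCmd A) <|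
    dispatch (workReg 23) (Session.otLabel.cmd pir ot A) <|
    dispatch (workReg 23) (Session.otKey.cmd pir ot A) <|
    dispatch (workReg 23) (Session.pirSrc.cmd pir ot A) (Session.pirDst.cmd pir ot A)

theorem impl_dispatch {α : Type} {r : ℕ} {c₀ c₁ : Cmd} {σ : Store} {b : Bool} {l : Str}
    (hr : σ r = b :: l) {T U : ℕ} {ν : PMF α} {Rel : α → Store → Prop}
    (h : Impl (bif b then c₁ else c₀) (Function.update σ r l) T ν Rel) (hU : T + 3 ≤ U) :
    Impl (dispatch r c₀ c₁) σ U ν Rel := by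
  have hpop : Det (Cmd.pop r) σ 1 (Function.update σ r l) := Det.pop.congr (by simp [hr])
  cases b
  · exact Impl.branch_false hr (Impl.det_seq hpop h le_rfl) (by omega)
  · exact Impl.branch_true hr (Impl.det_seq hpop h le_rfl) (by omega)

/-- The work registers hold the parameters of the sessions. -/
structure WorkParams (pir ot : RetrievalProtocol) (k : ℕ) (pp : PublicParams) (W : Store) :
    Prop where
  tmp : W 0 = []
  counter : W 1 = []
  sec : W 2 = ones k
  count : ∀ s : Session, W s.countReg = ones (s.count pp)
  len : ∀ s : Session, W s.lenReg = ones (s.len pp)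
  rounds : ∀ s : Session, W s.roundsReg = ones (s.rounds pir ot k pp)

/-- Sessions read neither work register 8, the number of rounds, which is used up when the schedule
is written, nor the registers from 23 on, which hold the schedule and scratch data. -/
theorem WorkParams.update {pir ot : RetrievalProtocol} {k : ℕ} {pp : PublicParams} {W : Store}
    (h : WorkParams pir ot k pp W) {r : ℕ} (hr : 23 ≤ r ∨ r = 8) (v : Str) :
    WorkParams pir ot k pp (Function.update W r v) where
  tmp := by rw [Function.update_of_ne (by omega), h.tmp]
  counter := by rw [Function.update_of_ne (by omega), h.counter]
  sec := by rw [Function.update_of_ne (by omega), h.sec]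
  count s := by
    rw [Function.update_of_ne, h.count]
    cases s <;> simp only [Session.countReg] <;> omega
  len s := by
    rw [Function.update_of_ne, h.len]
    cases s <;> simp only [Session.lenReg] <;> omega
  rounds s := by
    rw [Function.update_of_ne, h.rounds]
    cases s <;> simp only [Session.roundsReg] <;> omega

/-- `B` bounds the parameters, and the running times of the adversary and of the receivers. -/
structure Bounds (pir ot : RetrievalProtocol) (A : Cmd) (k : ℕ) (pp : PublicParams) (σ₀ : Store)
    (B : ℕ) : Prop where
  sec : k ≤ B
  count : ∀ s : Session, s.count pp ≤ B
  len : ∀ s : Session, s.len pp ≤ B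
  machines : ∃ B₀ ≤ B, (∀ L σ, Reach A σ₀ L σ → HaltsIn A σ B₀) ∧
    ∀ s : Session, s.rounds pir ot k pp ≤ B₀ ∧
      ∀ L ρ, L ≤ B₀ * (B₀ + 1) → Reach (s.protocol pir ot).receiver
        (RetrievalProtocol.receiverStore k (s.count pp) (s.len pp) 0) L ρ →
          HaltsIn (s.protocol pir ot).receiver ρ B

theorem Bounds.adversary {pir ot : RetrievalProtocol} {A : Cmd} {k : ℕ} {pp : PublicParams}
    {σ₀ : Store} {B : ℕ} (h : Bounds pir ot A k pp σ₀ B) (L : ℕ) (σ : Store)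
    (hσ : Reach A σ₀ L σ) : HaltsIn A σ B := by
  obtain ⟨B₀, hB, hA, -⟩ := h.machines
  exact (hA L σ hσ).mono hB

theorem Bounds.rounds {pir ot : RetrievalProtocol} {A : Cmd} {k : ℕ} {pp : PublicParams}
    {σ₀ : Store} {B : ℕ} (h : Bounds pir ot A k pp σ₀ B) (s : Session) :
    s.rounds pir ot k pp ≤ B := by
  obtain ⟨B₀, hB, -, hs⟩ := h.machines
  exact (hs s).1.trans hB

/-- A bound on the running time of an item. -/
def itemTime (pir ot : RetrievalProtocol) (B : ℕ) : ℕ :=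
  sessionTime pir.receiver B + sessionTime ot.receiver B + 25 * B + 20

section Rest

variable {pir ot : RetrievalProtocol} {A : Cmd} {k : ℕ} {pp : PublicParams} {σ₀ : Store} {B : ℕ}

theorem impl_activateCmd (hB : Bounds pir ot A k pp σ₀ B) {L : ℕ} {σ W mem : Store}
    (hσ : Idle A σ₀ L σ) (hmem : Resting B σ W mem) :
    Impl (activateCmd A) mem (25 * B + 4) (exec A (deliver σ []))
      fun σ' mem' => (∃ L', Idle A σ₀ L' σ') ∧ Resting B σ' W mem' := by
  obtain ⟨a, ha, haσ, ha0, ha1⟩ := hmem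
  have h₁ := (ha.update_adv 0 []).update_adv 1 []
  have ea : Function.update (Function.update a 0 []) 1 [] = deliver σ [] := by
    funext r
    by_cases r0 : r = 0
    · subst r0; simp [deliver_zero]
    by_cases r1 : r = 1
    · subst r1; simp [deliver_one]
    rw [deliver_of_ne r0 r1, Function.update_of_ne r1, Function.update_of_ne r0, haσ r r0]
  rw [ea] at h₁
  have hAσ := hB.adversary _ _ (hσ [])
  refine Impl.det_seq (T := 12 * B + 1) (det_clear _ _ ?_)
    (Impl.det_seq (T := 12 * B + 1) (det_clear _ _ ?_)
      ((h₁.impl_adv hAσ).mono le_rfl ?_) le_rfl) (by omega)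
  · rw [ha.adv]; omega
  · rw [(ha.update_adv 0 []).adv, Function.update_of_ne (by norm_num)]; omega
  · intro σ' hσ' mem' h
    refine ⟨⟨_, hσ.exec hσ'⟩, σ', h, fun _ _ => rfl, ?_, ?_⟩
    · have := length_le_of_exec hAσ hσ' 0
      rw [deliver_zero, List.length_nil] at this
      omega
    · have := length_le_of_exec hAσ hσ' 1
      rw [deliver_one, List.length_nil] at this
      omega

theorem impl_session (hB : Bounds pir ot A k pp σ₀ B) (s : Session) {L : ℕ} {σ W mem : Store}
    (hW : WorkParams pir ot k pp W) (hσ : Idle A σ₀ L σ) (hmem : Resting B σ W mem) :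
    Impl (s.cmd pir ot A) mem (sessionTime pir.receiver B + sessionTime ot.receiver B)
      ((s.run pir ot A k pp 0 σ).map Prod.fst)
      fun σ' mem' => (∃ L', Idle A σ₀ L' σ') ∧ Resting B σ' W mem' := by
  obtain ⟨B₀, hB₀, hA, hs⟩ := hB.machines
  refine (impl_sessionCmd hA hB₀ (hs s).2 hσ hmem hW.tmp hW.counter hW.sec
    (hW.count s) (hW.len s) (hW.rounds s) hB.sec (hB.count s) (hB.len s) (hs s).1
    ?_ ?_ ?_).mono ?_ fun _ _ _ h => h
  · cases s <;> simp [Session.countReg]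
  · cases s <;> simp [Session.lenReg]
  · cases s <;> simp [Session.roundsReg]
  · cases s <;> simp [Session.protocol]

/-- Both machines use this program: the simulator for the whole schedule, the malicious server for
the part after the session under attack. `Resting` is restored after each item, which makes items
composable. -/
theorem impl_restCmd (hB : Bounds pir ot A k pp σ₀ B) (items : List Item) {L : ℕ}
    {σ W mem : Store} (hW : WorkParams pir ot k pp W) (hitems : W 23 = itemsCode items)
    (hσ : Idle A σ₀ L σ) (hmem : Resting B σ W mem) :
    Impl (restCmd pir ot A) mem (items.length * itemTime pir ot B + 1)
      (restSem pir ot A k pp items σ)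
      fun σ' mem' => (∃ L', Idle A σ₀ L' σ') ∧ Resting B σ' (Function.update W 23 []) mem' := by
  induction items generalizing L σ W mem with
  | nil =>
    obtain ⟨a, ha, h⟩ := hmem
    refine Impl.loop_nil (by rw [ha.work, hitems]; rfl) ⟨⟨_, hσ⟩, a, ?_, h⟩ (by omega)
    rwa [show Function.update W 23 [] = W by
      rw [← show W 23 = [] from hitems, Function.update_eq_self]]
  | cons item items ih =>
    have hpop : ∀ v, Resting B σ (Function.update W 23 v) (Function.update mem (workReg 23) v) :=
      fun v => by
        obtain ⟨a, ha, h⟩ := hmem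
        exact ⟨a, ha.update_work 23 v, h⟩
    have hcode : mem (workReg 23) = Item.code item ++ itemsCode items := by
      obtain ⟨a, ha, h⟩ := hmem
      rw [ha.work, hitems]; rfl
    rw [restSem]
    -- One step of each item's budget is spent on the loop test.
    refine Impl.loop_cons (T := itemTime pir ot B - 1) (T' := items.length * itemTime pir ot B + 1)
      (Rel := fun σ' mem' => (∃ L', Idle A σ₀ L' σ') ∧
        Resting B σ' (Function.update W 23 (itemsCode items)) mem') ?_ ?_ ?_ ?_
    · rw [hcode]
      rcases item with _ | _ | _ | _ | _ <;> simp [Item.code]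
    · have hW' := hW.update (r := 23) (by norm_num) (itemsCode items)
      have hp := hpop (itemsCode items)
      have hs := fun s => impl_session hB s hW' hσ hp
      have hT : itemTime pir ot B =
        sessionTime pir.receiver B + sessionTime ot.receiver B + 25 * B + 20 := rfl
      rcases item with _ | _ | _ | _ | _
      · exact impl_dispatch hcode (impl_activateCmd hB hσ hp) (by omega)
      · refine impl_dispatch hcode (impl_dispatch (b := true) (Function.update_self _ _ _)
          (impl_dispatch (b := false) (l := itemsCode items)
            (T := sessionTime pir.receiver B + sessionTime ot.receiver B) (Function.update_self _ _ _) ?_ le_rfl)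
          le_rfl) ?_
        · rw [Function.update_idem, Function.update_idem]
          exact hs _
        · omega
      · refine impl_dispatch hcode (impl_dispatch (b := false) (l := itemsCode items)
            (T := sessionTime pir.receiver B + sessionTime ot.receiver B)
          (Function.update_self _ _ _) ?_ le_rfl) ?_
        · rw [Function.update_idem]
          exact hs _
        · omega
      · refine impl_dispatch hcode (impl_dispatch (b := true) (Function.update_self _ _ _)
          (impl_dispatch (b := true) (Function.update_self _ _ _)
          (impl_dispatch (b := false) (l := itemsCode items)
            (T := sessionTime pir.receiver B + sessionTime ot.receiver B) (Function.update_self _ _ _) ?_ le_rfl)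
          le_rfl) le_rfl) ?_
        · rw [Function.update_idem, Function.update_idem, Function.update_idem]
          exact hs _
        · omega
      · refine impl_dispatch hcode (impl_dispatch (b := true) (Function.update_self _ _ _)
          (impl_dispatch (b := true) (Function.update_self _ _ _)
          (impl_dispatch (b := true) (l := itemsCode items)
            (T := sessionTime pir.receiver B + sessionTime ot.receiver B) (Function.update_self _ _ _) ?_ le_rfl)
          le_rfl) le_rfl) ?_
        · rw [Function.update_idem, Function.update_idem, Function.update_idem]
          exact hs _
        · omega
    · rintro σ' - mem' ⟨⟨L', h₁⟩, h₂⟩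
      have := ih (hW.update (r := 23) (by norm_num) _) (Function.update_self _ _ _) h₁ h₂
      rwa [Function.update_idem] at this
    · rw [List.length_cons, Nat.add_one_mul]
      have : 1 ≤ itemTime pir ot B := by rw [itemTime]; omega
      omega

end Rest

end PrivateRouting

namespace PrivateRouting

/-! ## The simulator -/

/-- The part of the schedule that belongs to one round. -/
def roundItems (pp : PublicParams) : List Item :=
  some Session.pirSrc :: some Session.pirDst ::
    (List.replicate (2 * pp.fieldBits) (some Session.otLabel) ++ [none])

/-- The part of the schedule that belongs to `r` rounds. -/
def roundsItems (pp : PublicParams) : ℕ → List Item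
  | 0 => []
  | r + 1 => roundItems pp ++ roundsItems pp r

/-- The schedule of the whole protocol. -/
def allItems (pp : PublicParams) : List Item :=
  some Session.otKey :: some Session.otKey :: (roundsItems pp pp.R ++ [none])

theorem length_roundsItems (pp : PublicParams) (r : ℕ) :
    (roundsItems pp r).length = r * (2 * pp.fieldBits + 3) := by
  induction r with
  | zero => simp [roundsItems]
  | succ r ih => simp [roundsItems, roundItems, ih]; ring

theorem length_allItems (pp : PublicParams) :
    (allItems pp).length = pp.R * (2 * pp.fieldBits + 3) + 3 := by
  simp [allItems, length_roundsItems]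

theorem itemsCode_append (l l' : List Item) : itemsCode (l ++ l') = itemsCode l ++ itemsCode l' :=
  List.flatMap_append

/-- Push a word on a register, its last letter first. -/
def pushWord (r : ℕ) : Str → Cmd
  | [] => Cmd.skip
  | b :: w => Cmd.seq (pushWord r w) (Cmd.push b r)

theorem det_pushWord (r : ℕ) (w : Str) (σ : Store) :
    Det (pushWord r w) σ (2 * w.length + 1) (Function.update σ r (w ++ σ r)) := by
  induction w with
  | nil => exact Det.skip.congr (by simp)
  | cons b w ih => exact (ih.seq Det.push (by simp; omega)).congr (by simp)

theorem Parts.det_pushWord {a ρ W σ : Store} (h : Parts a ρ W σ) (r : ℕ) (w : Str) :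
    ∃ τ, Det (pushWord (workReg r) w) σ (2 * w.length + 1) τ ∧
      Parts a ρ (Function.update W r (w ++ W r)) τ :=
  ⟨_, PrivateRouting.det_pushWord _ _ _, h.work r ▸ h.update_work r _⟩

theorem Parts.det_pop {a ρ W σ : Store} (h : Parts a ρ W σ) (r : ℕ) :
    ∃ τ, Det (Cmd.pop (workReg r)) σ 1 τ ∧ Parts a ρ (Function.update W r (W r).tail) τ :=
  ⟨_, Det.pop, h.work r ▸ h.update_work r _⟩

theorem Parts.det_copy {a ρ W σ : Store} (h : Parts a ρ W σ) {s d T : ℕ} (h0 : W 0 = [])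
    (hd : W d = []) (hs0 : s ≠ 0) (hd0 : d ≠ 0) (hsd : s ≠ d) (hT : 18 * (W s).length + 3 ≤ T) :
    ∃ τ, Det (copy (workReg s) (workReg 0) (workReg d)) σ T τ ∧
      Parts a ρ (Function.update W d (W s)) τ :=
  ⟨_, PrivateRouting.det_copy (workReg_injective.ne hs0) (workReg_injective.ne hsd)
    (workReg_injective.ne hd0.symm) (by rw [h.work, h0]) (by rw [h.work, hd])
    (by rwa [h.work]), h.work s ▸ h.update_work d _⟩

/-- Push the codes of the label transfers, two for each symbol of the work register `24`. -/
def pushLabelItems : Cmd :=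
  Cmd.loop (workReg 24) <| Cmd.seq (Cmd.pop (workReg 24)) <|
    pushWord (workReg 23) (itemsCode [some Session.otLabel, some Session.otLabel])

theorem det_pushLabelItems (j : ℕ) {a ρ W σ : Store} (h : Parts a ρ W σ) (h24 : W 24 = ones j) :
    ∃ τ, Det pushLabelItems σ (j * 12 + 1) τ ∧ Parts a ρ (Function.update (Function.update W 24 [])
      23 (itemsCode (List.replicate (2 * j) (some Session.otLabel)) ++ W 23)) τ := by
  induction j generalizing W σ with
  | zero =>
    refine ⟨σ, Det.loop_nil (by rw [h.work, h24]; rfl) le_rfl, ?_⟩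
    convert h using 1
    funext r
    by_cases h3 : r = 23
    · subst h3; simp [itemsCode]
    by_cases h4 : r = 24
    · subst h4; simp [h24, ones]
    simp [h3, h4]
  | succ j ih =>
    obtain ⟨τ₁, d₁, p₁⟩ := h.det_pop 24
    obtain ⟨τ₂, d₂, p₂⟩ := p₁.det_pushWord 23
      (itemsCode [some Session.otLabel, some Session.otLabel])
    obtain ⟨τ₃, d₃, p₃⟩ := ih p₂ (by simp [h24, ones, List.replicate_succ])
    refine ⟨τ₃, Det.loop_cons (by rw [h.work, h24]; simp [ones]) (d₁.seq d₂ le_rfl) d₃ ?_, ?_⟩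
    · simp [itemsCode, Item.code]; omega
    · convert p₃ using 1
      funext r
      by_cases h3 : r = 23
      · subst h3
        have : List.replicate (2 * (j + 1)) (some Session.otLabel) =
            List.replicate (2 * j) (some Session.otLabel) ++
              [some Session.otLabel, some Session.otLabel] := by
          rw [show 2 * (j + 1) = 2 * j + 2 by ring, List.replicate_add]; rfl
        rw [this, itemsCode_append]
        simp
      by_cases h4 : r = 24
      · subst h4; simp
      simp [h3, h4]

/-- Push the codes of the items of the rounds, whose number is in the work register `8`. -/
def pushRoundsItems : Cmd :=
  Cmd.loop (workReg 8) <| Cmd.seq (Cmd.pop (workReg 8)) <|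
    Cmd.seq (pushWord (workReg 23) (itemsCode [none])) <|
    Cmd.seq (copy (workReg 16) (workReg 0) (workReg 24)) <| Cmd.seq pushLabelItems <|
      pushWord (workReg 23) (itemsCode [some Session.pirSrc, some Session.pirDst])

/-- The schedule register is a stack and is filled from the back: the activation that ends a round
is pushed before its sessions. -/
theorem det_pushRoundsItems {pp : PublicParams} (j : ℕ) {a ρ W σ : Store} (h : Parts a ρ W σ)
    (h0 : W 0 = []) (h8 : W 8 = ones j) (h16 : W 16 = ones pp.fieldBits) (h24 : W 24 = []) :
    ∃ τ, Det pushRoundsItems σ (j * (30 * pp.fieldBits + 40) + 1) τ ∧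
      Parts a ρ (Function.update (Function.update W 8 [])
        23 (itemsCode (roundsItems pp j) ++ W 23)) τ := by
  induction j generalizing W σ with
  | zero =>
    refine ⟨σ, Det.loop_nil (by rw [h.work, h8]; rfl) (by omega), ?_⟩
    convert h using 1
    funext r
    by_cases h3 : r = 23
    · subst h3; simp [itemsCode, roundsItems]
    by_cases h4 : r = 8
    · subst h4; simp [h8, ones]
    simp [h3, h4]
  | succ j ih =>
    obtain ⟨τ₁, d₁, p₁⟩ := h.det_pop 8
    obtain ⟨τ₂, d₂, p₂⟩ := p₁.det_pushWord 23 (itemsCode [none])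
    obtain ⟨τ₃, d₃, p₃⟩ := p₂.det_copy (s := 16) (d := 24) (by simpa using h0) (by simpa using h24)
      (by norm_num) (by norm_num) (by norm_num) le_rfl
    obtain ⟨τ₄, d₄, p₄⟩ := det_pushLabelItems pp.fieldBits p₃ (by simp [h16])
    obtain ⟨τ₅, d₅, p₅⟩ := p₄.det_pushWord 23 (itemsCode [some Session.pirSrc, some Session.pirDst])
    obtain ⟨τ₆, d₆, p₆⟩ := ih p₅ (by simpa using h0)
      (by simp [h8, ones, List.replicate_succ]) (by simpa using h16) (by simp)
    refine ⟨τ₆, Det.loop_cons (by rw [h.work, h8]; simp [ones]) (d₁.seq (d₂.seq (d₃.seq (d₄.seq d₅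
      le_rfl) le_rfl) le_rfl) le_rfl) d₆ ?_, ?_⟩
    · simp [itemsCode, Item.code, h16, ones]; nlinarith
    -- The loop puts the other `j` rounds in front of this one, the definition puts them behind it.
    -- All rounds are equal, so the lists agree.
    · have hr : roundsItems pp (j + 1) = roundsItems pp j ++ roundItems pp := by
        clear * -
        induction j with
        | zero => simp [roundsItems]
        | succ j ih =>
          change roundItems pp ++ roundsItems pp (j + 1) =
            (roundItems pp ++ roundsItems pp j) ++ roundItems pp
          rw [ih, List.append_assoc]
      have hr' : roundItems pp = [some Session.pirSrc, some Session.pirDst] ++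
        (List.replicate (2 * pp.fieldBits) (some Session.otLabel) ++ [none]) := rfl
      convert p₆ using 1
      funext r
      by_cases h3 : r = 23
      · subst h3
        rw [hr, hr', itemsCode_append, itemsCode_append, itemsCode_append]
        simp
      by_cases h4 : r = 8
      · subst h4; simp
      by_cases h5 : r = 24
      · subst h5; simp [h24]
      simp [h3, h4, h5]

/-- Write the whole schedule. -/
def scheduleCmd : Cmd :=
  Cmd.seq (pushWord (workReg 23) (itemsCode [none])) <| Cmd.seq pushRoundsItems <|
    pushWord (workReg 23) (itemsCode [some Session.otKey, some Session.otKey])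

theorem det_scheduleCmd {pp : PublicParams} {a ρ W σ : Store} (h : Parts a ρ W σ)
    (h0 : W 0 = []) (h8 : W 8 = ones pp.R) (h16 : W 16 = ones pp.fieldBits) (h23 : W 23 = [])
    (h24 : W 24 = []) :
    ∃ τ, Det scheduleCmd σ (pp.R * (30 * pp.fieldBits + 40) + 30) τ ∧
      Parts a ρ (Function.update (Function.update W 8 []) 23 (itemsCode (allItems pp))) τ := by
  obtain ⟨τ₁, d₁, p₁⟩ := h.det_pushWord 23 (itemsCode [none])
  obtain ⟨τ₂, d₂, p₂⟩ := det_pushRoundsItems (pp := pp) pp.R p₁ (by simpa using h0)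
    (by simpa using h8) (by simpa using h16) (by simpa using h24)
  obtain ⟨τ₃, d₃, p₃⟩ := p₂.det_pushWord 23 (itemsCode [some Session.otKey, some Session.otKey])
  refine ⟨τ₃, d₁.seq (d₂.seq d₃ le_rfl) ?_, ?_⟩
  · simp [itemsCode, Item.code]; omega
  · have hr : allItems pp = [some Session.otKey, some Session.otKey] ++
      (roundsItems pp pp.R ++ [none]) := rfl
    convert p₃ using 1
    funext r
    by_cases h3 : r = 23
    · subst h3
      rw [hr, itemsCode_append, itemsCode_append]
      simp [h23]
    by_cases h4 : r = 8
    · subst h4; simp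
    simp [h3, h4]

/-- Move the contents of the given registers to the adversary's and to the work registers. -/
def distribute : List ℕ → Cmd
  | [] => Cmd.skip
  | j :: js => Cmd.seq (Cmd.seq (pour j [workReg 0]) (pour (workReg 0) [advReg j, workReg j]))
      (distribute js)

/-- Each parameter is needed twice: as the adversary's input, which it may destroy, and for setting
up the sessions. The input registers are disjoint from both targets, so moving one leaves the others
intact. -/
theorem det_distribute {js : List ℕ} (hjs : js.Nodup) (hj : ∀ j ∈ js, 2 ≤ j ∧ j < 24) {S : ℕ}
    {a ρ W σ : Store} (h : Parts a ρ W σ) (h0 : W 0 = []) (ha : ∀ j ∈ js, a j = [])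
    (hW : ∀ j ∈ js, W j = []) (hS : ∀ j ∈ js, (σ j).length ≤ S) :
    ∃ τ, Det (distribute js) σ (js.length * (18 * S + 4) + 1) τ ∧
      Parts (fun r => if r ∈ js then σ r else a r) ρ (fun r => if r ∈ js then σ r else W r) τ := by
  induction js generalizing a W σ with
  | nil => exact ⟨σ, Det.skip.mono (by omega), by simpa using h⟩
  | cons j js ih =>
    rw [List.nodup_cons] at hjs
    obtain ⟨hj2, hj24⟩ := hj j (by simp)
    have far : ∀ i, i < 24 → 2 ≤ i → (∀ r, advReg r ≠ i) ∧ (∀ r, workReg r ≠ i) ∧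
        ∀ r, recvReg r ≠ i := fun i hi hi2 =>
      ⟨fun r => by rw [advReg]; split_ifs <;> omega, fun r => by rw [workReg]; omega,
        fun r => by rw [recvReg]; omega⟩
    obtain ⟨fa, fw, fr⟩ := far j hj24 hj2
    have d₁ := det_pour (s := j) (ds := [workReg 0]) (by simpa using (fw 0).symm) (by simp) σ
    have d₂ := det_pour (s := workReg 0) (ds := [advReg j, workReg j])
      (by simp [(advReg_ne_workReg j 0).symm, workReg_injective.ne_iff]; omega)
      (by simp [advReg_ne_workReg])
    have d := d₁.seq (d₂ _) le_rfl
    have ea : σ (advReg j) = [] := by rw [h.adv, ha j (by simp)]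
    have ew : σ (workReg j) = [] := by rw [h.work, hW j (by simp)]
    have e0 : σ (workReg 0) = [] := by rw [h.work, h0]
    have wj0 : workReg j ≠ workReg 0 := workReg_injective.ne (by omega)
    have d' := (d.congr (τ' := Function.update (Function.update (Function.update σ j [])
      (advReg j) (σ j)) (workReg j) (σ j)) (by
        funext r
        by_cases r1 : r = workReg j
        · subst r1
          simp [fw, e0, ew, wj0]
        by_cases r2 : r = advReg j
        · subst r2
          simp [fa, fw 0, e0, ea, advReg_ne_workReg]
        by_cases r3 : r = workReg 0
        · subst r3
          simp [fw 0, e0, wj0.symm, (advReg_ne_workReg j 0).symm]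
        by_cases r4 : r = j
        · subst r4; simp [(fw 0).symm, (fw r).symm, (fa r).symm]
        simp [r1, r2, r3, r4]))
    have p : Parts (Function.update a j (σ j)) ρ (Function.update W j (σ j))
        (Function.update (Function.update (Function.update σ j []) (advReg j) (σ j))
          (workReg j) (σ j)) := by
      refine Parts.update_work (Parts.update_adv ?_ j _) j _
      obtain ⟨rfl, rfl, rfl⟩ := h
      refine ⟨?_, ?_, ?_⟩ <;> funext r
      · exact Function.update_of_ne (fa r) _ _
      · exact Function.update_of_ne (fr r) _ _
      · exact Function.update_of_ne (fw r) _ _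
    have hσ : ∀ i ∈ js, Function.update (Function.update (Function.update σ j []) (advReg j) (σ j))
        (workReg j) (σ j) i = σ i := fun i hi => by
      obtain ⟨hi2, hi24⟩ := hj i (by simp [hi])
      obtain ⟨ga, gw, -⟩ := far i hi24 hi2
      rw [Function.update_of_ne (gw j).symm, Function.update_of_ne (ga j).symm,
        Function.update_of_ne]
      rintro rfl
      exact hjs.1 hi
    have hne : ∀ i ∈ js, i ≠ j := fun i hi => by rintro rfl; exact hjs.1 hi
    obtain ⟨τ, d₃, p₃⟩ := ih hjs.2 (fun i hi => hj i (by simp [hi])) p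
      (by rw [Function.update_of_ne (by omega), h0])
      (fun i hi => by rw [Function.update_of_ne (hne i hi), ha i (by simp [hi])])
      (fun i hi => by rw [Function.update_of_ne (hne i hi), hW i (by simp [hi])])
      (fun i hi => by rw [hσ i hi]; exact hS i (by simp [hi]))
    refine ⟨τ, d'.seq d₃ ?_, ?_⟩
    · have := hS j (by simp)
      simp [(fw 0), e0]
      nlinarith
    · convert p₃ using 1
      · funext r
        by_cases hr : r ∈ js
        · simp [hr, hσ r hr]
        · by_cases hr' : r = j
          · subst hr'; simp [hr]
          · simp [hr, hr']
      · funext r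
        by_cases hr : r ∈ js
        · simp [hr, hσ r hr]
        · by_cases hr' : r = j
          · subst hr'; simp [hr]
          · simp [hr, hr']

/-- The simulator runs the adversary against honest receivers with index `0`. -/
def simulatorCmd (pir ot : RetrievalProtocol) (A : Cmd) : Cmd :=
  Cmd.seq (distribute ((List.range 20).map (· + 2))) <|
    Cmd.seq (pushWord (workReg 22) (ones 2)) <| Cmd.seq scheduleCmd <| restCmd pir ot A

/-- The work registers of the simulator. -/
def workStore (pir ot : RetrievalProtocol) (k : ℕ) (pp : PublicParams) (x : ServerInput pp) :
    Store := Function.update (corruptStore pir ot k pp x) 22 (ones 2)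

theorem workParams_workStore (pir ot : RetrievalProtocol) (k : ℕ) (pp : PublicParams)
    (x : ServerInput pp) : WorkParams pir ot k pp (workStore pir ot k pp x) where
  tmp := rfl
  counter := rfl
  sec := rfl
  count s := by cases s <;> rfl
  len s := by cases s <;> rfl
  rounds s := by cases s <;> rfl

/-- A bound on the running time of the simulator. -/
def simulatorTime (pir ot : RetrievalProtocol) (pp : PublicParams) (B S : ℕ) : ℕ :=
  20 * (18 * S + 4) + pp.R * (30 * pp.fieldBits + 40) +
    (pp.R * (2 * pp.fieldBits + 3) + 3) * itemTime pir ot B + 50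

/-- The simulation of the index-0 execution is perfect; all loss in the theorem comes from replacing
indices. -/
theorem impl_simulatorCmd {pir ot : RetrievalProtocol} {A : Cmd} {k : ℕ} {pp : PublicParams}
    {x : ServerInput pp} {B S : ℕ} (hB : Bounds pir ot A k pp (corruptStore pir ot k pp x) B)
    (hS : ∀ r, (corruptStore pir ot k pp x r).length ≤ S) :
    Impl (simulatorCmd pir ot A) (corruptStore pir ot k pp x) (simulatorTime pir ot pp B S)
      (restSem pir ot A k pp (allItems pp) (corruptStore pir ot k pp x))
      fun σ' mem' => σ' 1 = mem' 1 := by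
  have far : ∀ r, 22 ≤ r → corruptStore pir ot k pp x r = [] := fun r hr => by
    obtain ⟨r, rfl⟩ := Nat.exists_eq_add_of_le' hr
    rfl
  have h : Parts (fun _ => []) (fun _ => []) (fun _ => []) (corruptStore pir ot k pp x) := by
    refine ⟨?_, ?_, ?_⟩ <;> funext r <;> rw [Function.comp_apply]
    · rw [advReg]
      split_ifs
      · rfl
      · exact far _ (by omega)
    · exact far _ (by rw [recvReg]; omega)
    · exact far _ (by rw [workReg]; omega)
  obtain ⟨τ₁, d₁, p₁⟩ := det_distribute (js := (List.range 20).map (· + 2)) (S := S) (by decide)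
    (by decide) h rfl (fun _ _ => rfl) (fun _ _ => rfl) (fun j _ => hS j)
  have e : (fun r => if r ∈ (List.range 20).map (· + 2) then corruptStore pir ot k pp x r
      else []) = corruptStore pir ot k pp x := by
    funext r
    split_ifs with hr
    · rfl
    · by_cases hr' : 22 ≤ r
      · rw [far r hr']
      · have : r = 0 ∨ r = 1 := by
          simp only [List.mem_map, List.mem_range, not_exists, not_and] at hr
          by_contra hc
          exact hr (r - 2) (by omega) (by omega)
        rcases this with rfl | rfl <;> rfl
  rw [e] at p₁
  obtain ⟨τ₂, d₂, p₂⟩ := p₁.det_pushWord 22 (ones 2)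
  obtain ⟨τ₃, d₃, p₃⟩ := det_scheduleCmd (pp := pp) p₂ rfl rfl rfl rfl rfl
  have hrest := impl_restCmd hB (allItems pp) (W := Function.update (Function.update
    (workStore pir ot k pp x) 8 []) 23 (itemsCode (allItems pp)))
    (((workParams_workStore pir ot k pp x).update (r := 8) (by norm_num) _).update
      (r := 23) (by norm_num) _) (Function.update_self _ _ _) (Idle.init A _)
    ⟨_, p₃, fun _ _ => rfl, by simp [corruptStore], by simp [corruptStore]⟩
  refine (Impl.det_seq d₁ (Impl.det_seq d₂ (Impl.det_seq d₃ hrest le_rfl) le_rfl) le_rfl).mono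
    ?_ ?_
  · rw [simulatorTime, length_allItems]
    simp [ones]
    omega
  · rintro σ' - mem' ⟨-, a, ha, haσ, -⟩
    rw [← haσ 1 (by norm_num), ← ha.adv 1]
    rfl

end PrivateRouting

/-! ### The reduction: a malicious server that attacks one session and evaluates the environment's
circuit. -/

namespace PrivateRouting

/-! ## Evaluating circuits -/

theorem Parts.det_push {a ρ W σ : Store} (h : Parts a ρ W σ) (b : Bool) (r : ℕ) :
    ∃ τ, Det (Cmd.push b (workReg r)) σ 1 τ ∧ Parts a ρ (Function.update W r (b :: W r)) τ :=
  ⟨_, Det.push, h.work r ▸ h.update_work r _⟩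

theorem Parts.det_clear {a ρ W σ : Store} (h : Parts a ρ W σ) {r T : ℕ}
    (hT : 6 * (W r).length + 1 ≤ T) :
    ∃ τ, Det (clear (workReg r)) σ T τ ∧ Parts a ρ (Function.update W r []) τ :=
  ⟨_, PrivateRouting.det_clear _ _ (by rw [h.work]; omega), h.update_work r _⟩

theorem window_succ (N : ℕ) (w : Str) :
    window (N + 1) w = (w[0]?).isSome :: (w[0]?).getD false :: window N w.tail := by
  simp [window, List.range_succ_eq_map, List.flatMap_map]

/-- Push the window of the register `1` on the work register `24`; its length is in `25`. -/
def windowCmd : Cmd :=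
  Cmd.loop (workReg 25) <| Cmd.seq (Cmd.pop (workReg 25)) <| Cmd.branch (advReg 1)
    (Cmd.seq (Cmd.push false (workReg 24)) (Cmd.push false (workReg 24)))
    (Cmd.seq (Cmd.pop (advReg 1))
      (Cmd.seq (Cmd.push true (workReg 24)) (Cmd.push false (workReg 24))))
    (Cmd.seq (Cmd.pop (advReg 1))
      (Cmd.seq (Cmd.push true (workReg 24)) (Cmd.push true (workReg 24))))

theorem det_windowCmd (N : ℕ) {a ρ W σ : Store} (h : Parts a ρ W σ) (hN : W 25 = ones N) :
    ∃ τ, Det windowCmd σ (N * 9 + 1) τ ∧ Parts (Function.update a 1 ((a 1).drop N)) ρ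
      (Function.update (Function.update W 25 []) 24 ((window N (a 1)).reverse ++ W 24)) τ := by
  induction N generalizing a W σ with
  | zero =>
    refine ⟨σ, Det.loop_nil (by rw [h.work, hN]; rfl) le_rfl, ?_⟩
    convert h using 1
    · simp
    · funext r
      by_cases h3 : r = 24
      · subst h3; simp [window]
      by_cases h4 : r = 25
      · subst h4; simp [hN, ones]
      simp [h3, h4]
  | succ N ih =>
    obtain ⟨τ₁, d₁, p₁⟩ := h.det_pop 25
    have key : ∃ τ, Det (Cmd.branch (advReg 1)
          (Cmd.seq (Cmd.push false (workReg 24)) (Cmd.push false (workReg 24)))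
          (Cmd.seq (Cmd.pop (advReg 1))
            (Cmd.seq (Cmd.push true (workReg 24)) (Cmd.push false (workReg 24))))
          (Cmd.seq (Cmd.pop (advReg 1))
            (Cmd.seq (Cmd.push true (workReg 24)) (Cmd.push true (workReg 24))))) τ₁ 6 τ ∧
        Parts (Function.update a 1 (a 1).tail) ρ (Function.update (Function.update W 25 (W 25).tail)
          24 ((a 1)[0]?.getD false :: (a 1)[0]?.isSome :: W 24)) τ := by
      have some_case : ∀ (b : Bool) (l : Str), a 1 = b :: l → ∃ τ, Det (Cmd.seq (Cmd.pop (advReg 1))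
          (Cmd.seq (Cmd.push true (workReg 24)) (Cmd.push b (workReg 24)))) τ₁ 5 τ ∧
          Parts (Function.update a 1 (a 1).tail) ρ (Function.update
            (Function.update W 25 (W 25).tail) 24
            ((a 1)[0]?.getD false :: (a 1)[0]?.isSome :: W 24)) τ := by
        intro b l hl
        have p₂ := p₁.update_adv 1 (τ₁ (advReg 1)).tail
        obtain ⟨τ₃, d₃, p₃⟩ := p₂.det_push true 24
        obtain ⟨τ₄, d₄, p₄⟩ := p₃.det_push b 24
        refine ⟨τ₄, Det.pop.seq (d₃.seq d₄ le_rfl) le_rfl, ?_⟩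
        rw [p₁.adv] at p₄
        simpa [hl] using p₄
      rcases hl : a 1 with _ | ⟨_ | _, l⟩
      · obtain ⟨τ₃, d₃, p₃⟩ := p₁.det_push false 24
        obtain ⟨τ₄, d₄, p₄⟩ := p₃.det_push false 24
        refine ⟨τ₄, Det.branch_nil (by rw [p₁.adv, hl]) (d₃.seq d₄ le_rfl) (by omega), ?_⟩
        have : Function.update a 1 [] = a := by rw [← hl, Function.update_eq_self]
        simpa [this] using p₄
      · obtain ⟨τ, d, p⟩ := some_case false l hl
        exact ⟨τ, Det.branch_false (by rw [p₁.adv, hl]) d le_rfl, hl ▸ p⟩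
      · obtain ⟨τ, d, p⟩ := some_case true l hl
        exact ⟨τ, Det.branch_true (by rw [p₁.adv, hl]) d le_rfl, hl ▸ p⟩
    obtain ⟨τ₂, d₂, p₂⟩ := key
    obtain ⟨τ₃, d₃, p₃⟩ := ih p₂ (by simp [hN, ones, List.replicate_succ])
    refine ⟨τ₃, Det.loop_cons (by rw [h.work, hN]; simp [ones]) (d₁.seq d₂ le_rfl) d₃ (by omega), ?_⟩
    convert p₃ using 1
    · simp
    · funext r
      by_cases h3 : r = 24
      · subst h3; simp [window_succ]
      by_cases h4 : r = 25
      · subst h4; simp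
      simp [h3, h4]

/-- Evaluate a circuit given as a stream: `ws` are the wires, `xs` is what remains of them after
skipping some, and `s` holds the first input of the current gate as soon as it is known. -/
def evalStream : Str → Str → Str → Str → Str
  | [], ws, _, _ => ws
  | true :: l, ws, xs, s => evalStream l ws xs.tail s
  | false :: l, ws, xs, [] => evalStream l ws ws [xs.headD false]
  | false :: l, ws, xs, u :: _ =>
      evalStream l ((!(u && xs.headD false)) :: ws) ((!(u && xs.headD false)) :: ws) []

/-- The stream of a circuit in which indices are capped at `N`. -/
def circuitCode (N : ℕ) (C : Circuit) : Str :=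
  C.flatMap fun g => ones (min g.1 N) ++ false :: (ones (min g.2 N) ++ [false])

theorem evalStream_ones (n : ℕ) (l ws xs s : Str) :
    evalStream (ones n ++ l) ws xs s = evalStream l ws (xs.drop n) s := by
  induction n generalizing xs with
  | zero => simp [ones]
  | succ n ih =>
    rw [ones, List.replicate_succ, List.cons_append, evalStream]
    exact (ih _).trans (by simp)

/-- Absent wires carry `false`, so an index beyond all wires can be capped. `Environment.size`
counts gates and not the magnitude of their indices; the cap is what keeps the unary code of a
circuit polynomially long. -/
theorem headD_drop_min (N n : ℕ) (ws : Str) (h : ws.length ≤ N) :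
    (ws.drop (min n N)).headD false = ws.getD n false := by
  rcases le_total n N with hn | hn
  · rw [min_eq_left hn, List.headD_eq_head?_getD, List.head?_drop, List.getD_eq_getElem?_getD]
  · rw [min_eq_right hn, List.drop_eq_nil_of_le h, List.getD_eq_default _ _ (h.trans hn)]
    rfl

/-- Each gate consumed adds one wire, so the sum of wires and remaining gates is invariant and one
cap serves all gates. -/
theorem evalStream_circuitCode (N : ℕ) (C : Circuit) (ws : Str) (h : ws.length + C.length ≤ N) :
    evalStream (circuitCode N C) ws ws [] =
      C.foldl (fun ws g => (!(ws.getD g.1 false && ws.getD g.2 false)) :: ws) ws := by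
  induction C generalizing ws with
  | nil => rfl
  | cons g C ih =>
    simp only [List.length_cons] at h
    have hws : ws.length ≤ N := by omega
    rw [circuitCode, List.flatMap_cons, List.append_assoc, evalStream_ones, List.cons_append,
      evalStream, List.append_assoc, evalStream_ones, List.singleton_append, evalStream,
      headD_drop_min N _ ws hws, headD_drop_min N _ ws hws]
    exact ih _ (by simp; omega)

/-- Use the bit `v` as the next input of the current gate. -/
def gateCmd (v : Bool) : Cmd :=
  Cmd.branch (workReg 28) (Cmd.push v (workReg 28))
    (Cmd.seq (Cmd.pop (workReg 28)) (Cmd.push true (workReg 29)))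
    (Cmd.seq (Cmd.pop (workReg 28)) (Cmd.push (!v) (workReg 29)))

/-- Evaluate the stream in the work register `26` on the wires in `29`. -/
def streamCmd : Cmd :=
  Cmd.loop (workReg 26) <| dispatch (workReg 26)
    (Cmd.seq (Cmd.branch (workReg 27) (gateCmd false) (gateCmd false) (gateCmd true)) <|
      Cmd.seq (clear (workReg 27)) (copy (workReg 29) (workReg 0) (workReg 27)))
    (Cmd.pop (workReg 27))

theorem Det.dispatch {r : ℕ} {c₀ c₁ : Cmd} {σ τ : Store} {b : Bool} {l : Str}
    (hr : σ r = b :: l) {T U : ℕ}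
    (h : Det (bif b then c₁ else c₀) (Function.update σ r l) T τ) (hU : T + 3 ≤ U) :
    Det (PrivateRouting.dispatch r c₀ c₁) σ U τ := by
  have hpop : Det (Cmd.pop r) σ 1 (Function.update σ r l) := Det.pop.congr (by simp [hr])
  cases b
  · exact Det.branch_false hr (Det.seq hpop h le_rfl) (by omega)
  · exact Det.branch_true hr (Det.seq hpop h le_rfl) (by omega)

theorem det_gateCmd {a ρ W σ : Store} (h : Parts a ρ W σ) (v : Bool) (h28 : (W 28).length ≤ 1) :
    ∃ τ, Det (gateCmd v) σ 4 τ ∧ Parts a ρ (match W 28 with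
      | [] => Function.update W 28 [v]
      | u :: _ => Function.update (Function.update W 28 []) 29 ((!(u && v)) :: W 29)) τ := by
  rcases hl : W 28 with _ | ⟨u, l⟩
  · obtain ⟨τ, d, p⟩ := h.det_push v 28
    exact ⟨τ, Det.branch_nil (by rw [h.work, hl]) d (by omega), by simpa [hl] using p⟩
  · obtain rfl : l = [] := by
      rw [hl] at h28
      simpa using h28
    obtain ⟨τ₁, d₁, p₁⟩ := h.det_pop 28
    cases u
    · obtain ⟨τ₂, d₂, p₂⟩ := p₁.det_push true 29
      exact ⟨τ₂, Det.branch_false (by rw [h.work, hl]) (d₁.seq d₂ le_rfl) le_rfl,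
        by simpa [hl] using p₂⟩
    · obtain ⟨τ₂, d₂, p₂⟩ := p₁.det_push (!v) 29
      exact ⟨τ₂, Det.branch_true (by rw [h.work, hl]) (d₁.seq d₂ le_rfl) le_rfl,
        by simpa [hl] using p₂⟩

/-- A stream symbol creates at most one wire, so `Q` bounds the wires throughout. The cost per
symbol is mainly that of restoring the reading copy of the wires: `6 * Q` for clearing and `18 * Q`
for copying. -/
theorem det_streamCmd {Q : ℕ} (l : Str) {a ρ W σ : Store} (h : Parts a ρ W σ) (h0 : W 0 = [])
    (h26 : W 26 = l) (h27 : (W 27).length ≤ Q) (h28 : (W 28).length ≤ 1)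
    (h29 : (W 29).length + l.length ≤ Q) :
    ∃ τ W', Det streamCmd σ (l.length * (24 * Q + 16) + 1) τ ∧ Parts a ρ W' τ ∧
      W' 29 = evalStream l (W 29) (W 27) (W 28) ∧ W' 31 = W 31 := by
  induction l generalizing W σ with
  | nil => exact ⟨σ, W, Det.loop_nil (by rw [h.work, h26]) (by simp), h, rfl, rfl⟩
  | cons b l ih =>
    have hσ : σ (workReg 26) = b :: l := by rw [h.work, h26]
    have p₁ := h.update_work 26 l
    simp only [List.length_cons] at h29
    cases b
    · have key : ∃ τ W₂, Det (Cmd.branch (workReg 27) (gateCmd false) (gateCmd false)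
          (gateCmd true)) (Function.update σ (workReg 26) l) 5 τ ∧ Parts a ρ W₂ τ ∧ W₂ 0 = [] ∧
          W₂ 26 = l ∧ W₂ 27 = W 27 ∧ W₂ 31 = W 31 ∧ (W₂ 28).length ≤ 1 ∧
          (W₂ 29).length ≤ (W 29).length + 1 ∧
          evalStream (false :: l) (W 29) (W 27) (W 28) =
            evalStream l (W₂ 29) (W₂ 29) (W₂ 28) := by
        obtain ⟨τ, d, p⟩ := det_gateCmd p₁ ((W 27).headD false) (by simpa using h28)
        refine ⟨τ, _, ?_, p, ?_⟩
        · rcases hx : W 27 with _ | ⟨_ | _, _⟩ <;> rw [hx] at d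
          · exact Det.branch_nil (by rw [p₁.work]; simpa using hx) d le_rfl
          · exact Det.branch_false (by rw [p₁.work]; simpa using hx) d le_rfl
          · exact Det.branch_true (by rw [p₁.work]; simpa using hx) d le_rfl
        · have e28 : Function.update W 26 l 28 = W 28 := by simp
          rw [e28]
          rcases W 28 with _ | ⟨u, s⟩ <;> simp [h0, evalStream]
      obtain ⟨τ₂, W₂, d₂, p₂, g0, g26, g27, g31, g28, g29, ge⟩ := key
      obtain ⟨τ₃, d₃, p₃⟩ := p₂.det_clear (r := 27) (T := 6 * Q + 1) (by rw [g27]; omega)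
      obtain ⟨τ₄, d₄, p₄⟩ := p₃.det_copy (s := 29) (d := 27) (T := 18 * Q + 3) (by simpa using g0)
        (by simp) (by norm_num) (by norm_num) (by norm_num) (by simp; omega)
      obtain ⟨τ₅, W₅, d₅, p₅, e₅, f₅⟩ := ih p₄ (by simpa using g0) (by simpa using g26)
        (by simp; omega) (by simpa using g28) (by simp; omega)
      refine ⟨τ₅, W₅, Det.loop_cons (by simp [hσ])
        (Det.dispatch hσ (d₂.seq (d₃.seq d₄ le_rfl) le_rfl) le_rfl) d₅ ?_, p₅, ?_, ?_⟩
      · simp only [List.length_cons]; nlinarith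
      · rw [e₅, ge]; simp
      · rw [f₅, ← g31]; simp
    · obtain ⟨τ₂, d₂, p₂⟩ := p₁.det_pop 27
      obtain ⟨τ₅, W₅, d₅, p₅, e₅, f₅⟩ := ih p₂ (by simpa using h0) (by simp)
        (by simp; omega) (by simpa using h28) (by simp; omega)
      refine ⟨τ₅, W₅, Det.loop_cons (by simp [hσ]) (Det.dispatch hσ d₂ le_rfl) d₅ ?_, p₅, ?_, ?_⟩
      · simp only [List.length_cons]; nlinarith
      · rw [e₅]; simp [evalStream]
      · rw [f₅]; simp

/-- Replace the register `1` by the negation of what the environment makes of it. -/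
def decideCmd : Cmd :=
  Cmd.seq windowCmd <| Cmd.seq (pour (workReg 24) [workReg 29]) <|
    Cmd.seq (copy (workReg 29) (workReg 0) (workReg 27)) <| Cmd.seq streamCmd <|
    Cmd.seq (clear (advReg 1)) <|
    Cmd.branch (workReg 29) (Cmd.push true (advReg 1)) (Cmd.push true (advReg 1))
      (Cmd.push false (advReg 1))

def decideTime (N c S : ℕ) : ℕ :=
  9 * N + 52 * N + 6 * S + c * (24 * (2 * N + c) + 16) + 20

/-- The bit is negated because the advantage is measured on the answer `false`, while a
distinguisher accepts by writing `true`. -/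
theorem det_decideCmd {pp : PublicParams} (E : Environment pp) {N : ℕ} {a ρ W σ : Store}
    (h : Parts a ρ W σ) (h0 : W 0 = []) (h24 : W 24 = []) (h25 : W 25 = ones E.readLen)
    (h26 : W 26 = circuitCode N E.circuit) (hN : 2 * E.readLen + E.circuit.length ≤ N)
    (h27 : W 27 = []) (h28 : W 28 = []) (h29 : W 29 = []) :
    ∃ τ, Det decideCmd σ
        (decideTime E.readLen (circuitCode N E.circuit).length (a 1).length) τ ∧
      τ 1 = [!E.decide (a 1)] ∧ τ (workReg 31) = W 31 := by
  obtain ⟨τ₁, d₁, p₁⟩ := det_windowCmd E.readLen h h25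
  have hwin : ∀ (n : ℕ) (w : Str), (window n w).length = 2 * n := fun n w => by
    simp [window]; ring
  -- The window was pushed symbol by symbol and lies reversed; pouring it restores its order.
  have p₂ : ∃ τ, Det (pour (workReg 24) [workReg 29]) τ₁ (16 * E.readLen + 1) τ ∧
      Parts (Function.update a 1 ((a 1).drop E.readLen)) ρ
        (Function.update (Function.update W 25 []) 29 (window E.readLen (a 1))) τ := by
    refine ⟨_, ((det_pour (by simp [workReg_injective.eq_iff]) (by simp) _).mono ?_).congr
      (τ' := Function.update (Function.update τ₁ (workReg 24) []) (workReg 29)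
        (window E.readLen (a 1))) ?_, ?_⟩
    · rw [p₁.work]
      simp [h24, hwin]
      omega
    · funext r
      by_cases r1 : r = workReg 29
      · subst r1
        simp [workReg_injective.eq_iff, p₁.work, h24, h29]
      by_cases r2 : r = workReg 24
      · subst r2
        simp [workReg_injective.eq_iff]
      simp [r1, r2]
    · convert (p₁.update_work 24 []).update_work 29 (window E.readLen (a 1)) using 1
      funext r
      by_cases h3 : r = 24
      · subst h3; simp [h24]
      simp [Function.update_apply, h3]
  obtain ⟨τ₂, d₂, p₂⟩ := p₂
  obtain ⟨τ₃, d₃, p₃⟩ := p₂.det_copy (s := 29) (d := 27) (T := 36 * E.readLen + 3)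
    (by simpa using h0) (by simpa using h27) (by norm_num) (by norm_num) (by norm_num)
    (by simp [hwin]; omega)
  obtain ⟨τ₄, W₄, d₄, p₄, e₄, f₄⟩ := det_streamCmd
    (Q := 2 * E.readLen + (circuitCode N E.circuit).length) (circuitCode N E.circuit) p₃
    (by simpa using h0) (by simpa using h26) (by simp [hwin]) (by simp [h28]) (by simp [hwin])
  have e₅ : E.decide (a 1) = (W₄ 29).headD false := by
    rw [e₄, Environment.decide, Circuit.eval]
    simp only [Function.update_self, ne_eq, Nat.reduceEqDiff, not_false_eq_true,
      Function.update_of_ne, h28]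
    rw [evalStream_circuitCode N _ _ (by rw [hwin]; exact hN)]
  have f₅ : W₄ 31 = W 31 := by simpa using f₄
  have p₅ := p₄.update_adv 1 []
  have hb : Det (Cmd.branch (workReg 29) (Cmd.push true (advReg 1)) (Cmd.push true (advReg 1))
      (Cmd.push false (advReg 1))) (Function.update τ₄ (advReg 1) []) 2
      (Function.update τ₄ (advReg 1) [!E.decide (a 1)]) := by
    have hpush : ∀ b, Det (Cmd.push b (advReg 1)) (Function.update τ₄ (advReg 1) []) 1
        (Function.update τ₄ (advReg 1) [b]) := fun b => Det.push.congr (by simp)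
    have hw : Function.update τ₄ (advReg 1) [] (workReg 29) = W₄ 29 := p₅.work 29
    rw [e₅]
    rcases hx : W₄ 29 with _ | ⟨_ | _, _⟩ <;> rw [hx] at hw
    · exact Det.branch_nil hw (hpush _) le_rfl
    · exact Det.branch_false hw (hpush _) le_rfl
    · exact Det.branch_true hw (hpush _) le_rfl
  refine ⟨_, d₁.seq (d₂.seq (d₃.seq (d₄.seq ((det_clear _ _
    (T := 6 * (a 1).length + 1) ?_).seq hb le_rfl) le_rfl) le_rfl) le_rfl) ?_, ?_, ?_⟩
  · rw [p₄.adv]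
    simp
    omega
  · rw [decideTime]; omega
  · exact Function.update_self (advReg 1) _ _
  · rw [Function.update_of_ne (advReg_ne_workReg _ _).symm, p₄.work, f₅]

end PrivateRouting

namespace PrivateRouting

/-! ## A malicious server against a single session -/

/-- The registers in which the adversary is run by a malicious server, which leaves messages in
their place. -/
def outerReg (r : ℕ) : ℕ := if r = 0 then 0 else advReg r

theorem advReg_pos (r : ℕ) : 0 < advReg r := by
  rw [advReg]; split_ifs <;> omega

theorem outerReg_injective : outerReg.Injective := by
  intro a b h
  have ha := advReg_pos a
  have hb := advReg_pos b
  simp only [outerReg] at h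
  split_ifs at h with h₁ h₂ h₂
  · omega
  · omega
  · omega
  · exact advReg_injective h

/-- The store consists of the adversary's store in the outer registers and the work registers. -/
structure OuterParts (a W mem : Store) : Prop where
  outer : mem ∘ outerReg = a
  recv : mem ∘ recvReg = fun _ => []
  work : mem ∘ workReg = W
  adv : mem (advReg 0) = []

theorem OuterParts.impl {c : Cmd} {a W mem : Store} {T : ℕ} (h : OuterParts a W mem)
    (hc : HaltsIn c a T) :
    Impl (c.rename outerReg) mem T (exec c a) fun a' mem' => OuterParts a' W mem' := by
  obtain ⟨rfl, h₂, h₃, h₄⟩ := h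
  have key : ∀ r s, outerReg r ≠ recvReg s ∧ outerReg r ≠ workReg s ∧ outerReg r ≠ advReg 0 := by
    intro r s
    rw [outerReg]
    split_ifs with hr
    · refine ⟨?_, ?_, (advReg_pos 0).ne⟩
      · rw [recvReg]; omega
      · rw [workReg]; omega
    · exact ⟨advReg_ne_recvReg _ _, advReg_ne_workReg _ _, advReg_injective.ne hr⟩
  refine (Impl.rename outerReg_injective hc).mono le_rfl ?_
  rintro a' - mem' ⟨g₁, g₂⟩
  refine ⟨g₁, ?_, ?_, ?_⟩
  · rw [← h₂]; funext r; exact g₂ _ fun ⟨s, hs⟩ => (key s r).1 hs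
  · rw [← h₃]; funext r; exact g₂ _ fun ⟨s, hs⟩ => (key s r).2.1 hs
  · rw [← h₄]; exact g₂ _ fun ⟨s, hs⟩ => (key s 0).2.2 hs

theorem OuterParts.deliver {a W mem : Store} (h : OuterParts a W mem) (msg : Str) :
    OuterParts (deliver a msg) W (deliver mem msg) := by
  obtain ⟨rfl, h₂, h₃, h₄⟩ := h
  refine ⟨?_, ?_, ?_, ?_⟩
  · funext r
    rw [Function.comp_apply]
    by_cases h0 : r = 0
    · subst h0; rw [deliver_zero]; exact deliver_zero _ _
    by_cases h1 : r = 1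
    · subst h1; rw [deliver_one]; exact deliver_one _ _
    have : outerReg r = 3 * r + 24 := by simp [outerReg, advReg, h0, h1]
    rw [deliver_of_ne h0 h1, deliver_of_ne (by omega) (by omega)]
    rfl
  · rw [← h₂]
    funext r
    exact deliver_of_ne (by rw [recvReg]; omega) (by rw [recvReg]; omega)
  · rw [← h₃]
    funext r
    exact deliver_of_ne (by rw [workReg]; omega) (by rw [workReg]; omega)
  · rw [← h₄]
    exact deliver_of_ne (by simp [advReg]) (by simp [advReg])

/-- The change of layout when the attacked session ends: only the place of the adversary's register
0 differs between `outerReg` and `advReg`, and `Resting` ignores the contents of that register. -/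
theorem OuterParts.resting {B : ℕ} {a W mem : Store} (h : OuterParts a W mem)
    (ha : (a 1).length ≤ 2 * B) : Resting B a W mem := by
  refine ⟨mem ∘ advReg, ⟨rfl, h.recv, h.work⟩, ?_, ?_, ?_⟩
  · intro r hr
    rw [← h.outer, Function.comp_apply, Function.comp_apply, outerReg, if_neg hr]
  · rw [Function.comp_apply, h.adv]; simp
  · rw [← h.outer] at ha
    exact ha

/-- The malicious server: run the adversary; when the rounds that are counted in the work register
`30` are over, run the rest of the schedule, evaluate the environment's circuit, and stop. -/
def attackCmd (pir ot : RetrievalProtocol) (A : Cmd) : Cmd :=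
  let active := Cmd.seq (A.rename outerReg) <| Cmd.branch (workReg 30)
    (Cmd.seq (Cmd.pop (workReg 31)) (Cmd.seq (restCmd pir ot A) decideCmd))
    (Cmd.pop (workReg 30)) (Cmd.pop (workReg 30))
  Cmd.branch (workReg 31) Cmd.skip active active

section Attack

variable {pir ot : RetrievalProtocol} {A : Cmd} {k : ℕ} {pp : PublicParams}

/-- The bound at which the indices of a circuit of the environment can be capped. -/
def capBound (E : Environment pp) : ℕ := 2 * E.readLen + E.circuit.length

/-- The work registers of the malicious server when `j` rounds are left. -/
def attackWork (pir ot : RetrievalProtocol) (k : ℕ) (E : Environment pp) (items : List Item)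
    (j : ℕ) : Store :=
  Function.update (Function.update (Function.update (Function.update (Function.update
    (workStore pir ot k pp E.x) 23 (itemsCode items)) 25 (ones E.readLen))
    26 (circuitCode (capBound E) E.circuit)) 31 [true]) 30 (ones j)

theorem workParams_attackWork (E : Environment pp) (items : List Item) (j : ℕ) :
    WorkParams pir ot k pp (attackWork pir ot k E items j) :=
  (((((workParams_workStore pir ot k pp E.x).update (by norm_num) _).update (by norm_num) _).update
    (by norm_num) _).update (by norm_num) _).update (by norm_num) _

/-- A bound on the running time of the malicious server. -/
def attackTime (pir ot : RetrievalProtocol) (E : Environment pp) (n B : ℕ) : ℕ :=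
  B + (n * itemTime pir ot B + 1) +
    decideTime E.readLen (circuitCode (capBound E) E.circuit).length (2 * B) + 10

theorem det_attackCmd_stopped {mem : Store} (h : mem (workReg 31) = []) :
    Det (attackCmd pir ot A) mem 2 mem :=
  Det.branch_nil h Det.skip le_rfl

theorem impl_attackCmd_succ {E : Environment pp} {items : List Item} {B j : ℕ} {a mem : Store}
    (ha : HaltsIn A a B) (h : OuterParts a (attackWork pir ot k E items (j + 1)) mem) :
    Impl (attackCmd pir ot A) mem (B + 5) (exec A a)
      fun a' mem' => OuterParts a' (attackWork pir ot k E items j) mem' := by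
  have h31 : mem (workReg 31) = [true] := by
    have := congrFun h.work 31
    rw [Function.comp_apply] at this
    rw [this]; simp [attackWork]
  refine Impl.branch_true h31 (Impl.seq_det (T' := 2) (h.impl ha) ?_ le_rfl) (by omega)
  intro a' _ mem' h'
  have h30 : mem' (workReg 30) = ones (j + 1) := by
    have := congrFun h'.work 30
    rw [Function.comp_apply] at this
    rw [this]; simp [attackWork]
  refine ⟨_, Det.branch_true (l := ones j) (by rw [h30]; rfl) Det.pop le_rfl, ?_, ?_, ?_, ?_⟩
  · rw [← h'.outer]
    refine Function.update_comp_eq_of_notMem_range _ _ ?_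
    rintro ⟨r, hr⟩
    rw [outerReg] at hr
    split_ifs at hr
    · rw [workReg] at hr; omega
    · exact advReg_ne_workReg _ _ hr
  · rw [update_work_recv, h'.recv]
  · rw [update_work_work, h'.work, h30, attackWork, Function.update_idem]
    rfl
  · rw [Function.update_of_ne (advReg_ne_workReg _ _), h'.adv]

/-- The activation after the last round ends the attacked session. The remaining schedule refers to
no output of the receiver, so the server can play both sides of it. -/
theorem impl_attackCmd_zero {E : Environment pp} {items : List Item} {B L : ℕ} {a mem : Store}
    (hB : Bounds pir ot A k pp (corruptStore pir ot k pp E.x) B)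
    (ha : Reach A (corruptStore pir ot k pp E.x) L a) (ha1 : a 1 = [])
    (h : OuterParts a (attackWork pir ot k E items 0) mem) :
    Impl (attackCmd pir ot A) mem (attackTime pir ot E items.length B)
      (((exec A a).bind (restSem pir ot A k pp items)).map fun σ => E.decide (σ 1))
      fun b mem' => mem' 1 = [!b] ∧ mem' (workReg 31) = [] := by
  have h31 : mem (workReg 31) = [true] := by
    have := congrFun h.work 31
    rw [Function.comp_apply] at this
    rw [this]; simp [attackWork]
  have hAa := hB.adversary _ _ ha
  have hmap : (((exec A a).bind (restSem pir ot A k pp items)).map fun σ => E.decide (σ 1)) =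
      (exec A a).bind fun a' => (restSem pir ot A k pp items a').bind
        fun σ => PMF.pure (E.decide (σ 1)) := PMF.map_bind _ _ _
  have hlen : ∀ l c S S', S ≤ S' → decideTime l c S ≤ decideTime l c S' := fun l c S S' hS => by
    rw [decideTime, decideTime]; omega
  rw [hmap]
  refine Impl.branch_true h31 (Impl.seq (h.impl hAa) (T' := 1 + (items.length * itemTime pir ot B +
    1 + decideTime E.readLen (circuitCode (capBound E) E.circuit).length (2 * B) + 1) + 1 + 1) ?_
    le_rfl) (by rw [attackTime]; omega)
  intro a' ha' mem₁ h₁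
  have hw := fun r => congrFun h₁.work r
  simp only [Function.comp_apply] at hw
  have ha'1 : (a' 1).length ≤ 2 * B := by
    have := length_le_of_exec hAa ha' 1
    rw [ha1, List.length_nil] at this
    omega
  obtain ⟨b, hb, hbσ, hb0, hb1⟩ := h₁.resting ha'1
  have h₂ := hb.update_work 31 (mem₁ (workReg 31)).tail
  have hidle : Idle A (corruptStore pir ot k pp E.x) L a' := fun msg => Reach.next ha ha' msg
  refine Impl.branch_nil (by rw [hw]; simp [attackWork, ones]) (Impl.det_seq Det.pop
    (Impl.seq (impl_restCmd hB items ((workParams_attackWork E items 0).update (by norm_num) _)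
      (by simp [attackWork]) hidle ⟨b, h₂, hbσ, hb0, hb1⟩) (T' := decideTime E.readLen
        (circuitCode (capBound E) E.circuit).length (2 * B)) ?_ le_rfl) le_rfl) le_rfl
  rintro σ' - mem₂ ⟨-, c, hc, hcσ, hc0, hc1⟩
  obtain ⟨τ, d, hτ, hτ'⟩ := det_decideCmd E (N := capBound E) hc
    (by simp [attackWork, workStore, corruptStore]) (by simp [attackWork, workStore, corruptStore])
    (by simp [attackWork]) (by simp [attackWork]) le_rfl
    (by simp [attackWork, workStore, corruptStore]) (by simp [attackWork, workStore, corruptStore])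
    (by simp [attackWork, workStore, corruptStore])
  refine (d.mono (hlen _ _ _ _ hc1)).impl ⟨?_, ?_⟩
  · rw [hτ, hcσ 1 (by norm_num)]
  · rw [hτ', hw]
    simp [attackWork]

/-- Efficiency is required on all reachable stores, also after more messages than the protocol has.
The empty flag register 31 makes those activations trivial. -/
theorem haltsIn_attackCmd {E : Environment pp} {items : List Item} {B j L : ℕ} {mem₀ mem σ : Store}
    (hB : Bounds pir ot A k pp (corruptStore pir ot k pp E.x) B)
    {L₀ : ℕ} (hσ : Idle A (corruptStore pir ot k pp E.x) L₀ σ)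
    (h₀ : ∀ msg, OuterParts (deliver σ msg) (attackWork pir ot k E items j) (deliver mem₀ msg))
    (h : Reach (attackCmd pir ot A) mem₀ L mem) :
    HaltsIn (attackCmd pir ot A) mem (attackTime pir ot E items.length B) := by
  have hwork : ∀ (m : Store) (msg : Str), deliver m msg (workReg 31) = m (workReg 31) :=
    fun m msg => deliver_of_ne (by rw [workReg]; omega) (by rw [workReg]; omega)
  have halts : ∀ {i L' : ℕ} {a mem : Store}, Reach A (corruptStore pir ot k pp E.x) L' a →
      a 1 = [] → OuterParts a (attackWork pir ot k E items i) mem →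
      HaltsIn (attackCmd pir ot A) mem (attackTime pir ot E items.length B) := by
    intro i L' a mem ha ha1 hm
    cases i with
    | zero => exact (impl_attackCmd_zero hB ha ha1 hm).1
    | succ i =>
      exact (impl_attackCmd_succ (hB.adversary _ _ ha) hm).1.mono (by rw [attackTime]; omega)
  -- Invariant: the server has stopped, or it emulates a reachable store of the adversary with some
  -- number `i` of rounds left.
  have key : mem (workReg 31) = [] ∨ ∃ i L' a, Reach A (corruptStore pir ot k pp E.x) L' a ∧
      a 1 = [] ∧ OuterParts a (attackWork pir ot k E items i) mem := by
    induction h with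
    | first msg => exact Or.inr ⟨j, _, _, hσ msg, deliver_one _ _, h₀ msg⟩
    | @next L mem mem' h h' msg ih =>
      rcases ih with ih | ⟨i, L', a, ha, ha1, hm⟩
      · left
        rw [(det_attackCmd_stopped ih).2, PMF.mem_support_pure_iff] at h'
        rw [hwork, h', ih]
      · cases i with
        | zero =>
          obtain ⟨b, -, hb⟩ := (impl_attackCmd_zero hB ha ha1 hm).2.of_support h'
          left
          rw [hwork, hb.2]
        | succ i =>
          obtain ⟨a', ha', hm'⟩ := (impl_attackCmd_succ (hB.adversary _ _ ha) hm).2.of_support h'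
          exact Or.inr ⟨i, _, _, Reach.next ha ha' msg, deliver_one _ _, hm'.deliver msg⟩
  rcases key with key | ⟨i, L', a, ha, ha1, hm⟩
  · exact (det_attackCmd_stopped key).1.mono (by rw [attackTime]; omega)
  · exact halts ha ha1 hm

/-- Until the rounds are over the server answers exactly as the adversary, so the same receiver can
be used on both sides. The stores are compared only after a delivery, since advice cannot prescribe
registers 0 and 1. -/
theorem coupled_interact {E : Environment pp} {items : List Item} {B : ℕ}
    (hB : Bounds pir ot A k pp (corruptStore pir ot k pp E.x) B) (R : Cmd) (j : ℕ) {L : ℕ}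
    {σ mem ρ : Store} {msg : Str} (hσ : Idle A (corruptStore pir ot k pp E.x) L σ)
    (h : ∀ m, OuterParts (deliver σ m) (attackWork pir ot k E items j) (deliver mem m)) :
    Coupled (interact A R j σ ρ msg) (interact (attackCmd pir ot A) R j mem ρ msg)
      fun x y => (∃ L', Idle A (corruptStore pir ot k pp E.x) L' x.1) ∧
        (∀ m, OuterParts (deliver x.1 m) (attackWork pir ot k E items 0) (deliver y.1 m)) ∧
        x.2 = y.2 := by
  induction j generalizing L σ mem ρ msg with
  | zero => exact Coupled.pure ⟨⟨_, hσ⟩, h, rfl⟩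
  | succ j ih =>
    refine Coupled.bind (impl_attackCmd_succ (hB.adversary _ _ (hσ msg)) (h msg)).2 ?_
    intro σ' hσ' mem' _ hm
    have h1 : mem' 1 = σ' 1 := congrFun hm.outer 1
    rw [h1]
    refine Coupled.bind (Coupled.refl _) ?_
    rintro ρ' - _ - ⟨-, rfl⟩
    exact ih (hσ.exec hσ') hm.deliver

theorem map_run_attackCmd {E : Environment pp} {items : List Item} {B : ℕ}
    (hB : Bounds pir ot A k pp (corruptStore pir ot k pp E.x) B) (P : RetrievalProtocol)
    (n m i : ℕ) {L : ℕ} {σ mem : Store} (hσ : Idle A (corruptStore pir ot k pp E.x) L σ)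
    (h : ∀ msg, OuterParts (deliver σ msg) (attackWork pir ot k E items (P.rounds k n m))
      (deliver mem msg)) :
    (P.run (attackCmd pir ot A) k n m i mem).map (fun y => y.1 1) =
      ((P.run A k n m i σ).bind fun y => (restSem pir ot A k pp items y.1).map
        fun σ => E.decide (σ 1)).map fun b => [!b] := by
  have e₁ : (P.run (attackCmd pir ot A) k n m i mem).map (fun y => y.1 1) =
      ((interact (attackCmd pir ot A) P.receiver (P.rounds k n m) mem
        (RetrievalProtocol.receiverStore k n m i) []).bind
        fun x => exec (attackCmd pir ot A) (deliver x.1 x.2.2)).map fun σ => σ 1 := by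
    simp only [RetrievalProtocol.run_eq, PMF.map_bind, PMF.map_comp]
    rfl
  have e₂ : ((P.run A k n m i σ).bind fun y => (restSem pir ot A k pp items y.1).map
        fun σ => E.decide (σ 1)) = (interact A P.receiver (P.rounds k n m) σ
        (RetrievalProtocol.receiverStore k n m i) []).bind
        fun x => ((exec A (deliver x.1 x.2.2)).bind (restSem pir ot A k pp items)).map
          fun σ => E.decide (σ 1) := by
    simp only [RetrievalProtocol.run_eq, PMF.bind_bind, PMF.bind_map, PMF.map_bind]
    rfl
  rw [e₁, e₂]
  have := (coupled_interact (items := items) hB P.receiver (P.rounds k n m)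
    (ρ := RetrievalProtocol.receiverStore k n m i) (msg := []) hσ h).bind
    (f := fun x => ((exec A (deliver x.1 x.2.2)).bind (restSem pir ot A k pp items)).map
          fun σ => E.decide (σ 1))
    (g := fun x => exec (attackCmd pir ot A) (deliver x.1 x.2.2))
    (Rel' := fun b mem' => mem' 1 = [!b] ∧ mem' (workReg 31) = []) (by
      rintro ⟨σ', ρ, msg⟩ - ⟨mem', y⟩ - ⟨⟨L', h₁⟩, h₂, rfl⟩
      exact (impl_attackCmd_zero hB (h₁ msg) (deliver_one _ _) (h₂ msg)).2)
  exact (this.map_eq fun b mem' hb => hb.1.symm).symm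

/-- The advice of the malicious server: the adversary's store and the work registers. -/
def attackAdvice (σ W : Store) : Store := fun r =>
  if r ≤ 24 then [] else if r % 3 = 0 then σ (r / 3 - 8) else if r % 3 = 2 then W (r / 3 - 8) else []

/-- Advice fills the registers from 6 on, and the layout starts at 24, so there is no conflict with
the server's own input. `r / 3 - 8` inverts both `3 * r + 24` and `3 * r + 26`. -/
theorem outerParts_attackAdvice (k n m : ℕ) (σ W : Store) (msg : Str) :
    OuterParts (deliver σ msg) W
      (deliver (RetrievalProtocol.serverStore k n m [] (attackAdvice σ W)) msg) := by
  have far : ∀ r, 6 ≤ r → deliver (RetrievalProtocol.serverStore k n m [] (attackAdvice σ W)) msg r =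
      attackAdvice σ W r := fun r hr => by
    rw [deliver_of_ne (by omega) (by omega)]
    obtain ⟨r, rfl⟩ := Nat.exists_eq_add_of_le' hr
    rfl
  refine ⟨?_, ?_, ?_, ?_⟩
  · funext r
    rw [Function.comp_apply]
    by_cases h0 : r = 0
    · subst h0; rw [deliver_zero]; exact deliver_zero _ _
    by_cases h1 : r = 1
    · subst h1; rw [deliver_one]; exact deliver_one _ _
    have : outerReg r = 3 * r + 24 := by simp [outerReg, advReg, h0, h1]
    rw [deliver_of_ne h0 h1, this, far _ (by omega), attackAdvice, if_neg (by omega),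
      if_pos (by omega)]
    congr 1
    omega
  · funext r
    rw [Function.comp_apply, far _ (by rw [recvReg]; omega), attackAdvice, recvReg,
      if_neg (by omega), if_neg (by omega), if_neg (by omega)]
  · funext r
    rw [Function.comp_apply, far _ (by rw [workReg]; omega), attackAdvice, workReg,
      if_neg (by omega), if_neg (by omega), if_pos (by omega)]
    congr 1
    omega
  · rw [far _ (by simp [advReg])]
    simp [attackAdvice, advReg]

theorem length_attackAdvice_le {σ W : Store} {S : ℕ} (hσ : ∀ r, r ≠ 0 → (σ r).length ≤ S)
    (hW : ∀ r, (W r).length ≤ S) (r : ℕ) : (attackAdvice σ W r).length ≤ S := by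
  rw [attackAdvice]
  split_ifs with h₁ h₂ h₃
  · simp
  · exact hσ _ (by omega)
  · exact hW _
  · simp

end Attack

end PrivateRouting

open scoped ENNReal

/-! ### The hybrid argument. -/

namespace PrivateRouting

/-! ## Replacing indices one by one -/

/-- The probabilities of `false` differ by at most `ε`. -/
def Close (ε : ℝ≥0∞) (P Q : PMF Bool) : Prop :=
  P false ≤ Q false + ε ∧ Q false ≤ P false + ε

namespace Close

variable {α : Type} {ε δ : ℝ≥0∞} {P Q R : PMF Bool}

theorem refl (ε : ℝ≥0∞) (P : PMF Bool) : Close ε P P := ⟨le_self_add, le_self_add⟩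

theorem trans (h : Close ε P Q) (h' : Close δ Q R) : Close (ε + δ) P R := by
  refine ⟨h.1.trans ?_, h'.2.trans ?_⟩
  · calc Q false + ε ≤ R false + δ + ε := by gcongr; exact h'.1
      _ = R false + (ε + δ) := by ring
  · calc Q false + δ ≤ P false + ε + δ := by gcongr; exact h.2
      _ = P false + (ε + δ) := by ring

theorem bind {μ : PMF α} {F G : α → PMF Bool} (h : ∀ a ∈ μ.support, Close ε (F a) (G a)) :
    Close ε (μ.bind F) (μ.bind G) := by
  have key : ∀ F G : α → PMF Bool, (∀ a ∈ μ.support, F a false ≤ G a false + ε) →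
      μ.bind F false ≤ μ.bind G false + ε := by
    intro F G h
    rw [PMF.bind_apply, PMF.bind_apply]
    calc ∑' a, μ a * F a false ≤ ∑' a, (μ a * G a false + μ a * ε) := by
          refine ENNReal.tsum_le_tsum fun a => ?_
          rw [← mul_add]
          by_cases ha : μ a = 0
          · simp [ha]
          · gcongr
            exact h a ((PMF.mem_support_iff _ _).2 ha)
      _ = ∑' a, μ a * G a false + ε := by
          rw [ENNReal.tsum_add, ENNReal.tsum_mul_right, PMF.tsum_coe, one_mul]
  exact ⟨key F G fun a ha => (h a ha).1, key G F fun a ha => (h a ha).2⟩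

/-- For randomness that the server does not see: the client's random field elements and fresh keys.
-/
theorem bind_left {μ : PMF α} {F : α → PMF Bool} (h : ∀ a, Close ε (F a) Q) :
    Close ε (μ.bind F) Q := by
  have := bind (μ := μ) (F := F) (G := fun _ => Q) (fun a _ => h a)
  rwa [PMF.bind_const] at this

end Close

/-- Register 0 is left out because deliveries fill it with messages of the receiver, whose length is
not tracked here. -/
theorem mem_support_interact {A R : Cmd} {σ₀ : Store} {B : ℕ}
    (hA : ∀ L σ, Reach A σ₀ L σ → HaltsIn A σ B) {j L : ℕ} {σ ρ : Store} {msg : Str}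
    (hσ : Idle A σ₀ L σ) {x : Store × Store × Str} (hx : x ∈ (interact A R j σ ρ msg).support) :
    (∃ L', Idle A σ₀ L' x.1) ∧ ∀ r, r ≠ 0 → (x.1 r).length ≤ (σ r).length + j * B := by
  induction j generalizing L σ ρ msg with
  | zero =>
    obtain rfl := (PMF.mem_support_pure_iff _ _).1 hx
    exact ⟨⟨_, hσ⟩, fun r _ => by simp⟩
  | succ j ih =>
    obtain ⟨σ', hσ', hx⟩ := (PMF.mem_support_bind_iff _ _ _).1 hx
    obtain ⟨ρ', hρ', hx⟩ := (PMF.mem_support_bind_iff _ _ _).1 hx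
    obtain ⟨h₁, h₂⟩ := ih (hσ.exec hσ') hx
    refine ⟨h₁, fun r hr => (h₂ r hr).trans ?_⟩
    have h₃ := length_le_of_exec (hA _ _ (hσ msg)) hσ' r
    have h₄ : (deliver σ msg r).length ≤ (σ r).length := by
      by_cases h1 : r = 1
      · subst h1; simp [deliver_one]
      · rw [deliver_of_ne hr h1]
    nlinarith

theorem mem_support_exec {A : Cmd} {σ₀ : Store} {B : ℕ}
    (hA : ∀ L σ, Reach A σ₀ L σ → HaltsIn A σ B) {L : ℕ} {σ σ' : Store} {msg : Str}
    (hσ : Idle A σ₀ L σ) (hσ' : σ' ∈ (exec A (deliver σ msg)).support) :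
    (∃ L', Idle A σ₀ L' σ') ∧ ∀ r, r ≠ 0 → (σ' r).length ≤ (σ r).length + B := by
  refine ⟨⟨_, hσ.exec hσ'⟩, fun r hr => ?_⟩
  have h₃ := length_le_of_exec (hA _ _ (hσ msg)) hσ' r
  have h₄ : (deliver σ msg r).length ≤ (σ r).length := by
    by_cases h1 : r = 1
    · subst h1; simp [deliver_one]
    · rw [deliver_of_ne hr h1]
  omega

/-- `σ` is a possible store of the adversary; its size is bounded by `S`, also when `n` items of the
schedule have been executed. -/
def Good (A : Cmd) (σ₀ : Store) (B S n : ℕ) (σ : Store) : Prop :=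
  (∃ L, Idle A σ₀ L σ) ∧ ∀ r, r ≠ 0 → (σ r).length + n * ((B + 1) * B) ≤ S

theorem Good.congr {A : Cmd} {σ₀ : Store} {B S n n' : ℕ} {σ : Store} (h : Good A σ₀ B S n σ)
    (hn : n = n') : Good A σ₀ B S n' σ := hn ▸ h

section Hybrid

variable {pir ot : RetrievalProtocol} {A : Cmd} {k : ℕ} {pp : PublicParams} {B S n : ℕ}
  {E : Environment pp} {δ ε : ℝ≥0∞} {items : List Item} {σ σ₀ : Store}

/-- A session consists of at most `B` rounds and one more activation, each of which lengthens a
register by at most `B`; hence the allowance `(B + 1) * B` per item. -/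
theorem Good.run (hB : Bounds pir ot A k pp σ₀ B) (h : Good A σ₀ B S (n + 1) σ) {s : Session}
    {i : ℕ} {y : Store × Str} (hy : y ∈ (s.run pir ot A k pp i σ).support) :
    Good A σ₀ B S n y.1 := by
  obtain ⟨⟨L, hσ⟩, hS⟩ := h
  rw [Session.run, RetrievalProtocol.run_eq] at hy
  obtain ⟨x, hx, hy⟩ := (PMF.mem_support_bind_iff _ _ _).1 hy
  obtain ⟨σ', hσ', rfl⟩ := (PMF.mem_support_map_iff _ _ _).1 hy
  obtain ⟨⟨L₁, h₁⟩, h₂⟩ := mem_support_interact hB.adversary hσ hx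
  obtain ⟨h₃, h₄⟩ := mem_support_exec hB.adversary h₁ hσ'
  refine ⟨h₃, fun r hr => ?_⟩
  have e₁ := h₂ r hr
  have e₂ := h₄ r hr
  have e₃ := hS r hr
  have e₄ : (s.protocol pir ot).rounds k (s.count pp) (s.len pp) * B ≤ B * B :=
    Nat.mul_le_mul_right _ (hB.rounds s)
  dsimp only
  nlinarith

theorem Good.activate (hB : Bounds pir ot A k pp σ₀ B) (h : Good A σ₀ B S (n + 1) σ) {σ' : Store}
    {msg : Str} (hσ' : σ' ∈ (exec A (deliver σ msg)).support) : Good A σ₀ B S n σ' := by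
  obtain ⟨⟨L, hσ⟩, hS⟩ := h
  obtain ⟨h₃, h₄⟩ := mem_support_exec hB.adversary hσ hσ'
  refine ⟨h₃, fun r hr => ?_⟩
  have e₂ := h₄ r hr
  have e₃ := hS r hr
  nlinarith

/-- The bit of the environment when the given items remain. -/
noncomputable def restBit (pir ot : RetrievalProtocol) (A : Cmd) (k : ℕ) (E : Environment pp)
    (items : List Item) (σ : Store) : PMF Bool :=
  (restSem pir ot A k pp items σ).map fun σ => E.decide (σ 1)

theorem restBit_session (s : Session) :
    restBit pir ot A k E (some s :: items) σ =
      (s.run pir ot A k pp 0 σ).bind fun y => restBit pir ot A k E items y.1 := by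
  rw [restBit, restSem, Item.sem, PMF.map_bind, PMF.bind_map]
  rfl

theorem restBit_activate :
    restBit pir ot A k E (none :: items) σ =
      (exec A (deliver σ [])).bind (restBit pir ot A k E items) := by
  rw [restBit, restSem, Item.sem, PMF.map_bind]
  rfl

/-- The index of a single session can be replaced by `0` at the cost of `δ`. -/
def Swappable (pir ot : RetrievalProtocol) (A : Cmd) (k : ℕ) (E : Environment pp) (σ₀ : Store)
    (B S : ℕ) (δ : ℝ≥0∞) : Prop :=
  ∀ (s : Session) (i : ℕ) (items : List Item) (σ : Store), i < s.count pp →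
    Good A σ₀ B S (items.length + 1) σ →
    Close δ ((s.run pir ot A k pp i σ).bind fun y => restBit pir ot A k E items y.1)
      ((s.run pir ot A k pp 0 σ).bind fun y => restBit pir ot A k E items y.1)

/-- The core of the hybrid argument. Replacing the continuation, at cost `ε`, removes its dependence
on the receiver's output `y.2`; only then can the index be replaced, at cost `δ`. Earlier outputs
determine later indices, so the replacement must go backwards. -/
theorem close_session (hB : Bounds pir ot A k pp σ₀ B) (hδ : Swappable pir ot A k E σ₀ B S δ)
    {s : Session} {i : ℕ} (hi : i < s.count pp) {F : Store × Str → PMF Bool}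
    (hF : ∀ y, Good A σ₀ B S items.length y.1 → Close ε (F y) (restBit pir ot A k E items y.1))
    (hσ : Good A σ₀ B S (items.length + 1) σ) :
    Close (ε + δ) ((s.run pir ot A k pp i σ).bind F)
      (restBit pir ot A k E (some s :: items) σ) := by
  rw [restBit_session]
  exact (Close.bind fun y hy => hF y (hσ.run hB hy)).trans (hδ s i items σ hi hσ)

theorem close_runOTs (hB : Bounds pir ot A k pp σ₀ B) (hδ : Swappable pir ot A k E σ₀ B S δ)
    (bits : List Bool) {F : Store × List Str → PMF Bool}
    (hF : ∀ y, Good A σ₀ B S items.length y.1 → Close ε (F y) (restBit pir ot A k E items y.1))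
    (hσ : Good A σ₀ B S (bits.length + items.length) σ) :
    Close (ε + bits.length * δ) ((runOTs ot A k pp.labelLen bits σ).bind F)
      (restBit pir ot A k E (List.replicate bits.length (some Session.otLabel) ++ items) σ) := by
  induction bits generalizing σ F with
  | nil =>
    rw [runOTs, PMF.pure_bind]
    simpa using hF (σ, []) (by simpa using hσ)
  | cons b bits ih =>
    have e : (runOTs ot A k pp.labelLen (b :: bits) σ).bind F =
        (Session.otLabel.run pir ot A k pp b.toNat σ).bind fun y =>
          (runOTs ot A k pp.labelLen bits y.1).bind fun z => F (z.1, y.2 :: z.2) := by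
      change (PMF.bind _ _).bind F = _
      rw [PMF.bind_bind]
      refine pmf_bind_congr fun y _ => ?_
      obtain ⟨σ₁, l⟩ := y
      change (PMF.bind _ _).bind F = _
      rw [PMF.bind_bind]
      refine pmf_bind_congr fun z _ => ?_
      obtain ⟨σ₂, ls⟩ := z
      exact PMF.pure_bind _ _
    rw [e]
    have := close_session (items := List.replicate bits.length (some Session.otLabel) ++ items)
      (σ := σ) hB hδ (s := Session.otLabel) (i := b.toNat)
      (show b.toNat < 2 by cases b <;> decide)
      (fun y hy => ih (σ := y.1) (F := fun z => F (z.1, y.2 :: z.2)) (fun z hz => hF _ hz)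
        (by simpa using hy)) (by simpa [add_right_comm] using hσ)
    have hε : ε + ((b :: bits).length : ℝ≥0∞) * δ = ε + bits.length * δ + δ := by
      rw [List.length_cons]; push_cast; ring
    rw [hε]
    exact this

theorem length_roundItems : (roundItems pp).length = 2 * pp.fieldBits + 3 := by
  simp [roundItems]

/-- All branches of the client produce the same items, so each is compared with the same schedule.
The cost counts the two PIR sessions and one OT for each bit of the two field elements. -/
theorem close_clientRound (hB : Bounds pir ot A k pp σ₀ B)
    (hδ : Swappable pir ot A k E σ₀ B S δ) (alg : LocalAlgorithms) (t : Fin pp.n) (kDst : Str)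
    (s : Fin pp.n) (kSrc : Str) {F : Store × Fin pp.n × Str × Option (Fin pp.n) → PMF Bool}
    (hF : ∀ y, Good A σ₀ B S items.length y.1 → Close ε (F y) (restBit pir ot A k E items y.1))
    (hσ : Good A σ₀ B S ((roundItems pp).length + items.length) σ) :
    Close (ε + (2 * pp.fieldBits + 2 : ℕ) * δ)
      ((clientRound pir ot alg A k pp t kDst s kSrc σ).bind F)
      (restBit pir ot A k E (roundItems pp ++ items) σ) := by
  rw [length_roundItems] at hσ
  have hε : ε + (2 * pp.fieldBits + 2 : ℕ) * δ =
      ε + (2 * pp.fieldBits : ℕ) * δ + δ + δ := by push_cast; ring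
  have hitems : roundItems pp ++ items = some Session.pirSrc :: some Session.pirDst ::
      (List.replicate (2 * pp.fieldBits) (some Session.otLabel) ++ (none :: items)) := by
    simp [roundItems]
  rw [hε, hitems]
  change Close _ ((PMF.bind _ _).bind F) _
  rw [PMF.bind_bind]
  refine close_session (s := Session.pirSrc) hB hδ s.isLt ?_
    (hσ.congr (by simp only [List.length_cons, List.length_append, List.length_replicate]; omega))
  rintro ⟨σ₁, cSrc⟩ hσ₁
  change Close _ ((PMF.bind _ _).bind F) _
  rw [PMF.bind_bind]
  refine close_session (s := Session.pirDst) hB hδ t.isLt ?_ hσ₁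
  rintro ⟨σ₂, cDst⟩ hσ₂
  dsimp only
  -- Whether or not both records parse, two field elements result, hence the same number of
  -- transfers. Their values affect only the choice bits.
  split
  all_goals
    change Close _ ((PMF.bind _ _).bind F) _
    rw [PMF.bind_bind]
    refine Close.bind_left ?_
    rintro ⟨z_ne, z_nw⟩
    change Close _ ((PMF.bind _ _).bind F) _
    rw [PMF.bind_bind]
    have hbits : (toBits pp.fieldBits z_ne.val ++ toBits pp.fieldBits z_nw.val).length =
        2 * pp.fieldBits := by simp [toBits]; ring
    rw [← hbits]
    refine close_runOTs hB hδ _ ?_ (hσ₂.congr (by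
      rw [List.length_append, List.length_replicate, hbits]))
    rintro ⟨σ₃, zLabels⟩ hσ₃
    change Close _ ((PMF.bind _ _).bind F) _
    rw [PMF.bind_bind, restBit_activate]
    refine Close.bind fun σ₄ hσ₄ => ?_
    have hg : Good A σ₀ B S items.length σ₄ := Good.activate hB hσ₃ hσ₄
    dsimp only
    split
    · exact (PMF.pure_bind _ F).symm ▸ hF _ hg
    · change Close _ ((PMF.bind _ _).bind F) _
      rw [PMF.bind_bind]
      refine Close.bind_left fun kNew => ?_
      exact (PMF.pure_bind _ F).symm ▸ hF _ hg

theorem close_clientRounds (hB : Bounds pir ot A k pp σ₀ B)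
    (hδ : Swappable pir ot A k E σ₀ B S δ) (alg : LocalAlgorithms) (t : Fin pp.n) (kDst : Str)
    (r : ℕ) (s : Fin pp.n) (kSrc : Str)
    {F : Store × List (Option (Fin pp.n)) → PMF Bool}
    (hF : ∀ y, Good A σ₀ B S items.length y.1 → Close ε (F y) (restBit pir ot A k E items y.1))
    (hσ : Good A σ₀ B S ((roundsItems pp r).length + items.length) σ) :
    Close (ε + (r * (2 * pp.fieldBits + 2) : ℕ) * δ)
      ((clientRounds pir ot alg A k pp t kDst r s kSrc σ).bind F)
      (restBit pir ot A k E (roundsItems pp r ++ items) σ) := by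
  induction r generalizing σ s kSrc F with
  | zero =>
    rw [clientRounds, PMF.pure_bind]
    simpa [roundsItems] using hF (σ, []) (by simpa [roundsItems] using hσ)
  | succ r ih =>
    have e : (clientRounds pir ot alg A k pp t kDst (r + 1) s kSrc σ).bind F =
        (clientRound pir ot alg A k pp t kDst s kSrc σ).bind fun y =>
          (clientRounds pir ot alg A k pp t kDst r y.2.1 y.2.2.1 y.1).bind fun z =>
            F (z.1, y.2.2.2 :: z.2) := by
      change (PMF.bind _ _).bind F = _
      rw [PMF.bind_bind]
      refine pmf_bind_congr fun y _ => ?_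
      obtain ⟨σ₁, s₁, kSrc₁, o⟩ := y
      change (PMF.bind _ _).bind F = _
      rw [PMF.bind_bind]
      refine pmf_bind_congr fun z _ => ?_
      obtain ⟨σ₂, ls⟩ := z
      exact PMF.pure_bind _ _
    rw [e, roundsItems, List.append_assoc]
    have := close_clientRound (items := roundsItems pp r ++ items) (σ := σ) hB hδ alg t kDst s kSrc
      (fun y hy => ih (σ := y.1) y.2.1 y.2.2.1 (F := fun z => F (z.1, y.2.2.2 :: z.2))
        (fun z hz => hF _ hz) (by simpa using hy))
      (by simpa [roundsItems, add_assoc] using hσ)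
    convert this using 1
    push_cast
    ring

theorem close_realBit (alg : LocalAlgorithms)
    (hB : Bounds pir ot A k pp (corruptStore pir ot k pp E.x) B)
    (hδ : Swappable pir ot A k E (corruptStore pir ot k pp E.x) B S δ)
    (hS : Good A (corruptStore pir ot k pp E.x) B S (allItems pp).length
      (corruptStore pir ot k pp E.x)) :
    Close ((pp.R * (2 * pp.fieldBits + 2) + 2 : ℕ) * δ) (realBit pir ot alg A k pp E)
      (restBit pir ot A k E (allItems pp) (corruptStore pir ot k pp E.x)) := by
  have hε : (pp.R * (2 * pp.fieldBits + 2) + 2 : ℕ) * δ =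
      0 + (pp.R * (2 * pp.fieldBits + 2) : ℕ) * δ + δ + δ := by push_cast; ring
  rw [hε]
  change Close _ ((PMF.bind _ _).map _) _
  rw [PMF.map_bind]
  refine close_session (s := Session.otKey) hB hδ E.s.isLt (items := some Session.otKey ::
    (roundsItems pp pp.R ++ [none])) ?_ hS
  rintro ⟨σ₁, kSrc⟩ hσ₁
  change Close _ ((PMF.bind _ _).map _) _
  rw [PMF.map_bind]
  refine close_session (s := Session.otKey) hB hδ E.t.isLt ?_ hσ₁
  rintro ⟨σ₂, kDst⟩ hσ₂
  change Close _ ((PMF.bind _ _).map _) _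
  rw [PMF.map_bind]
  refine close_clientRounds hB hδ alg E.t kDst pp.R E.s kSrc ?_ (by simpa using hσ₂)
  rintro ⟨σ₃, path⟩ -
  change Close _ ((PMF.bind _ _).map _) _
  rw [PMF.map_bind, restBit_activate]
  refine Close.bind fun σ₄ _ => ?_
  have : restBit pir ot A k E [] σ₄ = PMF.pure (E.decide (σ₄ 1)) := PMF.pure_map _ _
  rw [this]
  exact (PMF.pure_map _ _).symm ▸ Close.refl _ _

/-- What the simulator submits to the trusted party plays no role, since it affects only the
client's output, which is hidden from the environment. -/
theorem idealBit_eq (hB : Bounds pir ot A k pp (corruptStore pir ot k pp E.x) B)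
    (hS : ∀ r, (corruptStore pir ot k pp E.x r).length ≤ S) :
    idealBit pir ot (simulatorCmd pir ot A) k pp E =
      restBit pir ot A k E (allItems pp) (corruptStore pir ot k pp E.x) := by
  have h := (impl_simulatorCmd hB hS).2.map_eq (f := fun σ => E.decide (σ 1))
    (g := fun σ => E.decide (σ 1)) fun a b hab => by rw [hab]
  rw [restBit, h, idealBit]
  change (PMF.bind _ _).map _ = _
  rw [PMF.map_bind]
  refine pmf_bind_congr fun σ _ => ?_
  exact PMF.pure_map _ _

end Hybrid

end PrivateRouting

/-! ### Polynomial bounds, negligible functions, and the final assembly. -/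

namespace PrivateRouting

/-! ## Polynomially bounded and negligible functions -/

theorem monotone_eval_nat (q : Polynomial ℕ) : Monotone fun k : ℕ => q.eval k := by
  intro a b h
  induction q using Polynomial.induction_on' with
  | add p q hp hq => simp only [Polynomial.eval_add] at *; omega
  | monomial n c => simp only [Polynomial.eval_monomial]; gcongr

namespace PolyBounded

variable {f g : ℕ → ℕ}

theorem of_le (hg : PolyBounded g) (h : ∀ k, f k ≤ g k) : PolyBounded f := by
  obtain ⟨q, hq⟩ := hg
  exact ⟨q, fun k => (h k).trans (hq k)⟩

theorem const (c : ℕ) : PolyBounded fun _ => c := ⟨Polynomial.C c, fun k => by simp⟩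

theorem id : PolyBounded fun k => k := ⟨Polynomial.X, fun k => by simp⟩

theorem eval (q : Polynomial ℕ) : PolyBounded fun k => q.eval k := ⟨q, fun _ => le_rfl⟩

theorem add (hf : PolyBounded f) (hg : PolyBounded g) : PolyBounded fun k => f k + g k := by
  obtain ⟨p, hp⟩ := hf
  obtain ⟨q, hq⟩ := hg
  exact ⟨p + q, fun k => by rw [Polynomial.eval_add]; exact Nat.add_le_add (hp k) (hq k)⟩

theorem mul (hf : PolyBounded f) (hg : PolyBounded g) : PolyBounded fun k => f k * g k := by
  obtain ⟨p, hp⟩ := hf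
  obtain ⟨q, hq⟩ := hg
  exact ⟨p * q, fun k => by rw [Polynomial.eval_mul]; exact Nat.mul_le_mul (hp k) (hq k)⟩

theorem comp (hf : PolyBounded f) (hg : PolyBounded g) : PolyBounded fun k => f (g k) := by
  obtain ⟨p, hp⟩ := hf
  obtain ⟨q, hq⟩ := hg
  exact ⟨p.comp q, fun k => by
    rw [Polynomial.eval_comp]; exact (hp _).trans (monotone_eval_nat p (hq k))⟩

end PolyBounded

namespace Negligible

variable {f g : ℕ → ℝ}

theorem of_le (hg : Negligible g) (h0 : ∀ k, 0 ≤ f k) (h : ∀ k, f k ≤ g k) : Negligible f :=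
  fun c => (Asymptotics.isBigO_of_le _ fun k => by
    rw [Real.norm_of_nonneg (h0 k), Real.norm_of_nonneg ((h0 k).trans (h k))]
    exact h k).trans_isLittleO (hg c)

theorem add (hf : Negligible f) (hg : Negligible g) : Negligible fun k => f k + g k :=
  fun c => (hf c).add (hg c)

theorem mul_polyBounded (hf : Negligible f) {N : ℕ → ℕ} (hN : PolyBounded N) :
    Negligible fun k => N k * f k := by
  intro c
  obtain ⟨q, hq⟩ := hN
  set d := q.natDegree
  have h₁ : (fun k : ℕ => (N k : ℝ)) =O[Filter.atTop] fun k : ℕ => (k : ℝ) ^ d := by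
    have h₂ : (fun x : ℝ => (q.map (Nat.castRingHom ℝ)).eval x) =O[Filter.atTop]
        fun x => (Polynomial.X ^ d : Polynomial ℝ).eval x := by
      refine Polynomial.isBigO_atTop_of_degree_le _ _ ?_
      rw [Polynomial.degree_X_pow]
      exact Polynomial.degree_map_le.trans Polynomial.degree_le_natDegree
    have h₃ := h₂.comp_tendsto tendsto_natCast_atTop_atTop
    refine Asymptotics.IsBigO.trans (Asymptotics.isBigO_of_le _ fun k => ?_)
      (h₃.trans (Asymptotics.isBigO_of_le _ fun k => ?_))
    · have e : ((q.map (Nat.castRingHom ℝ)).eval (k : ℝ)) = ((q.eval k : ℕ) : ℝ) := by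
        rw [Polynomial.eval_natCast_map]; rfl
      simp only [Function.comp_apply, e, RCLike.norm_natCast]
      exact_mod_cast hq k
    · simp
  refine (h₁.mul_isLittleO (hf (c + d))).congr' Filter.EventuallyEq.rfl ?_
  filter_upwards [Filter.eventually_ge_atTop 1] with k hk
  have : (k : ℝ) ≠ 0 := by positivity
  rw [pow_add]
  field_simp

end Negligible

/-- From negligibility along every sequence of choices to a uniform bound: a sequence of nearly
maximal choices is itself one of the sequences. -/
theorem exists_negligible_bound {ι : Type} {valid : ℕ → ι → Prop} {f : ℕ → ι → ℝ}
    (h0 : ∀ k c, 0 ≤ f k c) (h1 : ∀ k c, f k c ≤ 1) (hv : ∀ k, ∃ c, valid k c)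
    (h : ∀ c : ℕ → ι, (∀ k, valid k (c k)) → Negligible fun k => f k (c k)) :
    ∃ δ : ℕ → ℝ, Negligible δ ∧ ∀ k c, valid k c → f k c ≤ δ k := by
  have key : ∀ k, ∃ c, valid k c ∧ ∀ c', valid k c' → f k c' ≤ f k c + f k c := by
    intro k
    have hbdd : BddAbove (f k '' {c | valid k c}) := ⟨1, by rintro _ ⟨c, -, rfl⟩; exact h1 k c⟩
    have hle : ∀ c', valid k c' → f k c' ≤ sSup (f k '' {c | valid k c}) := fun c' hc' =>
      le_csSup hbdd ⟨c', hc', rfl⟩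
    obtain ⟨c₀, hc₀⟩ := hv k
    by_cases hs : sSup (f k '' {c | valid k c}) ≤ 0
    · exact ⟨c₀, hc₀, fun c' hc' => ((hle c' hc').trans hs).trans (add_nonneg (h0 k _) (h0 k _))⟩
    · push Not at hs
      -- The supremum need not be attained, but some value exceeds half of it; this accounts for the
      -- factor 2.
      obtain ⟨_, ⟨c, hc, rfl⟩, hlt⟩ := exists_lt_of_lt_csSup
        (show (f k '' {c | valid k c}).Nonempty from ⟨_, c₀, hc₀, rfl⟩) (half_lt_self hs)
      exact ⟨c, hc, fun c' hc' => (hle c' hc').trans (by linarith)⟩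
  choose c hc hc' using key
  exact ⟨fun k => f k (c k) + f k (c k), (h c hc).add (h c hc), hc'⟩

/-! ## Polynomial bounds for the protocol -/

theorem PublicParams.fieldBits_le (pp : PublicParams) : pp.fieldBits ≤ pp.size := by
  have h₁ : pp.fieldBits ≤ Nat.size pp.p := Nat.clog_le_of_le_pow (Nat.lt_size_self _).le
  rw [PublicParams.size]
  omega

theorem PublicParams.tau_add_mu_le (pp : PublicParams) : pp.τ + pp.μ ≤ pp.size := by
  have h₁ : pp.τ + pp.μ + 1 < Nat.size pp.p := Nat.lt_size.2 pp.p_large.le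
  rw [PublicParams.size]
  omega

theorem length_encodeGraph_le (pp : PublicParams) :
    (encodeGraph pp).length ≤ pp.n * (4 * (pp.n + 1)) := by
  have h : ∀ u ∈ List.finRange pp.n, ([Dir.north, Dir.east, Dir.south, Dir.west].flatMap fun dir =>
      match pp.nbr u dir with
      | none => [false]
      | some v => ones (v + 1) ++ [false]).length ≤ 4 * (pp.n + 1) := by
    intro u _
    have h' : ∀ dir, (match pp.nbr u dir with
      | none => [false]
      | some v => ones (v + 1) ++ [false]).length ≤ pp.n + 1 := by
      intro dir
      rcases pp.nbr u dir with _ | v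
      · simp
      · have := v.isLt
        simp [ones]
    have h₁ := h' Dir.north
    have h₂ := h' Dir.east
    have h₃ := h' Dir.south
    have h₄ := h' Dir.west
    simp only [List.flatMap_cons, List.flatMap_nil, List.length_append, List.length_nil]
    omega
  rw [encodeGraph, List.length_flatMap]
  refine (List.sum_le_card_nsmul _ (4 * (pp.n + 1)) ?_).trans (by simp)
  intro x hx
  obtain ⟨u, hu, rfl⟩ := List.mem_map.1 hx
  exact h u hu

theorem length_corruptStore_le {pir ot : RetrievalProtocol} {A : Cmd} {k : ℕ} {pp : PublicParams}
    {x : ServerInput pp} {B : ℕ} (hB : Bounds pir ot A k pp (corruptStore pir ot k pp x) B) (r : ℕ) :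
    (corruptStore pir ot k pp x r).length ≤
      B + x.encode.length + pp.size * (4 * (pp.size + 1)) := by
  have h₁ := pp.fieldBits_le
  have h₂ := pp.tau_add_mu_le
  have hn : pp.n ≤ pp.size := by rw [PublicParams.size]; omega
  have h₃ : (encodeGraph pp).length ≤ pp.size * (4 * (pp.size + 1)) :=
    (length_encodeGraph_le pp).trans (by gcongr)
  have h₄ : pp.size ≤ pp.size * (4 * (pp.size + 1)) := Nat.le_mul_of_pos_right _ (by omega)
  have h₅ : pp.size = pp.n + pp.d + pp.R + pp.keyLen + pp.prfKeyLen + Nat.size pp.p + pp.labelLen +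
    pp.ctLen + pp.srcLen + pp.dstLen := rfl
  have hk := hB.sec
  have h17 := hB.rounds Session.otKey
  have h18 := hB.rounds Session.pirSrc
  have h19 := hB.rounds Session.pirDst
  have h20 := hB.rounds Session.otLabel
  simp only [Session.rounds, Session.protocol, Session.count, Session.len] at h17 h18 h19 h20
  have h11 : (Nat.bits pp.p).length = Nat.size pp.p := (Nat.size_eq_bits_len _).symm ▸ rfl
  match r with
  | 4 => exact h₃.trans (by omega)
  | 11 => change (Nat.bits pp.p).length ≤ _; omega
  | 21 => change x.encode.length ≤ _; omega
  | 0 | 1 | 2 | 3 | 5 | 6 | 7 | 8 | 9 | 10 | 12 | 13 | 14 | 15 | 16 | 17 | 18 | 19 | 20 =>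
    simp only [corruptStore, ones, List.length_replicate, List.length_nil]; omega
  | r + 22 => exact Nat.zero_le _

/-- `B₀` bounds the adversary's time and the numbers of rounds, without reference to messages. It
determines how much a receiver reads, and the receivers' time at that size yields `B`. -/
theorem exists_bounds {pp : ℕ → PublicParams} (hpp : PolyBounded fun k => (pp k).size)
    {pir ot : RetrievalProtocol} (hpir : pir.IsEfficient) (hot : ot.IsEfficient) {A : Cmd}
    (hA : IsPPTServer pir ot pp A) :
    ∃ B : ℕ → ℕ, PolyBounded B ∧ (∀ z, 1 ≤ B z) ∧ ∀ k (x : ServerInput (pp k)),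
      (pp k).size ≤ B (k + x.encode.length) ∧
      Bounds pir ot A k (pp k) (corruptStore pir ot k (pp k) x) (B (k + x.encode.length)) := by
  obtain ⟨q, hq⟩ := hpp
  obtain ⟨qa, hqa⟩ := hA
  obtain ⟨qp, hqp⟩ := hpir
  obtain ⟨qo, hqo⟩ := hot
  -- The summand 2 is the number of records in a label transfer. `N` bounds each of the security
  -- parameter, the number and the length of the records, so `3 * N` bounds their sum.
  set N : ℕ → ℕ := fun z => z + q.eval z + 2 with hN
  set B₀ : ℕ → ℕ := fun z => N z + qa.eval z + qp.eval (3 * N z) + qo.eval (3 * N z) with hB₀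
  set M : ℕ → ℕ := fun z => 3 * N z + B₀ z * (B₀ z + 1) with hM
  have pN : PolyBounded N := (PolyBounded.id.add (PolyBounded.eval q)).add (PolyBounded.const 2)
  have pN3 : PolyBounded fun z => 3 * N z := (PolyBounded.const 3).mul pN
  have pB₀ : PolyBounded B₀ := ((pN.add (PolyBounded.eval qa)).add
    ((PolyBounded.eval qp).comp pN3)).add ((PolyBounded.eval qo).comp pN3)
  have pM : PolyBounded M := pN3.add (pB₀.mul (pB₀.add (PolyBounded.const 1)))
  refine ⟨fun z => B₀ z + qp.eval (M z) + qo.eval (M z), (pB₀.add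
    ((PolyBounded.eval qp).comp pM)).add ((PolyBounded.eval qo).comp pM),
    fun z => by simp only [hB₀, hN]; omega, fun k x => ?_⟩
  set z := k + x.encode.length with hz
  have hsize : (pp k).size ≤ q.eval z :=
    (hq k).trans (monotone_eval_nat q (show k ≤ z by omega))
  change (pp k).size ≤ B₀ z + qp.eval (M z) + qo.eval (M z) ∧
    Bounds _ _ _ _ _ _ (B₀ z + qp.eval (M z) + qo.eval (M z))
  have hNz : N z = z + q.eval z + 2 := rfl
  have hB₀z : B₀ z = N z + qa.eval z + qp.eval (3 * N z) + qo.eval (3 * N z) := rfl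
  have hMz : M z = 3 * N z + B₀ z * (B₀ z + 1) := rfl
  have hpos := (pp k).n_pos
  have hs : (pp k).size = (pp k).n + (pp k).d + (pp k).R + (pp k).keyLen + (pp k).prfKeyLen +
    Nat.size (pp k).p + (pp k).labelLen + (pp k).ctLen + (pp k).srcLen + (pp k).dstLen := rfl
  have hcount : ∀ s : Session, s.count (pp k) ≤ N z := fun s => by
    cases s <;> simp only [Session.count] <;> omega
  have hlen : ∀ s : Session, s.len (pp k) ≤ N z := fun s => by
    cases s <;> simp only [Session.len] <;> omega
  have hcpos : ∀ s : Session, 0 < s.count (pp k) := fun s => by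
    cases s <;> simp only [Session.count] <;> omega
  have main : ∀ (P : RetrievalProtocol) (q' : Polynomial ℕ) (s : Session),
      (∀ k n m : ℕ, P.rounds k n m ≤ q'.eval (k + n + m) ∧ ∀ i < n, ∀ (L : ℕ) (ρ : Store),
        Reach P.receiver (RetrievalProtocol.receiverStore k n m i) L ρ →
          HaltsIn P.receiver ρ (q'.eval (k + n + m + L))) →
      P.rounds k (s.count (pp k)) (s.len (pp k)) ≤ q'.eval (3 * N z) ∧
      ∀ L ρ, L ≤ B₀ z * (B₀ z + 1) → Reach P.receiver
        (RetrievalProtocol.receiverStore k (s.count (pp k)) (s.len (pp k)) 0) L ρ →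
          HaltsIn P.receiver ρ (q'.eval (M z)) := by
    intro P q' s h
    have h₁ := hcount s
    have h₂ := hlen s
    obtain ⟨h₃, h₄⟩ := h k (s.count (pp k)) (s.len (pp k))
    refine ⟨h₃.trans (monotone_eval_nat q' (by omega)), fun L ρ hL hρ => ?_⟩
    exact (h₄ 0 (hcpos s) L ρ hρ).mono (monotone_eval_nat q' (by omega))
  refine ⟨by omega, ⟨by omega, fun s => (hcount s).trans (by omega),
    fun s => (hlen s).trans (by omega), B₀ z, by omega, fun L σ hσ => ?_, fun s => ?_⟩⟩
  · refine (hqa k x L σ hσ).mono ?_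
    change qa.eval z ≤ _
    omega
  · have key : ∃ q', (q' = qp ∨ q' = qo) ∧ ∀ k n m : ℕ,
        (s.protocol pir ot).rounds k n m ≤ q'.eval (k + n + m) ∧ ∀ i < n, ∀ (L : ℕ) (ρ : Store),
        Reach (s.protocol pir ot).receiver (RetrievalProtocol.receiverStore k n m i) L ρ →
          HaltsIn (s.protocol pir ot).receiver ρ (q'.eval (k + n + m + L)) := by
      cases s
      · exact ⟨qo, Or.inr rfl, hqo⟩
      · exact ⟨qo, Or.inr rfl, hqo⟩
      · exact ⟨qp, Or.inl rfl, hqp⟩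
      · exact ⟨qp, Or.inl rfl, hqp⟩
    obtain ⟨q', hq', h⟩ := key
    obtain ⟨h₁, h₂⟩ := main _ q' s h
    constructor
    · rcases hq' with rfl | rfl
      · exact h₁.trans (by omega)
      · exact h₁.trans (by omega)
    · intro L ρ hL hρ
      refine (h₂ L ρ hL hρ).mono ?_
      rcases hq' with rfl | rfl <;> omega

theorem polyBounded_itemTime (pir ot : RetrievalProtocol) {B : ℕ → ℕ} (hB : PolyBounded B) :
    PolyBounded fun z => itemTime pir ot (B z) := by
  have c := PolyBounded.const
  have hs : ∀ R : Cmd, PolyBounded fun z => sessionTime R (B z) := fun R =>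
    (((hB.mul (((c 60).mul hB).add (c 26))).add ((c 97).mul hB)).add ((c (max 5 R.regBound)).mul
      (((c 6).mul (hB.add (((c 2).mul hB).mul hB))).add (c 2)))).add (c 30)
  exact (((hs _).add (hs _)).add ((c 25).mul hB)).add (c 20)

theorem isPPTSimulator_simulatorCmd {pp : ℕ → PublicParams} {pir ot : RetrievalProtocol} {A : Cmd}
    {B : ℕ → ℕ} (pB : PolyBounded B) (hB : ∀ k (x : ServerInput (pp k)),
      (pp k).size ≤ B (k + x.encode.length) ∧
      Bounds pir ot A k (pp k) (corruptStore pir ot k (pp k) x) (B (k + x.encode.length))) :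
    IsPPTSimulator pir ot pp (simulatorCmd pir ot A) := by
  have c := PolyBounded.const
  have pS : PolyBounded fun z => B z + z + B z * (4 * (B z + 1)) :=
    (pB.add PolyBounded.id).add (pB.mul ((c 4).mul (pB.add (c 1))))
  have pF : PolyBounded fun z => 20 * (18 * (B z + z + B z * (4 * (B z + 1))) + 4) +
      B z * (30 * B z + 40) + (B z * (2 * B z + 3) + 3) * itemTime pir ot (B z) + 50 :=
    ((((c 20).mul (((c 18).mul pS).add (c 4))).add (pB.mul (((c 30).mul pB).add (c 40)))).add
      (((pB.mul (((c 2).mul pB).add (c 3))).add (c 3)).mul (polyBounded_itemTime pir ot pB))).add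
      (c 50)
  obtain ⟨q, hq⟩ := pF
  refine ⟨q, fun k x => ?_⟩
  obtain ⟨h₁, h₂⟩ := hB k x
  set z := k + x.encode.length
  have h₃ : ∀ r, (corruptStore pir ot k (pp k) x r).length ≤ B z + z + B z * (4 * (B z + 1)) :=
    fun r => (length_corruptStore_le h₂ r).trans (by gcongr; omega)
  refine (impl_simulatorCmd h₂ h₃).1.mono (le_trans ?_ (hq z))
  have h₄ : (pp k).R ≤ B z := le_trans (by rw [PublicParams.size]; omega) h₁
  have h₅ : (pp k).fieldBits ≤ B z := (pp k).fieldBits_le.trans h₁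
  rw [simulatorTime]
  beta_reduce
  gcongr

end PrivateRouting

namespace PrivateRouting

/-! ## Conclusion -/

theorem Close.of_abs_le {P Q : PMF Bool} {δ : ℝ}
    (h : |(P false).toReal - (Q false).toReal| ≤ δ) : Close (ENNReal.ofReal δ) P Q := by
  have key : ∀ P Q : PMF Bool, (P false).toReal ≤ (Q false).toReal + δ →
      P false ≤ Q false + ENNReal.ofReal δ := by
    intro P Q h
    rw [← ENNReal.ofReal_toReal (P.apply_ne_top false), ← ENNReal.ofReal_toReal
      (Q.apply_ne_top false)]
    exact (ENNReal.ofReal_le_ofReal h).trans ENNReal.ofReal_add_le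
  have := abs_le.1 h
  exact ⟨key P Q (by linarith [this.2]), key Q P (by linarith [this.1])⟩

theorem Close.abs_le {P Q : PMF Bool} {δ : ℝ} (hδ : 0 ≤ δ) (h : Close (ENNReal.ofReal δ) P Q) :
    |(P false).toReal - (Q false).toReal| ≤ δ := by
  have key : ∀ P Q : PMF Bool, P false ≤ Q false + ENNReal.ofReal δ →
      (P false).toReal ≤ (Q false).toReal + δ := by
    intro P Q h
    have := ENNReal.toReal_mono (ENNReal.add_ne_top.2 ⟨Q.apply_ne_top false, ENNReal.ofReal_ne_top⟩) h
    rwa [ENNReal.toReal_add (Q.apply_ne_top false) ENNReal.ofReal_ne_top,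
      ENNReal.toReal_ofReal hδ] at this
  have h₁ := key P Q h.1
  have h₂ := key Q P h.2
  exact _root_.abs_le.2 ⟨by linarith, by linarith⟩

/-- The distinguisher that accepts the word `1`. -/
def bitTester : Cmd := Cmd.branch 0 Cmd.skip Cmd.skip (Cmd.push true 1)

theorem det_bitTester (k : ℕ) (w : Str) :
    Det bitTester (distStore k w) 2
      (if w.head? = some true then Function.update (distStore k w) 1 [true] else distStore k w) := by
  rcases w with _ | ⟨_ | _, w⟩
  · exact Det.branch_nil rfl Det.skip le_rfl
  · exact Det.branch_false (l := w) rfl Det.skip le_rfl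
  · exact Det.branch_true (l := w) rfl Det.push le_rfl

theorem isPPTDistinguisher_bitTester : IsPPTDistinguisher bitTester :=
  ⟨Polynomial.C 2, fun k w => by simpa using (det_bitTester k w).1⟩

theorem acceptProb_bitTester (k : ℕ) (μ : PMF Bool) :
    acceptProb bitTester k (μ.map fun b => [!b]) = (μ false).toReal := by
  have e : ((μ.map fun b => [!b]).bind fun w =>
      (exec bitTester (distStore k w)).map fun σ => σ 1) =
      μ.map fun b => if b then [] else [true] := by
    rw [PMF.bind_map, PMF.map]
    refine pmf_bind_congr fun b _ => ?_
    simp only [Function.comp_apply]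
    rw [(det_bitTester k [!b]).2, PMF.pure_map]
    cases b <;> simp [distStore]
  rw [acceptProb, e, PMF.map_apply, tsum_bool]
  simp

theorem length_itemsCode_le (items : List Item) : (itemsCode items).length ≤ 4 * items.length := by
  induction items with
  | nil => simp [itemsCode]
  | cons a items ih =>
    have : (Item.code a).length ≤ 4 := by
      rcases a with _ | s
      · simp [Item.code]
      · cases s <;> simp [Item.code]
    simp only [itemsCode, List.flatMap_cons, List.length_append, List.length_cons] at *
    omega

theorem length_circuitCode_le (N : ℕ) (C : Circuit) :
    (circuitCode N C).length ≤ C.length * (2 * N + 2) := by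
  induction C with
  | nil => simp [circuitCode]
  | cons g C ih =>
    simp only [circuitCode, List.flatMap_cons, List.length_append, List.length_cons, ones,
      List.length_replicate, List.length_nil] at *
    have h₁ := min_le_right g.1 N
    have h₂ := min_le_right g.2 N
    nlinarith

theorem length_circuitCode_capBound_le {pp : PublicParams} (E : Environment pp) :
    (circuitCode (capBound E) E.circuit).length ≤ E.size * (4 * E.size + 2) := by
  have h₁ : E.size = E.x.encode.length + E.readLen + E.circuit.length := rfl
  have h₂ : capBound E = 2 * E.readLen + E.circuit.length := rfl
  exact (length_circuitCode_le _ _).trans (Nat.mul_le_mul (by omega) (by omega))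

section

variable {pir ot : RetrievalProtocol} {A : Cmd}

theorem length_attackWork_le {k : ℕ} {pp : PublicParams} {E : Environment pp} {items : List Item}
    {j S : ℕ} (hS : ∀ r, (corruptStore pir ot k pp E.x r).length ≤ S) (hn : items.length ≤ S)
    (hj : j ≤ S) (r : ℕ) :
    (attackWork pir ot k E items j r).length ≤ 4 * S + E.size * (4 * E.size + 2) + E.size + 2 := by
  have h₁ := length_itemsCode_le items
  have h₂ := length_circuitCode_capBound_le E
  have h₃ : E.readLen ≤ E.size := by rw [Environment.size]; omega
  have h₄ := hS r
  simp only [attackWork, workStore, Function.update_apply]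
  split_ifs
  all_goals
    try simp only [ones, List.length_replicate, List.length_cons, List.length_nil]
    omega

theorem attackTime_le {pp : PublicParams} {E : Environment pp} {n S B : ℕ} (hn : n ≤ S) :
    attackTime pir ot E n B ≤ B + (S * itemTime pir ot B + 1) +
      (9 * E.size + 52 * E.size + 6 * (2 * B) + E.size * (4 * E.size + 2) *
        (24 * (2 * E.size + E.size * (4 * E.size + 2)) + 16) + 20) + 10 := by
  have h₂ := length_circuitCode_capBound_le E
  have h₃ : E.readLen ≤ E.size := by rw [Environment.size]; omega
  rw [attackTime, decideTime]
  gcongr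

/-- Each item takes at least one unit of the allowance, since `1 ≤ B`. So the schedules in
`Swappable` have bounded length although their contents are arbitrary. -/
theorem Good.length_le {σ₀ σ : Store} {B S n : ℕ} (h : Good A σ₀ B S n σ) (hB : 1 ≤ B) : n ≤ S := by
  have h₁ := h.2 1 one_ne_zero
  have h₂ : n ≤ n * ((B + 1) * B) := Nat.le_mul_of_pos_right _ (by positivity)
  omega

variable {pp : ℕ → PublicParams} {E : ∀ k, Environment (pp k)} {B S : ℕ → ℕ}

theorem negligible_swap (s : Session) (hpriv : (s.protocol pir ot).IsPrivate) (pB : PolyBounded B)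
    (pS : PolyBounded S) (pE : PolyBounded fun k => (E k).size)
    (hB : ∀ k, Bounds pir ot A k (pp k) (corruptStore pir ot k (pp k) (E k).x) (B k))
    (hB1 : ∀ k, 1 ≤ B k) (hBS : ∀ k, B k ≤ S k)
    (hS : ∀ k r, (corruptStore pir ot k (pp k) (E k).x r).length ≤ S k)
    {i : ℕ → ℕ} {items : ℕ → List Item} {σ : ℕ → Store} (hi : ∀ k, i k < s.count (pp k))
    (hσ : ∀ k, Good A (corruptStore pir ot k (pp k) (E k).x) (B k) (S k) ((items k).length + 1)
      (σ k)) :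
    Negligible fun k =>
      |(((s.run pir ot A k (pp k) (i k) (σ k)).bind fun y =>
          restBit pir ot A k (E k) (items k) y.1) false).toReal -
        (((s.run pir ot A k (pp k) 0 (σ k)).bind fun y =>
          restBit pir ot A k (E k) (items k) y.1) false).toReal| := by
  have c := PolyBounded.const
  have hn : ∀ k, (items k).length ≤ S k := fun k => by
    have := (hσ k).length_le (hB1 k)
    omega
  have pC : PolyBounded fun k => (E k).size * (4 * (E k).size + 2) :=
    pE.mul (((c 4).mul pE).add (c 2))
  obtain ⟨qa, hqa⟩ : PolyBounded fun k =>
      4 * S k + (E k).size * (4 * (E k).size + 2) + (E k).size + 2 :=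
    ((((c 4).mul pS).add pC).add pE).add (c 2)
  obtain ⟨qt, hqt⟩ : PolyBounded fun k => B k + (S k * itemTime pir ot (B k) + 1) +
      (9 * (E k).size + 52 * (E k).size + 6 * (2 * B k) + (E k).size * (4 * (E k).size + 2) *
        (24 * (2 * (E k).size + (E k).size * (4 * (E k).size + 2)) + 16) + 20) + 10 :=
    ((pB.add ((pS.mul (polyBounded_itemTime pir ot pB)).add (c 1))).add
      ((((((c 9).mul pE).add ((c 52).mul pE)).add ((c 6).mul ((c 2).mul pB))).add
        (pC.mul (((c 24).mul (((c 2).mul pE).add pC)).add (c 16)))).add (c 20))).add (c 10)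
  set W : ℕ → Store := fun k => attackWork pir ot k (E k) (items k)
    ((s.protocol pir ot).rounds k (s.count (pp k)) (s.len (pp k))) with hW
  have hparts : ∀ k msg, OuterParts (deliver (σ k) msg) (W k) (deliver (RetrievalProtocol.serverStore
      k (s.count (pp k)) (s.len (pp k)) [] (attackAdvice (σ k) (W k))) msg) := fun k =>
    outerParts_attackAdvice _ _ _ _ _
  -- The database is empty: the adversary's store, the schedule and the circuit all reach the server
  -- as advice.
  have h := hpriv (attackCmd pir ot A) (fun k => s.count (pp k)) (fun k => s.len (pp k))
    (fun _ => []) (fun k => attackAdvice (σ k) (W k)) i (fun _ => 0)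
    (pB.of_le fun k => (hB k).count s) (pB.of_le fun k => (hB k).len s) (c 0)
    ⟨qa, fun k r => (length_attackAdvice_le
      (fun r hr => (le_self_add.trans ((hσ k).2 r hr)).trans (by omega))
      (length_attackWork_le (hS k) (hn k) (((hB k).rounds s).trans (hBS k))) r).trans (hqa k)⟩
    ⟨qt, fun k L mem hmem => by
      obtain ⟨L₀, h₀⟩ := (hσ k).1
      exact (haltsIn_attackCmd (hB k) h₀ (hparts k) hmem).mono
        ((attackTime_le (hn k)).trans (hqt k))⟩
    hi (fun k => (Nat.zero_le _).trans_lt (hi k)) bitTester isPPTDistinguisher_bitTester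
  have e : ∀ k j, acceptProb bitTester k ((s.protocol pir ot).view (attackCmd pir ot A) k
      (s.count (pp k)) (s.len (pp k)) [] (attackAdvice (σ k) (W k)) j) =
      (((s.run pir ot A k (pp k) j (σ k)).bind fun y =>
        restBit pir ot A k (E k) (items k) y.1) false).toReal := by
    intro k j
    obtain ⟨L₀, h₀⟩ := (hσ k).1
    rw [RetrievalProtocol.view, map_run_attackCmd (hB k) _ _ _ j h₀ (hparts k),
      acceptProb_bitTester]
    rfl
  simpa only [e] using h

/-- The near-worst choice ranges over index, schedule and store together, separately for each kind
of session; the four bounds are added. -/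
theorem exists_swappable (hpir : pir.IsPrivate) (hot : ot.IsPrivate) (pB : PolyBounded B)
    (pS : PolyBounded S) (pE : PolyBounded fun k => (E k).size)
    (hB : ∀ k, Bounds pir ot A k (pp k) (corruptStore pir ot k (pp k) (E k).x) (B k))
    (hB1 : ∀ k, 1 ≤ B k)
    (hS : ∀ k r, (corruptStore pir ot k (pp k) (E k).x r).length + ((B k + 1) * B k) ≤ S k) :
    ∃ δ : ℕ → ℝ, Negligible δ ∧ (∀ k, 0 ≤ δ k) ∧ ∀ k, Swappable pir ot A k (E k)
      (corruptStore pir ot k (pp k) (E k).x) (B k) (S k) (ENNReal.ofReal (δ k)) := by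
  have hBS : ∀ k, B k ≤ S k := fun k => by have := hS k 0; nlinarith
  have hS' : ∀ k r, (corruptStore pir ot k (pp k) (E k).x r).length ≤ S k := fun k r =>
    le_self_add.trans (hS k r)
  set F : Session → ℕ → ℕ × List Item × Store → ℝ := fun s k c =>
    |(((s.run pir ot A k (pp k) c.1 c.2.2).bind fun y =>
        restBit pir ot A k (E k) c.2.1 y.1) false).toReal -
      (((s.run pir ot A k (pp k) 0 c.2.2).bind fun y =>
        restBit pir ot A k (E k) c.2.1 y.1) false).toReal| with hF
  have hcount : ∀ (s : Session) k, 0 < s.count (pp k) := fun s k => by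
    have := (pp k).n_pos
    cases s <;> simp only [Session.count] <;> omega
  have hpriv : ∀ s : Session, (s.protocol pir ot).IsPrivate := fun s => by
    cases s <;> assumption
  have key : ∀ s : Session, ∃ δ : ℕ → ℝ, Negligible δ ∧ ∀ k c, c.1 < s.count (pp k) ∧
      Good A (corruptStore pir ot k (pp k) (E k).x) (B k) (S k) (c.2.1.length + 1) c.2.2 →
        F s k c ≤ δ k := by
    intro s
    refine exists_negligible_bound (fun k c => abs_nonneg _) (fun k c => ?_) (fun k => ?_)
      fun c hc => ?_
    · have h : ∀ P : PMF Bool, 0 ≤ (P false).toReal ∧ (P false).toReal ≤ 1 := fun P =>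
        ⟨ENNReal.toReal_nonneg, ENNReal.toReal_le_of_le_ofReal zero_le_one
          (by simpa using P.coe_le_one false)⟩
      refine _root_.abs_le.2 ⟨?_, ?_⟩
      · linarith [(h ((s.run pir ot A k (pp k) c.1 c.2.2).bind fun y =>
          restBit pir ot A k (E k) c.2.1 y.1)).1, (h ((s.run pir ot A k (pp k) 0 c.2.2).bind fun y =>
          restBit pir ot A k (E k) c.2.1 y.1)).2]
      · linarith [(h ((s.run pir ot A k (pp k) c.1 c.2.2).bind fun y =>
          restBit pir ot A k (E k) c.2.1 y.1)).2, (h ((s.run pir ot A k (pp k) 0 c.2.2).bind fun y =>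
          restBit pir ot A k (E k) c.2.1 y.1)).1]
    · exact ⟨(0, [], corruptStore pir ot k (pp k) (E k).x), hcount s k, ⟨0, Idle.init _ _⟩,
        fun r _ => by simpa using hS k r⟩
    · exact negligible_swap s (hpriv s) pB pS pE hB hB1 hBS hS' (fun k => (hc k).1)
        (fun k => (hc k).2)
  choose δ hδ hle using key
  have hnonneg : ∀ s k, 0 ≤ δ s k := fun s k => (abs_nonneg _).trans (hle s k
    (0, [], corruptStore pir ot k (pp k) (E k).x) ⟨hcount s k, ⟨0, Idle.init _ _⟩,
      fun r _ => by simpa using hS k r⟩)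
  refine ⟨fun k => δ Session.otKey k + δ Session.otLabel k + δ Session.pirSrc k +
    δ Session.pirDst k, (((hδ _).add (hδ _)).add (hδ _)).add (hδ _), fun k => ?_, fun k => ?_⟩
  · have := fun s => hnonneg s k
    have h₁ := this Session.otKey
    have h₂ := this Session.otLabel
    have h₃ := this Session.pirSrc
    have h₄ := this Session.pirDst
    positivity
  · intro s i items σ hi hσ
    refine Close.of_abs_le ((hle s k (i, items, σ) ⟨hi, hσ⟩).trans ?_)
    have h₁ := hnonneg Session.otKey k
    have h₂ := hnonneg Session.otLabel k
    have h₃ := hnonneg Session.pirSrc k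
    have h₄ := hnonneg Session.pirDst k
    cases s <;> linarith

theorem negligible_privacyAdvantage (hpp : PolyBounded fun k => (pp k).size)
    (alg : ℕ → LocalAlgorithms) (hpir : pir.IsPrivate) (hot : ot.IsPrivate)
    (pB : PolyBounded B) (hB1 : ∀ z, 1 ≤ B z)
    (hB : ∀ k (x : ServerInput (pp k)), (pp k).size ≤ B (k + x.encode.length) ∧
      Bounds pir ot A k (pp k) (corruptStore pir ot k (pp k) x) (B (k + x.encode.length)))
    (pE : PolyBounded fun k => (E k).size) :
    Negligible fun k =>
      privacyAdvantage pir ot (alg k) A (simulatorCmd pir ot A) k (pp k) (E k) := by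
  have c := PolyBounded.const
  have hx : ∀ k, (E k).x.encode.length ≤ (E k).size := fun k => by
    rw [Environment.size]; omega
  have pB' : PolyBounded fun k => B (k + (E k).x.encode.length) :=
    pB.comp (PolyBounded.id.add (pE.of_le hx))
  set B' : ℕ → ℕ := fun k => B (k + (E k).x.encode.length)
  have hB' : ∀ k, Bounds pir ot A k (pp k) (corruptStore pir ot k (pp k) (E k).x) (B' k) :=
    fun k => (hB k (E k).x).2
  have hB1' : ∀ k, 1 ≤ B' k := fun k => hB1 _
  have pN : PolyBounded fun k => (pp k).R * (2 * (pp k).fieldBits + 3) + 3 :=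
    ((hpp.of_le fun k => by rw [PublicParams.size]; omega).mul (((c 2).mul
      (hpp.of_le fun k => (pp k).fieldBits_le)).add (c 3))).add (c 3)
  have pS : PolyBounded fun k => B' k + (E k).size + (pp k).size * (4 * ((pp k).size + 1)) +
      ((pp k).R * (2 * (pp k).fieldBits + 3) + 3) * ((B' k + 1) * B' k) :=
    ((pB'.add pE).add (hpp.mul ((c 4).mul (hpp.add (c 1))))).add
      (pN.mul ((pB'.add (c 1)).mul pB'))
  -- The last summand is the allowance of `Good` for the whole schedule, so that the initial store
  -- qualifies.
  set S : ℕ → ℕ := fun k => B' k + (E k).size + (pp k).size * (4 * ((pp k).size + 1)) +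
      ((pp k).R * (2 * (pp k).fieldBits + 3) + 3) * ((B' k + 1) * B' k) with hSdef
  have hS : ∀ k r, (corruptStore pir ot k (pp k) (E k).x r).length +
      (allItems (pp k)).length * ((B' k + 1) * B' k) ≤ S k := fun k r => by
    have h₁ := length_corruptStore_le (hB' k) r
    have h₂ := hx k
    rw [length_allItems]
    simp only [hSdef]
    omega
  have hpos : ∀ k, 1 ≤ (allItems (pp k)).length := fun k => by rw [length_allItems]; omega
  obtain ⟨δ, hδ, hδ0, hswap⟩ := exists_swappable hpir hot pB' pS pE hB' hB1' fun k r =>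
    (Nat.add_le_add_left (Nat.le_mul_of_pos_left _ (hpos k)) _).trans (hS k r)
  have pM : PolyBounded fun k => (pp k).R * (2 * (pp k).fieldBits + 2) + 2 :=
    pN.of_le fun k => by gcongr <;> omega
  refine (hδ.mul_polyBounded pM).of_le (fun k => abs_nonneg _) fun k => ?_
  have hclose := close_realBit (alg k) (hB' k) (hswap k)
    ⟨⟨0, Idle.init _ _⟩, fun r _ => hS k r⟩
  rw [← idealBit_eq (hB' k) fun r => le_self_add.trans (hS k r), ← ENNReal.ofReal_natCast,
    ← ENNReal.ofReal_mul (Nat.cast_nonneg _)] at hclose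
  exact hclose.abs_le (mul_nonneg (Nat.cast_nonneg _) (hδ0 k))

end

end PrivateRouting

theorem mainTheorem2
    (pp : ℕ → PrivateRouting.PublicParams)
    (hpp : PrivateRouting.PolyBounded fun k => (pp k).size)
    (alg : ℕ → PrivateRouting.LocalAlgorithms)
    (pir ot : PrivateRouting.RetrievalProtocol)
    (hpir : pir.IsEfficient) (hot : ot.IsEfficient)
    (hpir_private : pir.IsPrivate) (hot_private : ot.IsPrivate)
    (adversary : PrivateRouting.Cmd)
    (hadversary : PrivateRouting.IsPPTServer pir ot pp adversary) :
    ∃ simulator : PrivateRouting.Cmd, PrivateRouting.IsPPTSimulator pir ot pp simulator ∧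
      ∀ E : ∀ k, PrivateRouting.Environment (pp k),
        PrivateRouting.PolyBounded (fun k => (E k).size) →
        PrivateRouting.Negligible fun k =>
          PrivateRouting.privacyAdvantage pir ot (alg k) adversary simulator k (pp k) (E k) := by
  obtain ⟨B, pB, hB1, hB⟩ := PrivateRouting.exists_bounds hpp hpir hot hadversary
  exact ⟨PrivateRouting.simulatorCmd pir ot adversary,
    PrivateRouting.isPPTSimulator_simulatorCmd pB hB, fun E pE =>
      PrivateRouting.negligible_privacyAdvantage hpp alg hpir_private hot_private pB hB1 hB pE⟩
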